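/- Let $k\ge 1$ be an integer. Then there is a constant $C$ (depending only on $k$) such that the following holds. Let $L_i(n)=a_in+b_i$ ($1\le i\le k$; $a_i,b_i\in\mathbb Z$, $a_i>0$) be distinct linear functions which are admissible (for every prime $p$ there is an integer $n$ with $p\nmid L_i(n)$ for all $i$) and normalised: all $a_i$ have the same prime factors, none of these primes divides any $b_j$, and for $i\neq j$ every prime factor of $a_ib_j-a_jb_i$ divides every $a_l$. Put $A=\prod_{i}a_i$, $\Pi(n)=\prod_i L_i(n)$ and $$\mathfrak S(\mathcal L)=\prod_{p\mid A}\Bigl(1-\frac1p\Bigr)^{-k}\prod_{p\nmid A}\Bigl(1-\frac kp\Bigr)\Bigl(1-\frac1p\Bigr)^{-k}.$$ Let $P$ be a real polynomial. Let $\rho,\eta>0$, and let $W_0:[0,\rho]\to\mathbb R_{\ge0}$ be piecewise smooth (for some finite partition of $[0,\rho]$, $W_0$ agrees on each open piece with a function that is smooth on the closure of the piece). For real $N$, let $R_1=N^{r_1}$ and $R_2=N^{r_2}$, where $r_1,r_2$ may vary with $N$ subject to $r_1\ge r_2\ge\eta$ and $r_1/r_2\le\rho$ (in particular, $r_1\ge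 r_2>0$ may be fixed, with $\rho=r_1/r_2$ and $\eta=r_2$). For square-free $d$ coprime to $A$ put $f(d)=\prod_{p\mid d}\frac pk$ and $f_1(d)=\prod_{p\mid d}\frac{p-k}k$. For integers $r\geq 1$ put $y_r=\mu^2(r)\,\mathfrak S(\mathcal L)\,P\bigl(\frac{\log (R_2/r)}{\log R_2}\bigr)$ if $r\le R_2$ and $(r,A)=1$, and $y_r=0$ otherwise. For $d\ge1$ put $$\lambda_d=\mu(d)f(d)\sum_{r}\frac{y_{rd}}{f_1(rd)}$$ for $d$ square-free and coprime to $A$, the sum being over square-free $r\ge 1$ coprime to $A$ with $rd$ square-free, and $\lambda_d=0$ for all other $d$. Then, for all sufficiently large $N$ with $R_1R_2^2\le N(\log N)^{-C}$, $$\sum_{N\le n\le 2N}\Bigl(\sum_{\substack{p\mid\Pi(n)\\p\le R_1}}W_0\Bigl(\frac{\log p}{\log R_2}\Bigr)\Bigr)\Bigl(\sum_{\substack{d\mid\Pi(n)\\d\le R_2}}\lambda_d\Bigr)^2=\frac{\mathfrak S(\mathcal L)N(\log R_2)^k}{(k-1)!}J_0+O\bigl(N(\log N)^{k-1}(\log\log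 N)^2\bigr),$$ where $p$ runs over primes, $J_0=J_{01}+J_{02}+J_{03}$ and $$J_{01}=k\int_0^1\frac{W_0(y)}y\int_0^{1-y}\bigl(P(1-x)-P(1-x-y)\bigr)^2x^{k-1}\,dx\,dy,$$ $$J_{02}=k\int_0^1\frac{W_0(y)}y\int_{1-y}^1P(1-x)^2x^{k-1}\,dx\,dy,\qquad J_{03}=k\int_1^{r_1/r_2}\frac{W_0(y)}y\int_0^1P(1-x)^2x^{k-1}\,dx\,dy.$$ The implied constant and the threshold for "sufficiently large" depend only on $k,A,P,\eta,\rho$ and $W_0$. -/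

import Mathlib

namespace WeightedSieve

open scoped ContDiff

/-- `W` is piecewise smooth on `[u, v]`: for some finite partition `u = t₀ < t₁ < ⋯ < tₘ = v`, on each
open piece `W` coincides with a function that is smooth up to and including the endpoints of that
piece. Jumps, and arbitrary values at the partition points, are allowed. -/
def PiecewiseSmoothOn (W : ℝ → ℝ) (u v : ℝ) : Prop :=
  ∃ (m : ℕ) (t : Fin (m + 1) → ℝ), StrictMono t ∧ t 0 = u ∧ t (Fin.last m) = v ∧
    ∀ i : Fin m, ∃ g : ℝ → ℝ,
      ContDiffOn ℝ ∞ g (Set.Icc (t i.castSucc) (t i.succ)) ∧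
      Set.EqOn W g (Set.Ioo (t i.castSucc) (t i.succ))

/-- The `k` integer linear functions `Lᵢ(n) = aᵢ n + bᵢ` are distinct, form an admissible `k`-tuple, and
are normalised. -/
structure Normalised {k : ℕ} (a : Fin k → ℕ) (b : Fin k → ℤ) : Prop where
  /-- For every prime `p` there is an integer at which no `Lᵢ` is divisible by `p`. -/
  admissible : ∀ p : ℕ, p.Prime → ∃ n : ℤ, ∀ i, ¬ ((p : ℤ) ∣ (a i : ℤ) * n + b i)
  distinct : ∀ i j, i ≠ j → (a i, b i) ≠ (a j, b j)
  pos : ∀ i, 0 < a i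
  /-- The leading coefficients are composed of the same primes. -/
  same_primes : ∀ i j, ∀ p : ℕ, p.Prime → p ∣ a i → p ∣ a j
  coprime : ∀ i j, ∀ p : ℕ, p.Prime → p ∣ a i → ¬ ((p : ℤ) ∣ b j)
  cross : ∀ i j, i ≠ j → ∀ p : ℕ, p.Prime → (p : ℤ) ∣ (a i : ℤ) * b j - (a j : ℤ) * b i →
    ∀ l, p ∣ a l

/-- `Π(n) = ∏ᵢ (aᵢ n + bᵢ)`. -/
def bigPi {k : ℕ} (a : Fin k → ℕ) (b : Fin k → ℤ) (n : ℕ) : ℤ :=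
  ∏ i, ((a i : ℤ) * (n : ℤ) + b i)

/-- The local factor at `p` of the singular series. -/
noncomputable def localFactor (k A p : ℕ) : ℝ :=
  if p ∣ A then ((1 - 1 / (p : ℝ)) ^ k)⁻¹
  else (1 - (k : ℝ) / (p : ℝ)) * ((1 - 1 / (p : ℝ)) ^ k)⁻¹

/-- The singular series, as a function of `k` and `A = ∏ᵢ aᵢ`. -/
noncomputable def singularSeries (k A : ℕ) : ℝ :=
  ∏' p : Nat.Primes, localFactor k A p

/-- `f(d) = ∏_{p ∣ d} p / k`. -/
noncomputable def f (k d : ℕ) : ℝ :=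
  ∏ p ∈ d.primeFactors, (p : ℝ) / (k : ℝ)

/-- `f₁(d) = ∏_{p ∣ d} (p - k) / k`. -/
noncomputable def f₁ (k d : ℕ) : ℝ :=
  ∏ p ∈ d.primeFactors, ((p : ℝ) - (k : ℝ)) / (k : ℝ)

/-- `y_r`, for the polynomial `P` and the level `R`. -/
noncomputable def y (k A : ℕ) (P : Polynomial ℝ) (R : ℝ) (r : ℕ) : ℝ :=
  if (r : ℝ) ≤ R ∧ r.Coprime A then
    (ArithmeticFunction.moebius r : ℝ) ^ 2 * singularSeries k A *
      P.eval (Real.log (R / (r : ℝ)) / Real.log R)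
  else 0

/-- The sieve weight `λ_d = μ(d) f(d) ∑_r y_{rd} / f₁(rd)`, over positive square-free `r` coprime to `A`. The sum is cut
at `r ≤ R`, since `y_{rd} = 0` for `rd > R`. -/
noncomputable def sieveWeight (k A : ℕ) (P : Polynomial ℝ) (R : ℝ) (d : ℕ) : ℝ :=
  (ArithmeticFunction.moebius d : ℝ) * f k d *
    ∑ r ∈ Finset.Icc 1 ⌊R⌋₊ with Squarefree r ∧ r.Coprime A,
      y k A P R (r * d) / f₁ k (r * d)

/-- The sum over integers `n` with `N ≤ n ≤ 2N` (`N` real) of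
`(∑_{p ∣ Π(n), p ≤ R₁} W(log p / log R₂)) * (∑_{d ∣ Π(n), d ≤ R₂} λ_d)²`. -/
noncomputable def weightedSum {k : ℕ} (a : Fin k → ℕ) (b : Fin k → ℤ) (P : Polynomial ℝ)
    (W : ℝ → ℝ) (N R₁ R₂ : ℝ) : ℝ :=
  ∑ n ∈ Finset.Icc ⌈N⌉₊ ⌊2 * N⌋₊,
    (∑ p ∈ (Finset.Icc 1 ⌊R₁⌋₊).filter (fun p : ℕ => p.Prime ∧ (p : ℤ) ∣ bigPi a b n),
      W (Real.log (p : ℝ) / Real.log R₂)) *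
    (∑ d ∈ (Finset.Icc 1 ⌊R₂⌋₊).filter (fun d : ℕ => (d : ℤ) ∣ bigPi a b n),
      sieveWeight k (∏ i, a i) P R₂ d) ^ 2

noncomputable def J₀₁ (k : ℕ) (P : Polynomial ℝ) (W : ℝ → ℝ) : ℝ :=
  (k : ℝ) * ∫ y in (0 : ℝ)..1, W y / y *
    ∫ x in (0 : ℝ)..(1 - y), (P.eval (1 - x) - P.eval (1 - x - y)) ^ 2 * x ^ (k - 1)

noncomputable def J₀₂ (k : ℕ) (P : Polynomial ℝ) (W : ℝ → ℝ) : ℝ :=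
  (k : ℝ) * ∫ y in (0 : ℝ)..1, W y / y *
    ∫ x in (1 - y)..(1 : ℝ), (P.eval (1 - x)) ^ 2 * x ^ (k - 1)

/-- The last integral; `u` stands for `r₁ / r₂`. -/
noncomputable def J₀₃ (k : ℕ) (P : Polynomial ℝ) (W : ℝ → ℝ) (u : ℝ) : ℝ :=
  (k : ℝ) * ∫ y in (1 : ℝ)..u, W y / y *
    ∫ x in (0 : ℝ)..1, (P.eval (1 - x)) ^ 2 * x ^ (k - 1)

noncomputable def J₀ (k : ℕ) (P : Polynomial ℝ) (W : ℝ → ℝ) (u : ℝ) : ℝ :=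
  J₀₁ k P W + J₀₂ k P W + J₀₃ k P W u

/-- The product defining the singular series converges (absolutely). -/
theorem multipliable_localFactor (k A : ℕ) (hA : A ≠ 0) :
    Multipliable (fun p : Nat.Primes => localFactor k A p) := by
  have hb : ∀ x : ℝ, 0 ≤ x → x ≤ 1 / 2 →
      (1 - x) ^ k ≤ 1 - k * x + (k : ℝ) ^ 2 * x ^ 2 := by
    intro x h0 h1
    induction k with
    | zero => simp
    | succ n ih =>
      have hx : 0 ≤ 1 - x := by linarith
      have h2 := mul_le_mul_of_nonneg_right ih hx
      have hn : (0 : ℝ) ≤ n := Nat.cast_nonneg n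
      rw [pow_succ]
      refine h2.trans ?_
      push_cast
      have h3 : 0 ≤ (n : ℝ) ^ 2 * x ^ 3 := by positivity
      have h4 : 0 ≤ (n : ℝ) * x ^ 2 := by positivity
      nlinarith [sq_nonneg x]
  have hsum : Summable (fun p : Nat.Primes => ((p : ℕ) : ℝ)⁻¹ ^ 2) := by
    have h := (Real.summable_nat_pow_inv (p := 2)).2 (by norm_num)
    have h' := h.comp_injective (i := fun p : Nat.Primes => (p : ℕ)) Nat.Primes.coe_nat_injective
    simpa [Function.comp_def, inv_pow] using h'
  have hs : Summable (fun p : Nat.Primes => localFactor k A p - 1) := by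
    refine Summable.of_norm_bounded_eventually (hsum.mul_left (2 ^ k * (k : ℝ) ^ 2)) ?_
    have hfin : {p : Nat.Primes | (p : ℕ) ∣ A}.Finite := by
      refine Set.Finite.of_finite_image (f := fun p : Nat.Primes => (p : ℕ)) ?_
        Nat.Primes.coe_nat_injective.injOn
      refine (Set.finite_le_nat A).subset ?_
      rintro _ ⟨p, hp, rfl⟩
      exact Nat.le_of_dvd (Nat.pos_of_ne_zero hA) hp
    filter_upwards [hfin.compl_mem_cofinite] with p hp
    have hp' : ¬ (p : ℕ) ∣ A := hp
    have hp2 : (2 : ℝ) ≤ ((p : ℕ) : ℝ) := by exact_mod_cast p.2.two_le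
    set x : ℝ := ((p : ℕ) : ℝ)⁻¹ with hx
    have hx0 : 0 ≤ x := by positivity
    have hx1 : x ≤ 1 / 2 := by
      rw [hx, one_div]
      exact inv_anti₀ (by norm_num) hp2
    have hpos : 0 < (1 - x) ^ k := pow_pos (by linarith) k
    have hlow : (1 / 2 : ℝ) ^ k ≤ (1 - x) ^ k :=
      pow_le_pow_left₀ (by norm_num) (by linarith) k
    have hbern : 1 - k * x ≤ (1 - x) ^ k := by
      have := one_add_mul_le_pow (a := -x) (by linarith) k
      simpa [sub_eq_add_neg] using this
    have hup := hb x hx0 hx1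
    have heq : localFactor k A p - 1 = ((1 - k * x) - (1 - x) ^ k) * ((1 - x) ^ k)⁻¹ := by
      have hdef : localFactor k A p = (1 - k * x) * ((1 - x) ^ k)⁻¹ := by
        rw [localFactor, if_neg hp', one_div, div_eq_mul_inv]
      rw [hdef]
      field_simp
    rw [heq, norm_mul, Real.norm_eq_abs, Real.norm_eq_abs, abs_of_pos (inv_pos.2 hpos)]
    have h1 : |(1 - k * x) - (1 - x) ^ k| ≤ (k : ℝ) ^ 2 * x ^ 2 := by
      rw [abs_le]
      constructor
      · linarith
      · have : 0 ≤ (k : ℝ) ^ 2 * x ^ 2 := by positivity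
        linarith
    have h2 : ((1 - x) ^ k)⁻¹ ≤ 2 ^ k := by
      have := inv_anti₀ (by positivity) hlow
      simpa using this
    calc _ ≤ (k : ℝ) ^ 2 * x ^ 2 * 2 ^ k :=
          mul_le_mul h1 h2 (inv_pos.2 hpos).le (by positivity)
      _ = _ := by ring
  have := Real.multipliable_one_add_of_summable hs
  simpa using this

end WeightedSieve

/-! Expand the square and interchange summations. Primes dividing A never divide Π(n). For each
remaining prime p and squarefree d, e coprime to A, the inner sum counts the n in [N, 2N] with [d,
e, p] | Π(n). Normalisation gives Π exactly k roots modulo every prime not dividing A, so this count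
is N/f([d, e, p]) + O(k^ω([d, e, p])). The errors add up to at most a constant times R₁ (∑ |λ_d|
k^ω(d))² ≪ R₁ R₂² (1 + log R₂)^(2k+2), which the level condition absorbs when C = 2k + 2.

The main term is a quadratic form in λ for each p. Selberg's diagonalisation, carried out with p as
an extra modulus (`sum_sieveWeight_lcm`), turns it into (k/p) ∑_{p ∤ r} (y_r - y_{rp})² / f₁(r). The
function 1/f₁ behaves like the k-fold divisor function over n: it is the k-th Dirichlet power of 1/n
convolved with an absolutely summable function whose sum is 1/𝔖 (`sum_sieveDensity_asymptotic`).
Partial summation in x = log r / log R₂ then gives 𝔖 (log R₂)^k / (k-1)! times an integral depending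
on y = log p / log R₂. The integral is cut at x = 1 - y, where rp leaves the support of y: below the
cut lies the integrand of J₀₁, above it that of J₀₂, and for p > R₂ only the integrand of J₀₃
remains. Dropping the condition p ∤ r costs only O((log R₂)^(k-1)), because y_r - y_{rp} is small
when p is small (`sum_multiples_le`).

Finally the sum over p is evaluated by Mertens' theorem in the form ∑ (log p / p) H(log p / L) = L ∫
H + O(1), valid for piecewise smooth H. The factor 1/y causes no trouble at 0, since the integrals
it multiplies for y ≤ 1 are polynomials in y vanishing at 0. The errors of the individual primes
carry a factor 1/p, and ∑ 1/p ≪ log log N accounts for the iterated logarithm in the error term. -/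

namespace WeightedSieve

open Finset MeasureTheory ArithmeticFunction
open scoped ContDiff

/-! ### Partial summation and Mertens' first theorem -/

/-- Partial summation in integral form: a finite weighted point set whose distribution function is
within `E` of `∫ m` integrates `C¹` functions like the density `m`. -/
theorem abs_sum_mul_sub_integral_le {ι : Type*} (s : Finset ι) (w x : ι → ℝ) {u v E B₀ B₁ : ℝ}
    (huv : u ≤ v) (hx : ∀ i ∈ s, x i ∈ Set.Icc u v) (m F F' : ℝ → ℝ)
    (hm : ContinuousOn m (Set.Icc u v)) (hF : ContinuousOn F (Set.Icc u v))
    (hF' : ContinuousOn F' (Set.Icc u v)) (hd : ∀ t ∈ Set.Ioo u v, HasDerivAt F (F' t) t)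
    (hD : ∀ t ∈ Set.Icc u v, |∑ i ∈ s with x i ≤ t, w i - ∫ z in u..t, m z| ≤ E)
    (hB₀ : |F v| ≤ B₀) (hB₁ : ∀ t ∈ Set.Icc u v, |F' t| ≤ B₁) :
    |∑ i ∈ s, w i * F (x i) - ∫ t in u..v, F t * m t| ≤ E * (B₀ + (v - u) * B₁) := by
  classical
  set M : ℝ → ℝ := fun t => ∫ z in u..t, m z with hM
  have huIcc : Set.uIcc u v = Set.Icc u v := Set.uIcc_of_le huv
  have hmint : IntervalIntegrable m volume u v := (huIcc ▸ hm).intervalIntegrable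
  have hF'int : IntervalIntegrable F' volume u v := (huIcc ▸ hF').intervalIntegrable
  have hMc : ContinuousOn M (Set.Icc u v) := by
    have := intervalIntegral.continuousOn_primitive_interval (μ := volume) (f := m) (a := u) (b := v)
      (by rw [huIcc]; exact hm.integrableOn_Icc)
    rwa [huIcc] at this
  have hMd : ∀ t ∈ Set.Ioo u v, HasDerivAt M (m t) t := by
    intro t ht
    have hnt : Set.Icc u v ∈ nhds t := Icc_mem_nhds ht.1 ht.2
    refine intervalIntegral.integral_hasDerivAt_right ?_ ?_ ?_
    · refine hmint.mono_set ?_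
      rw [huIcc, Set.uIcc_of_le ht.1.le]
      exact Set.Icc_subset_Icc le_rfl ht.2.le
    · exact ContinuousOn.stronglyMeasurableAtFilter_nhdsWithin hm measurableSet_Icc t |>.filter_mono
        (by rw [nhdsWithin_eq_nhds.2 hnt])
    · exact hm.continuousAt hnt
  have hparts : ∫ t in u..v, F t * m t = F v * M v - F u * M u - ∫ t in u..v, F' t * M t := by
    refine intervalIntegral.integral_mul_deriv_eq_deriv_mul_of_hasDerivAt (by rwa [huIcc])
      (by rwa [huIcc]) ?_ ?_ hF'int hmint
    · rw [min_eq_left huv, max_eq_right huv]; exact hd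
    · rw [min_eq_left huv, max_eq_right huv]; exact hMd
  have hMu : M u = 0 := by simp [hM]
  have hind : ∀ i ∈ s, IntervalIntegrable (fun t => F' t * (if x i ≤ t then w i else 0)) volume u v := by
    intro i _
    have : (fun t => F' t * (if x i ≤ t then w i else 0)) =
        Set.indicator (Set.Ici (x i)) (fun t => F' t * w i) := by
      funext t
      by_cases h : x i ≤ t <;> simp [Set.indicator, h]
    rw [this, intervalIntegrable_iff]
    have h1 : IntegrableOn (fun t => F' t * w i) (Set.uIoc u v) volume :=
      (intervalIntegrable_iff.1 (hF'int.mul_const (w i)))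
    exact h1.indicator measurableSet_Ici
  -- Writing F(xᵢ) as F(v) minus the integral of F' over [xᵢ, v] turns the sum over points into an
  -- ordinary integral against the distribution function, so no Stieltjes integral is needed.
  have hpt : ∀ i ∈ s, w i * F (x i) =
      w i * F v - ∫ t in u..v, F' t * (if x i ≤ t then w i else 0) := by
    intro i hi
    obtain ⟨h1, h2⟩ := hx i hi
    have hsub1 : Set.uIcc u (x i) ⊆ Set.uIcc u v := by
      rw [huIcc, Set.uIcc_of_le h1]; exact Set.Icc_subset_Icc le_rfl h2
    have hsub2 : Set.uIcc (x i) v ⊆ Set.uIcc u v := by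
      rw [huIcc, Set.uIcc_of_le h2]; exact Set.Icc_subset_Icc h1 le_rfl
    have hsplit := intervalIntegral.integral_add_adjacent_intervals
      ((hind i hi).mono_set hsub1) ((hind i hi).mono_set hsub2)
    have e1 : ∫ t in u..(x i), F' t * (if x i ≤ t then w i else 0) = 0 := by
      rw [intervalIntegral.integral_of_le h1, integral_Ioc_eq_integral_Ioo]
      rw [setIntegral_congr_fun (g := fun _ => (0 : ℝ)) measurableSet_Ioo]
      · simp
      · intro t ht
        simp [not_le.2 ht.2]
    have e2 : ∫ t in (x i)..v, F' t * (if x i ≤ t then w i else 0) = w i * (F v - F (x i)) := by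
      have h3 : ∫ t in (x i)..v, F' t * (if x i ≤ t then w i else 0) = ∫ t in (x i)..v, F' t * w i := by
        refine intervalIntegral.integral_congr ?_
        intro t ht
        rw [Set.uIcc_of_le h2] at ht
        simp [ht.1]
      rw [h3, intervalIntegral.integral_mul_const,
        intervalIntegral.integral_eq_sub_of_hasDerivAt_of_le h2
          (hF.mono (Set.Icc_subset_Icc h1 le_rfl))
          (fun t ht => hd t ⟨h1.trans_lt ht.1, ht.2⟩) (hF'int.mono_set hsub2)]
      ring
    rw [← hsplit, e1, e2]; ring
  set D : ℝ → ℝ := fun t => ∑ i ∈ s with x i ≤ t, w i with hDdef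
  have hsum : ∑ i ∈ s, w i * F (x i) = F v * D v - ∫ t in u..v, F' t * D t := by
    rw [Finset.sum_congr rfl hpt, Finset.sum_sub_distrib,
      ← intervalIntegral.integral_finsetSum hind]
    congr 1
    · rw [← Finset.sum_mul, mul_comm]
      congr 1
      simp only [hDdef]
      rw [Finset.filter_true_of_mem (fun i hi => (hx i hi).2)]
    · congr 1
      funext t
      simp only [hDdef]
      rw [← Finset.mul_sum, Finset.sum_filter]
  have hDint : IntervalIntegrable (fun t => F' t * D t) volume u v := by
    have e : (fun t => F' t * D t) =
        ∑ i ∈ s, fun t => F' t * (if x i ≤ t then w i else 0) := by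
      funext t
      simp only [hDdef]
      rw [Finset.sum_apply, ← Finset.mul_sum, Finset.sum_filter]
    rw [e]
    exact IntervalIntegrable.sum s hind
  have hMint : IntervalIntegrable (fun t => F' t * M t) volume u v :=
    hF'int.mul_continuousOn (by rwa [huIcc])
  have key : ∑ i ∈ s, w i * F (x i) - ∫ t in u..v, F t * m t =
      F v * (D v - M v) - ∫ t in u..v, F' t * (D t - M t) := by
    rw [hsum, hparts, hMu]
    have : ∫ t in u..v, F' t * (D t - M t) =
        (∫ t in u..v, F' t * D t) - ∫ t in u..v, F' t * M t := by
      rw [← intervalIntegral.integral_sub hDint hMint]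
      congr 1; funext t; ring
    rw [this]; ring
  have hE : 0 ≤ E := (abs_nonneg _).trans (hD u ⟨le_rfl, huv⟩)
  have hb1 : |F v * (D v - M v)| ≤ B₀ * E := by
    rw [abs_mul]
    exact mul_le_mul hB₀ (hD v ⟨huv, le_rfl⟩) (abs_nonneg _) ((abs_nonneg _).trans hB₀)
  have hb2 : |∫ t in u..v, F' t * (D t - M t)| ≤ B₁ * E * (v - u) := by
    have := intervalIntegral.norm_integral_le_of_norm_le_const (a := u) (b := v)
      (f := fun t => F' t * (D t - M t)) (C := B₁ * E) ?_
    · rwa [Real.norm_eq_abs, abs_of_nonneg (sub_nonneg.2 huv)] at this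
    · intro t ht
      rw [Set.uIoc_of_le huv] at ht
      have ht' : t ∈ Set.Icc u v := ⟨ht.1.le, ht.2⟩
      rw [norm_mul, Real.norm_eq_abs, Real.norm_eq_abs]
      exact mul_le_mul (hB₁ t ht') (hD t ht') (abs_nonneg _) ((abs_nonneg _).trans (hB₁ t ht'))
  rw [key]
  calc _ ≤ B₀ * E + B₁ * E * (v - u) := (abs_sub _ _).trans (add_le_add hb1 hb2)
    _ = _ := by ring

/-- Mertens' first theorem. -/
theorem mertens_nat : ∃ K : ℝ, ∀ n : ℕ, 1 ≤ n →
    |∑ p ∈ Icc 1 n with p.Prime, Real.log p / p - Real.log n| ≤ K := by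
  have hsummable : Summable (fun n : ℕ => 4 * (1 / (n : ℝ) ^ (3 / 2 : ℝ))) :=
    (Real.summable_one_div_nat_rpow.2 (by norm_num)).mul_left 4
  set S := ∑' n : ℕ, 4 * (1 / (n : ℝ) ^ (3 / 2 : ℝ)) with hS
  have hterm : ∀ p : ℕ, p.Prime →
      Real.log p / ((p : ℝ) * (p - 1)) ≤ 4 * (1 / (p : ℝ) ^ (3 / 2 : ℝ)) := by
    intro p hp
    have hp2 : (2 : ℝ) ≤ p := by exact_mod_cast hp.two_le
    have hp0 : (0 : ℝ) < p := by linarith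
    have h1 : Real.log p ≤ 2 * (p : ℝ) ^ (1 / 2 : ℝ) := by
      have := Real.log_le_rpow_div hp0.le (ε := 1 / 2) (by norm_num)
      linarith
    have h2 : (p : ℝ) ^ (1 / 2 : ℝ) * (p : ℝ) ^ (3 / 2 : ℝ) = (p : ℝ) ^ 2 := by
      rw [← Real.rpow_add hp0]; norm_num
    have h3 : 0 < (p : ℝ) ^ (3 / 2 : ℝ) := Real.rpow_pos_of_pos hp0 _
    rw [div_le_iff₀ (by nlinarith), mul_one_div, div_mul_eq_mul_div, le_div_iff₀ h3]
    calc Real.log p * (p : ℝ) ^ (3 / 2 : ℝ) ≤ 2 * (p : ℝ) ^ (1 / 2 : ℝ) * (p : ℝ) ^ (3 / 2 : ℝ) := by gcongr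
      _ = 2 * (p : ℝ) ^ 2 := by rw [mul_assoc, h2]
      _ ≤ 4 * (p * (p - 1)) := by nlinarith
  refine ⟨S + 1 + Real.log 4, fun n hn => ?_⟩
  have hn0 : (0 : ℝ) < n := by exact_mod_cast hn
  have hprimes : (n.factorial).factorization.support = (Icc 1 n).filter Nat.Prime := by
    ext p
    simp only [Nat.support_factorization, Nat.mem_primeFactors, mem_filter, mem_Icc]
    constructor
    · rintro ⟨h1, h2, _⟩
      exact ⟨⟨h1.one_lt.le, (h1.dvd_factorial).1 h2⟩, h1⟩
    · rintro ⟨⟨_, h2⟩, h1⟩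
      exact ⟨h1, (h1.dvd_factorial).2 h2, n.factorial_ne_zero⟩
  have hlog : Real.log (n.factorial : ℝ) =
      ∑ p ∈ Icc 1 n with p.Prime, (n.factorial.factorization p : ℝ) * Real.log p := by
    rw [Real.log_nat_eq_sum_factorization, Finsupp.sum, hprimes]
  have hup : Real.log (n.factorial : ℝ) ≤ n * Real.log n := by
    rw [← Real.log_pow]
    refine Real.log_le_log (by exact_mod_cast n.factorial_pos) ?_
    exact_mod_cast n.factorial_le_pow
  have hlow : n * Real.log n - n ≤ Real.log (n.factorial : ℝ) := by
    have h := Real.pow_div_factorial_le_exp (x := n) hn0.le n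
    have hf : (0 : ℝ) < n.factorial := by exact_mod_cast n.factorial_pos
    have := Real.log_le_log (by positivity) h
    rw [Real.log_exp, Real.log_div (by positivity) hf.ne', Real.log_pow] at this
    linarith
  -- Legendre's formula bounds the exponent of p in n! between n/p - 1 and n/(p - 1). The loss of 1
  -- costs θ(n) ≤ n log 4; passing from 1/(p - 1) to 1/p costs n times the convergent sum of log p /
  -- (p (p - 1)), bounded by S. Both are compared with log n! = n log n + O(n).
  have hval : ∀ p ∈ (Icc 1 n).filter Nat.Prime,
      (n : ℝ) / p - 1 ≤ n.factorial.factorization p ∧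
      (n.factorial.factorization p : ℝ) ≤ n / (p - 1) := by
    intro p hp
    have hpp := (mem_filter.1 hp).2
    have : Fact p.Prime := ⟨hpp⟩
    have hp2 : (2 : ℝ) ≤ p := by exact_mod_cast hpp.two_le
    rw [Nat.factorization_def _ hpp]
    constructor
    · have h1 : n / p ≤ padicValNat p n.factorial := by
        rw [padicValNat_factorial (Nat.lt_succ_self _)]
        calc n / p = n / p ^ 1 := by simp
          _ ≤ _ := Finset.single_le_sum (f := fun i => n / p ^ i) (fun _ _ => Nat.zero_le _) (by
              simp only [mem_Ico, le_refl, true_and]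
              have : 1 ≤ Nat.log p n := Nat.log_pos hpp.one_lt (mem_Icc.1 (mem_filter.1 hp).1).2
              omega)
      have h2 : (n : ℝ) / p - 1 ≤ ((n / p : ℕ) : ℝ) := by
        have := Nat.lt_div_mul_add (a := n) (b := p) hpp.pos
        have h3 : (n : ℝ) < ((n / p : ℕ) : ℝ) * p + p := by exact_mod_cast this
        rw [sub_le_iff_le_add, div_le_iff₀ (by linarith)]
        linarith
      exact h2.trans (by exact_mod_cast h1)
    · have h1 := sub_one_mul_padicValNat_factorial (p := p) n
      have h2 : (p - 1) * padicValNat p n.factorial ≤ n := by omega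
      have h3 : ((p : ℝ) - 1) * padicValNat p n.factorial ≤ n := by
        have : (((p - 1) * padicValNat p n.factorial : ℕ) : ℝ) ≤ n := by exact_mod_cast h2
        rwa [Nat.cast_mul, Nat.cast_sub hpp.one_lt.le, Nat.cast_one] at this
      rw [le_div_iff₀ (by linarith)]
      linarith
  set T := ∑ p ∈ Icc 1 n with p.Prime, Real.log p / p with hT
  have hlogp : ∀ p ∈ (Icc 1 n).filter Nat.Prime, 0 ≤ Real.log p := fun p _ => Real.log_natCast_nonneg p
  have h1 : n * T - Real.log 4 * n ≤ Real.log (n.factorial : ℝ) := by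
    have hθ : ∑ p ∈ Icc 1 n with p.Prime, Real.log p ≤ Real.log 4 * n := by
      have h := Chebyshev.theta_le_log4_mul_x (x := n) hn0.le
      rw [Chebyshev.theta_eq_sum_Icc, Nat.floor_natCast] at h
      refine le_trans (Finset.sum_le_sum_of_subset_of_nonneg ?_ ?_) h
      · intro p hp
        simp only [mem_filter, mem_Icc] at hp ⊢
        exact ⟨⟨Nat.zero_le _, hp.1.2⟩, hp.2⟩
      · intro p _ _; exact Real.log_natCast_nonneg p
    calc n * T - Real.log 4 * n ≤ n * T - ∑ p ∈ Icc 1 n with p.Prime, Real.log p := by linarith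
      _ = ∑ p ∈ Icc 1 n with p.Prime, ((n : ℝ) / p - 1) * Real.log p := by
        rw [hT, Finset.mul_sum, ← Finset.sum_sub_distrib]
        refine Finset.sum_congr rfl fun p _ => ?_
        ring
      _ ≤ _ := by
        rw [hlog]
        exact Finset.sum_le_sum fun p hp => mul_le_mul_of_nonneg_right (hval p hp).1 (hlogp p hp)
  have h2 : Real.log (n.factorial : ℝ) ≤ n * T + n * S := by
    calc Real.log (n.factorial : ℝ) ≤ ∑ p ∈ Icc 1 n with p.Prime,
          (n * (Real.log p / p) + n * (4 * (1 / (p : ℝ) ^ (3 / 2 : ℝ)))) := by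
          rw [hlog]
          refine Finset.sum_le_sum fun p hp => ?_
          have hpp := (mem_filter.1 hp).2
          have hp2 : (2 : ℝ) ≤ p := by exact_mod_cast hpp.two_le
          have e : (n : ℝ) / (p - 1) * Real.log p =
              n * (Real.log p / p) + n * (Real.log p / ((p : ℝ) * (p - 1))) := by
            have : (p : ℝ) - 1 ≠ 0 := by linarith
            have : (p : ℝ) ≠ 0 := by linarith
            field_simp
            ring
          refine (mul_le_mul_of_nonneg_right (hval p hp).2 (hlogp p hp)).trans ?_
          rw [e]
          gcongr
          exact hterm p hpp
      _ ≤ _ := by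
        rw [Finset.sum_add_distrib, ← Finset.mul_sum, ← Finset.mul_sum]
        gcongr
        exact hsummable.sum_le_tsum _ (fun i _ => by positivity)
  have hS0 : 0 ≤ S := tsum_nonneg fun i => by positivity
  have hl4 : 0 ≤ Real.log 4 := Real.log_nonneg (by norm_num)
  rw [abs_le]
  constructor
  · have : n * (Real.log n - 1) ≤ n * (T + S) := by linarith
    have := le_of_mul_le_mul_left this hn0
    linarith
  · have : n * T ≤ n * (Real.log n + Real.log 4) := by linarith
    have := le_of_mul_le_mul_left this hn0
    linarith

theorem log_floor_bounds {x : ℝ} (hx : 1 ≤ x) :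
    Real.log (⌊x⌋₊ : ℝ) ≤ Real.log x ∧ Real.log x ≤ Real.log (⌊x⌋₊ : ℝ) + 1 := by
  have h1 : 1 ≤ ⌊x⌋₊ := Nat.le_floor (by simpa using hx)
  have h1' : (1 : ℝ) ≤ ⌊x⌋₊ := by exact_mod_cast h1
  refine ⟨Real.log_le_log (by linarith) (Nat.floor_le (by linarith)), ?_⟩
  have h2 : x ≤ ⌊x⌋₊ * Real.exp 1 := by
    have := Nat.lt_floor_add_one x
    have h3 := Real.add_one_le_exp (1 : ℝ)
    nlinarith
  calc Real.log x ≤ Real.log (⌊x⌋₊ * Real.exp 1) := Real.log_le_log (by linarith) h2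
    _ = _ := by rw [Real.log_mul (by linarith) (Real.exp_ne_zero _), Real.log_exp]

theorem mertens : ∃ K : ℝ, ∀ x : ℝ, 1 ≤ x →
    |∑ p ∈ Icc 1 ⌊x⌋₊ with p.Prime, Real.log p / p - Real.log x| ≤ K := by
  obtain ⟨K, hK⟩ := mertens_nat
  refine ⟨K + 1, fun x hx => ?_⟩
  have h := abs_le.1 (hK ⌊x⌋₊ (Nat.le_floor (by simpa using hx)))
  have h2 := log_floor_bounds hx
  rw [abs_le]
  constructor <;> linarith [h.1, h.2, h2.1, h2.2]

/-! ### Dirichlet powers of 1/n -/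

/-- The arithmetic function `n ↦ 1 / n`. -/
noncomputable def invFun : ArithmeticFunction ℝ := ⟨fun n => (n : ℝ)⁻¹, by simp⟩

/-- The arithmetic function `n ↦ μ(n) / n`, the Dirichlet inverse of `n ↦ 1 / n`. -/
noncomputable def moebiusDiv : ArithmeticFunction ℝ :=
  ⟨fun n => (moebius n : ℝ) * (n : ℝ)⁻¹, by simp⟩

theorem invFun_apply (n : ℕ) : invFun n = (n : ℝ)⁻¹ := rfl

theorem moebiusDiv_apply (n : ℕ) : moebiusDiv n = (moebius n : ℝ) * (n : ℝ)⁻¹ := rfl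

theorem moebiusDiv_mul_invFun : moebiusDiv * invFun = 1 := by
  ext n
  rw [mul_apply]
  have h : ∀ x ∈ n.divisorsAntidiagonal, moebiusDiv x.1 * invFun x.2 =
      (n : ℝ)⁻¹ * (((moebius x.1 : ℤ) : ℝ) * ((zeta x.2 : ℕ) : ℝ)) := by
    intro x hx
    obtain ⟨h1, h2⟩ := Nat.mem_divisorsAntidiagonal.1 hx
    have hx2 : x.2 ≠ 0 := by rintro h; rw [h, mul_zero] at h1; exact h2 h1.symm
    rw [moebiusDiv_apply, invFun_apply, zeta_apply_ne hx2, ← h1]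
    push_cast
    rw [mul_inv]; ring
  rw [Finset.sum_congr rfl h, ← Finset.mul_sum]
  have h2 := congrArg (fun F : ArithmeticFunction ℤ => ((F n : ℤ) : ℝ)) moebius_mul_coe_zeta
  simp only [mul_apply, Int.cast_sum, Int.cast_mul, natCoe_apply, Int.cast_natCast] at h2
  rw [h2]
  by_cases hn : n = 1
  · simp [hn]
  · simp [one_apply_ne hn]

theorem isMultiplicative_moebiusDiv : moebiusDiv.IsMultiplicative := by
  refine ⟨by simp [moebiusDiv_apply], ?_⟩
  intro m n hmn
  simp only [moebiusDiv_apply]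
  rw [isMultiplicative_moebius.map_mul_of_coprime hmn]
  push_cast
  rw [mul_inv]; ring

theorem Icc_one_eq_Ioc (n : ℕ) : Icc 1 n = Ioc 0 n := by
  ext; simp [Nat.succ_le_iff]

theorem sum_inv_bounds {x : ℝ} (hx : 1 ≤ x) :
    |∑ n ∈ Ioc 0 ⌊x⌋₊, (n : ℝ)⁻¹ - Real.log x| ≤ 1 := by
  have h1 := log_le_harmonic_floor x (by linarith)
  have h2 := harmonic_floor_le_one_add_log x hx
  have h3 : ((harmonic ⌊x⌋₊ : ℚ) : ℝ) = ∑ n ∈ Ioc 0 ⌊x⌋₊, (n : ℝ)⁻¹ := by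
    rw [harmonic_eq_sum_Icc, Icc_one_eq_Ioc]; push_cast; rfl
  rw [h3] at h1 h2
  rw [abs_le]; constructor <;> linarith

theorem log_mem_Icc {x : ℝ} {n : ℕ} (hn : n ∈ Ioc 0 ⌊x⌋₊) :
    Real.log n ∈ Set.Icc 0 (Real.log x) := by
  obtain ⟨h1, h2⟩ := mem_Ioc.1 hn
  have h3 : (0 : ℝ) < n := by exact_mod_cast h1
  refine ⟨Real.log_natCast_nonneg n, Real.log_le_log h3 ?_⟩
  exact (Nat.le_floor_iff' h1.ne').1 h2

/-- Restricting a sum over `n ≤ x` to `log n ≤ t`. -/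
theorem filter_log_le {x t : ℝ} (hx : 1 ≤ x) (ht : t ≤ Real.log x) :
    (Ioc 0 ⌊x⌋₊).filter (fun n : ℕ => Real.log n ≤ t) = Ioc 0 ⌊Real.exp t⌋₊ := by
  have hex : Real.exp t ≤ x := by
    rw [← Real.exp_log (by linarith : 0 < x)]; exact Real.exp_le_exp.2 ht
  ext n
  simp only [mem_filter, mem_Ioc]
  constructor
  · rintro ⟨⟨h1, _⟩, h3⟩
    have h4 : (0 : ℝ) < n := by exact_mod_cast h1
    exact ⟨h1, Nat.le_floor ((Real.log_le_iff_le_exp h4).1 h3)⟩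
  · rintro ⟨h1, h2⟩
    have h4 : (0 : ℝ) < n := by exact_mod_cast h1
    have h5 : (n : ℝ) ≤ Real.exp t := (Nat.le_floor_iff' h1.ne').1 h2
    exact ⟨⟨h1, Nat.le_floor (h5.trans hex)⟩, (Real.log_le_iff_le_exp h4).2 h5⟩

/-- Partial summation in the variable log m, where the weights 1/m have density 1 up to an error of
1. The test function (L - t)^(j+1) vanishes at t = L, so only its derivative contributes to the
error. This drives the induction in `sum_invFun_pow`. -/
theorem sum_inv_mul_log_pow {x : ℝ} (hx : 1 ≤ x) (j : ℕ) :
    |∑ m ∈ Ioc 0 ⌊x⌋₊, (m : ℝ)⁻¹ * Real.log (x / m) ^ (j + 1) - Real.log x ^ (j + 2) / (j + 2)|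
      ≤ (j + 1) * Real.log x ^ (j + 1) := by
  set L := Real.log x with hL
  have hL0 : 0 ≤ L := Real.log_nonneg hx
  have h := abs_sum_mul_sub_integral_le (Ioc 0 ⌊x⌋₊) (fun m : ℕ => (m : ℝ)⁻¹)
    (fun m : ℕ => Real.log m) (u := 0) (v := L) (E := 1) (B₀ := 0) (B₁ := (j + 1) * L ^ j) hL0
    (fun m hm => log_mem_Icc hm) (fun _ => 1) (fun t => (L - t) ^ (j + 1))
    (fun t => -((j + 1) * (L - t) ^ j)) (by fun_prop) (by fun_prop) (by fun_prop) ?_ ?_ (by simp) ?_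
  · have hint : ∫ t in (0 : ℝ)..L, (L - t) ^ (j + 1) * 1 = L ^ (j + 2) / (j + 2) := by
      have := intervalIntegral.integral_comp_sub_left (fun t : ℝ => t ^ (j + 1)) (a := 0) (b := L) L
      simp only [mul_one]
      rw [this, integral_pow]
      simp
      ring
    rw [hint] at h
    have hs : ∑ m ∈ Ioc 0 ⌊x⌋₊, (m : ℝ)⁻¹ * Real.log (x / m) ^ (j + 1) =
        ∑ m ∈ Ioc 0 ⌊x⌋₊, (m : ℝ)⁻¹ * (L - Real.log m) ^ (j + 1) := by
      refine Finset.sum_congr rfl fun m hm => ?_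
      rw [Real.log_div (by linarith) (by have := (mem_Ioc.1 hm).1; positivity)]
    rw [hs]
    refine h.trans (le_of_eq ?_)
    ring
  · intro t _
    refine (((hasDerivAt_id t).const_sub L).fun_pow (j + 1)).congr_deriv ?_
    simp
  · intro t ht
    rw [filter_log_le hx ht.2]
    have := sum_inv_bounds (x := Real.exp t) (Real.one_le_exp ht.1)
    simpa using this
  · intro t ht
    rw [abs_neg, abs_of_nonneg (by have := ht.2; have : 0 ≤ L - t := by linarith
                                   positivity)]
    have h1 : 0 ≤ L - t := by linarith [ht.2]
    have h2 : L - t ≤ L := by linarith [ht.1]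
    gcongr

/-- Partial sums of the `(j+1)`-fold convolution of `1/n`. -/
theorem sum_invFun_pow (j : ℕ) : ∃ K : ℝ, 0 ≤ K ∧ ∀ x : ℝ, 1 ≤ x →
    |∑ n ∈ Ioc 0 ⌊x⌋₊, (invFun ^ (j + 1)) n - Real.log x ^ (j + 1) / ((j + 1).factorial : ℝ)|
      ≤ K * (1 + Real.log x) ^ j := by
  induction j with
  | zero =>
    refine ⟨1, by norm_num, fun x hx => ?_⟩
    have := sum_inv_bounds hx
    simpa [invFun_apply] using this
  | succ j ih =>
    obtain ⟨K, hK0, hK⟩ := ih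
    refine ⟨K * 1 + (j + 1), by positivity, fun x hx => ?_⟩
    set L := Real.log x with hL
    have hL0 : 0 ≤ L := Real.log_nonneg hx
    set c : ℝ := ((j + 1).factorial : ℝ) with hc
    have hc1 : 1 ≤ c := by
      rw [hc]; exact_mod_cast Nat.factorial_pos (j + 1)
    have hxm : ∀ m ∈ Ioc 0 ⌊x⌋₊, 1 ≤ x / m ∧ Real.log (x / m) ≤ L ∧ 0 ≤ Real.log (x / m) := by
      intro m hm
      obtain ⟨h1, h2⟩ := mem_Ioc.1 hm
      have h3 : (0 : ℝ) < m := by exact_mod_cast h1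
      have h4 : (m : ℝ) ≤ x := (Nat.le_floor_iff' h1.ne').1 h2
      have h5 : 1 ≤ x / m := (one_le_div h3).2 h4
      refine ⟨h5, ?_, Real.log_nonneg h5⟩
      rw [Real.log_div (by linarith) h3.ne']
      linarith [Real.log_natCast_nonneg m]
    have hsum : ∑ n ∈ Ioc 0 ⌊x⌋₊, (invFun ^ (j + 1 + 1)) n =
        ∑ m ∈ Ioc 0 ⌊x⌋₊, (m : ℝ)⁻¹ * ∑ n ∈ Ioc 0 ⌊x / m⌋₊, (invFun ^ (j + 1)) n := by
      rw [pow_succ' invFun (j + 1), sum_Ioc_mul_eq_sum_sum]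
      refine Finset.sum_congr rfl fun m _ => ?_
      rw [Nat.floor_div_natCast, invFun_apply]
    -- The inductive error is at most K (1 + L)^j for every m; summing it against 1/m costs one more
    -- factor 1 + L.
    have h1 : |∑ m ∈ Ioc 0 ⌊x⌋₊, (m : ℝ)⁻¹ * ∑ n ∈ Ioc 0 ⌊x / m⌋₊, (invFun ^ (j + 1)) n -
        ∑ m ∈ Ioc 0 ⌊x⌋₊, (m : ℝ)⁻¹ * (Real.log (x / m) ^ (j + 1) / c)| ≤
        (1 + L) * (K * (1 + L) ^ j) := by
      rw [← Finset.sum_sub_distrib]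
      refine (Finset.abs_sum_le_sum_abs _ _).trans ?_
      have : ∀ m ∈ Ioc 0 ⌊x⌋₊, |(m : ℝ)⁻¹ * ∑ n ∈ Ioc 0 ⌊x / m⌋₊, (invFun ^ (j + 1)) n -
          (m : ℝ)⁻¹ * (Real.log (x / m) ^ (j + 1) / c)| ≤ (m : ℝ)⁻¹ * (K * (1 + L) ^ j) := by
        intro m hm
        obtain ⟨h5, h6, h7⟩ := hxm m hm
        rw [← mul_sub, abs_mul, abs_of_nonneg (by positivity)]
        refine mul_le_mul_of_nonneg_left ?_ (by positivity)
        refine (hK _ h5).trans ?_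
        gcongr
      refine (Finset.sum_le_sum this).trans ?_
      rw [← Finset.sum_mul]
      have := (abs_le.1 (sum_inv_bounds hx)).2
      refine mul_le_mul_of_nonneg_right (by linarith) (by positivity)
    have h2 := sum_inv_mul_log_pow hx j
    have h3 : |∑ m ∈ Ioc 0 ⌊x⌋₊, (m : ℝ)⁻¹ * (Real.log (x / m) ^ (j + 1) / c) -
        L ^ (j + 2) / ((j + 1 + 1).factorial : ℝ)| ≤ (j + 1) * (1 + L) ^ (j + 1) := by
      have e : ∑ m ∈ Ioc 0 ⌊x⌋₊, (m : ℝ)⁻¹ * (Real.log (x / m) ^ (j + 1) / c) -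
          L ^ (j + 2) / ((j + 1 + 1).factorial : ℝ) =
          c⁻¹ * (∑ m ∈ Ioc 0 ⌊x⌋₊, (m : ℝ)⁻¹ * Real.log (x / m) ^ (j + 1) - L ^ (j + 2) / (j + 2)) := by
        rw [mul_sub, Finset.mul_sum, Nat.factorial_succ (j + 1)]
        congr 1
        · refine Finset.sum_congr rfl fun m _ => by ring
        · push_cast
          rw [← hc]
          have : (j : ℝ) + 1 + 1 ≠ 0 := by positivity
          have : (j : ℝ) + 2 ≠ 0 := by positivity
          field_simp
          ring
      rw [e, abs_mul, abs_of_nonneg (by positivity)]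
      calc c⁻¹ * _ ≤ 1 * ((j + 1) * L ^ (j + 1)) := by
            refine mul_le_mul (inv_le_one_of_one_le₀ hc1) h2 (abs_nonneg _) zero_le_one
        _ ≤ _ := by
            rw [one_mul]
            gcongr
            linarith
    rw [hsum]
    refine (abs_sub_le _ _ _).trans ((add_le_add h1 h3).trans (le_of_eq ?_))
    ring

/-! ### The density 1/f₁ and the singular series -/

/-- A nonnegative multiplicative function is summable if its local sums are `1 + c p` with `∑ c p`
convergent. -/
theorem summable_of_multiplicative {F c : ℕ → ℝ} (h0 : F 0 = 0) (hF : ∀ n, 0 ≤ F n) (h1 : F 1 = 1)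
    (hmul : ∀ {m n : ℕ}, m.Coprime n → F (m * n) = F m * F n) (hc0 : ∀ n, 0 ≤ c n)
    (hc : Summable c) (hp : ∀ p : ℕ, p.Prime → Summable (fun e => F (p ^ e)) ∧
      ∑' e, F (p ^ e) ≤ 1 + c p) : Summable F := by
  refine summable_of_sum_range_le (c := Real.exp (∑' n, c n)) hF fun N => ?_
  obtain ⟨hs1, hs2⟩ := EulerProduct.summable_and_hasSum_smoothNumbers_prod_primesBelow_tsum
    (f := F) h1 hmul (fun {p} h => by simpa [abs_of_nonneg (hF _)] using (hp p h).1) N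
  -- Every positive n < N has all its prime factors below N, so the partial sum is dominated by the
  -- finite Euler product, which is at most exp(∑ c p).
  have hle : ∑ n ∈ range N, F n ≤ ∏ p ∈ N.primesBelow, ∑' e, F (p ^ e) := by
    rw [← hs2.tsum_eq]
    have hind : HasSum (Set.indicator (N.smoothNumbers) F) (∑' m : N.smoothNumbers, F m) :=
      (hasSum_subtype_iff_indicator).1 hs2.summable.hasSum
    rw [← hind.tsum_eq]
    refine le_trans (le_of_eq ?_) (hind.summable.sum_le_tsum (range N) fun i _ =>
      Set.indicator_nonneg (fun n _ => hF n) i)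
    refine Finset.sum_congr rfl fun n hn => ?_
    rcases Nat.eq_zero_or_pos n with h | h
    · subst h; simp [Set.indicator, h0]
    · rw [Set.indicator_of_mem (Nat.mem_smoothNumbers_of_lt h (mem_range.1 hn))]
  refine hle.trans ?_
  calc ∏ p ∈ N.primesBelow, ∑' e, F (p ^ e) ≤ ∏ p ∈ N.primesBelow, Real.exp (c p) := by
        refine Finset.prod_le_prod (fun p _ => tsum_nonneg fun e => hF _) fun p hpN => ?_
        have := (hp p (Nat.prime_of_mem_primesBelow hpN)).2
        linarith [Real.add_one_le_exp (c p)]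
    _ = Real.exp (∑ p ∈ N.primesBelow, c p) := (Real.exp_sum _ _).symm
    _ ≤ _ := Real.exp_le_exp.2 (hc.sum_le_tsum _ fun i _ => hc0 i)

/-- The Möbius function vanishes on p², p³, …, so only two terms of the convolution survive. -/
theorem mul_moebiusDiv_prime_pow_succ (u : ArithmeticFunction ℝ) {p : ℕ} (hp : p.Prime) (e : ℕ) :
    (u * moebiusDiv) (p ^ (e + 1)) = u (p ^ (e + 1)) - u (p ^ e) / p := by
  rw [mul_apply, Nat.sum_divisorsAntidiagonal' (f := fun a b => u a * moebiusDiv b),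
    Nat.sum_divisors_prime_pow hp, Finset.sum_range_succ', Finset.sum_range_succ']
  have h : ∑ x ∈ range e, u (p ^ (e + 1) / p ^ (x + 1 + 1)) * moebiusDiv (p ^ (x + 1 + 1)) = 0 := by
    refine Finset.sum_eq_zero fun x _ => ?_
    rw [moebiusDiv_apply, moebius_apply_prime_pow hp (by omega), if_neg (by omega)]
    simp
  rw [h]
  have h2 : p ^ (e + 1) / p ^ (0 + 1) = p ^ e := by
    rw [zero_add, pow_one, pow_succ, Nat.mul_div_cancel _ hp.pos]
  rw [h2, moebiusDiv_apply, moebiusDiv_apply, zero_add, pow_one, moebius_apply_prime hp]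
  simp
  ring

/-- The multiplicative function `1 / f₁` on squarefree integers coprime to `A`. -/
noncomputable def sieveDensity (k A : ℕ) : ArithmeticFunction ℝ :=
  ⟨fun r => if Squarefree r ∧ r.Coprime A then (f₁ k r)⁻¹ else 0, by simp⟩

theorem sieveDensity_apply (k A r : ℕ) :
    sieveDensity k A r = if Squarefree r ∧ r.Coprime A then (f₁ k r)⁻¹ else 0 := rfl

theorem f₁_mul (k : ℕ) {m n : ℕ} (h : m.Coprime n) : f₁ k (m * n) = f₁ k m * f₁ k n := by
  rw [f₁, h.primeFactors_mul, Finset.prod_union h.disjoint_primeFactors]; rfl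

theorem f_mul (k : ℕ) {m n : ℕ} (h : m.Coprime n) : f k (m * n) = f k m * f k n := by
  rw [f, h.primeFactors_mul, Finset.prod_union h.disjoint_primeFactors]; rfl

theorem f_prime (k : ℕ) {p : ℕ} (hp : p.Prime) : f k p = p / k := by
  simp [f, hp.primeFactors]

theorem f₁_prime (k : ℕ) {p : ℕ} (hp : p.Prime) : f₁ k p = (p - k) / k := by
  simp [f₁, hp.primeFactors]

theorem isMultiplicative_sieveDensity (k A : ℕ) : (sieveDensity k A).IsMultiplicative := by
  refine ⟨by simp [sieveDensity_apply, f₁], ?_⟩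
  intro m n hmn
  simp only [sieveDensity_apply, Nat.squarefree_mul hmn, Nat.coprime_mul_iff_left, f₁_mul k hmn,
    mul_inv]
  split_ifs <;> first | rfl | (simp; done) | (exfalso; tauto)

theorem sieveDensity_prime_of_dvd {k A p : ℕ} (hp : p.Prime) (h : p ∣ A) :
    sieveDensity k A p = 0 := by
  rw [sieveDensity_apply, if_neg]
  rintro ⟨_, h2⟩
  exact (hp.coprime_iff_not_dvd.1 h2) h

theorem sieveDensity_prime_of_not_dvd {k A p : ℕ} (hp : p.Prime) (h : ¬ p ∣ A) :
    sieveDensity k A p = k / (p - k) := by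
  rw [sieveDensity_apply, if_pos ⟨hp.prime.squarefree, hp.coprime_iff_not_dvd.2 h⟩, f₁_prime k hp,
    inv_div]

theorem sieveDensity_prime_pow {k A p : ℕ} (hp : p.Prime) (e : ℕ) :
    sieveDensity k A (p ^ (e + 2)) = 0 := by
  rw [sieveDensity_apply, if_neg]
  rintro ⟨h, _⟩
  rw [Nat.squarefree_pow_iff hp.one_lt.ne' (by omega)] at h
  omega

/-- The difference of the two sides is k (p - k - 1). In this form k < p already gives 1/(p - k) ≤
(k + 1)/p, so small primes need no separate treatment. -/
theorem sub_mul_succ_ge {k p : ℕ} (h : k < p) : (p : ℝ) ≤ ((p : ℝ) - k) * (k + 1) := by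
  have h1 : (k : ℝ) + 1 ≤ p := by exact_mod_cast h
  have h2 : (0 : ℝ) ≤ k := Nat.cast_nonneg k
  nlinarith

theorem sieveDensity_prime_bounds {k A p : ℕ} (hkA : ∀ p : ℕ, p.Prime → ¬ p ∣ A → k < p)
    (hp : p.Prime) : 0 ≤ sieveDensity k A p ∧ sieveDensity k A p ≤ k * (k + 1) / p := by
  have hp0 : (0 : ℝ) < p := by exact_mod_cast hp.pos
  by_cases h : p ∣ A
  · rw [sieveDensity_prime_of_dvd hp h]
    exact ⟨le_rfl, by positivity⟩
  · rw [sieveDensity_prime_of_not_dvd hp h]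
    have h1 : (k : ℝ) < p := by exact_mod_cast hkA p hp h
    have h2 : 0 < (p : ℝ) - k := by linarith
    refine ⟨by positivity, ?_⟩
    rw [div_le_div_iff₀ h2 hp0]
    have := sub_mul_succ_ge (hkA p hp h)
    have h3 : (0 : ℝ) ≤ k := Nat.cast_nonneg k
    nlinarith

/-- `sieveDensity` convolved `j` times with `μ(n) / n`. -/
noncomputable def reducedDensity (k A j : ℕ) : ArithmeticFunction ℝ :=
  sieveDensity k A * moebiusDiv ^ j

theorem reducedDensity_succ (k A j : ℕ) :
    reducedDensity k A (j + 1) = reducedDensity k A j * moebiusDiv := by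
  rw [reducedDensity, reducedDensity, pow_succ, mul_assoc]

theorem isMultiplicative_reducedDensity (k A j : ℕ) : (reducedDensity k A j).IsMultiplicative := by
  induction j with
  | zero => simpa [reducedDensity] using isMultiplicative_sieveDensity k A
  | succ j ih => rw [reducedDensity_succ]; exact ih.mul isMultiplicative_moebiusDiv

theorem reducedDensity_prime (k A j : ℕ) {p : ℕ} (hp : p.Prime) :
    reducedDensity k A j p = sieveDensity k A p - j / p := by
  induction j with
  | zero => simp [reducedDensity]
  | succ j ih =>
    have := mul_moebiusDiv_prime_pow_succ (reducedDensity k A j) hp 0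
    simp only [zero_add, pow_one, pow_zero] at this
    rw [reducedDensity_succ, this, ih, (isMultiplicative_reducedDensity k A j).1]
    push_cast
    ring

/-- Both terms produced by a convolution with μ(n)/n are of size p^(-e), so each convolution at most
doubles the constant. The initial constant k (k + 1) + 1 covers the exponents 0 and 1; for larger
exponents the density is 0. -/
theorem abs_reducedDensity_prime_pow_le {k A : ℕ} (hkA : ∀ p : ℕ, p.Prime → ¬ p ∣ A → k < p) (j : ℕ)
    {p : ℕ} (hp : p.Prime) (e : ℕ) :
    |reducedDensity k A j (p ^ e)| ≤ 2 ^ j * (k * (k + 1) + 1) / (p : ℝ) ^ e := by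
  have hp0 : (0 : ℝ) < p := by exact_mod_cast hp.pos
  induction j generalizing e with
  | zero =>
    simp only [reducedDensity, pow_zero, mul_one, one_mul]
    match e with
    | 0 => simp [(isMultiplicative_sieveDensity k A).1]; positivity
    | 1 =>
      obtain ⟨h1, h2⟩ := sieveDensity_prime_bounds hkA hp
      rw [pow_one, pow_one, abs_of_nonneg h1]
      refine h2.trans ?_
      gcongr
      linarith
    | e + 2 => rw [sieveDensity_prime_pow hp, abs_zero]; positivity
  | succ j ih =>
    match e with
    | 0 =>
      rw [pow_zero, (isMultiplicative_reducedDensity k A (j + 1)).1, pow_zero, abs_one, div_one]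
      have : (1 : ℝ) ≤ 2 ^ (j + 1) := one_le_pow₀ (by norm_num)
      have : (0 : ℝ) ≤ k * (k + 1) := by positivity
      nlinarith
    | e + 1 =>
      rw [reducedDensity_succ, mul_moebiusDiv_prime_pow_succ _ hp]
      refine (abs_sub _ _).trans ((add_le_add (ih (e + 1)) (?_ : _ ≤ 2 ^ j *
        ((k : ℝ) * (k + 1) + 1) / (p : ℝ) ^ (e + 1))).trans (le_of_eq ?_))
      · rw [abs_div, abs_of_pos hp0, div_le_iff₀ hp0]
        refine (ih e).trans (le_of_eq ?_)
        field_simp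
        ring
      · ring

/-- Each convolution with μ(n)/n multiplies the Euler factor at p by 1 - 1/p. For j = k the result
is the reciprocal of `localFactor` at p. -/
theorem hasSum_reducedDensity_prime_pow (k A j : ℕ) {p : ℕ} (hp : p.Prime) :
    HasSum (fun e => reducedDensity k A j (p ^ e))
      ((1 + sieveDensity k A p) * (1 - 1 / (p : ℝ)) ^ j) := by
  induction j with
  | zero =>
    simp only [reducedDensity, pow_zero, mul_one]
    have := hasSum_sum_of_ne_finset_zero (L := .unconditional ℕ) (f := fun e => sieveDensity k A (p ^ e)) (s := range 2) ?_
    · simpa [Finset.sum_range_succ, (isMultiplicative_sieveDensity k A).1] using this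
    · intro e he
      obtain ⟨e', rfl⟩ : ∃ e', e = e' + 2 := ⟨e - 2, by simp at he; omega⟩
      exact sieveDensity_prime_pow hp e'
  | succ j ih =>
    have h1 := (hasSum_nat_add_iff' 1).2 ih
    have h2 := ih.div_const (p : ℝ)
    have h3 := h1.sub h2
    rw [← hasSum_nat_add_iff' 1]
    simp only [Finset.sum_range_one, pow_zero, (isMultiplicative_reducedDensity k A _).1] at h3 ⊢
    convert h3 using 1
    · funext e
      rw [reducedDensity_succ, mul_moebiusDiv_prime_pow_succ _ hp]
    · rw [pow_succ]; ring

/-- With j = k the terms of order 1/p cancel: k/(p - k) - k/p = k²/(p (p - k)). For p | A the value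
-k/p remains, which is O(1/p²) because p ≤ A. -/
theorem abs_reducedDensity_prime_le {k A : ℕ} (hA : A ≠ 0)
    (hkA : ∀ p : ℕ, p.Prime → ¬ p ∣ A → k < p) {p : ℕ} (hp : p.Prime) :
    |reducedDensity k A k p| ≤ (k ^ 2 * (k + 1) + k * A) / (p : ℝ) ^ 2 := by
  have hp0 : (0 : ℝ) < p := by exact_mod_cast hp.pos
  have hk0 : (0 : ℝ) ≤ k := Nat.cast_nonneg k
  rw [reducedDensity_prime k A k hp]
  by_cases h : p ∣ A
  · rw [sieveDensity_prime_of_dvd hp h, zero_sub, abs_neg, abs_of_nonneg (by positivity),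
      div_le_div_iff₀ hp0 (by positivity)]
    have : (p : ℝ) ≤ A := by exact_mod_cast Nat.le_of_dvd (Nat.pos_of_ne_zero hA) h
    have h2 : (k : ℝ) * p ≤ k * A := by gcongr
    have h3 : 0 ≤ (k : ℝ) ^ 2 * (k + 1) := by positivity
    nlinarith
  · rw [sieveDensity_prime_of_not_dvd hp h]
    have h1 : (k : ℝ) < p := by exact_mod_cast hkA p hp h
    have h2 : 0 < (p : ℝ) - k := by linarith
    have e : (k : ℝ) / (p - k) - k / p = k ^ 2 / (p * (p - k)) := by
      field_simp; ring
    rw [e, abs_of_nonneg (by positivity), div_le_div_iff₀ (by positivity) (by positivity)]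
    have h3 := sub_mul_succ_ge (hkA p hp h)
    have h4 : (0 : ℝ) ≤ k * A * (p * (p - k)) := by positivity
    have h5 : (k : ℝ) ^ 2 * p * p ≤ k ^ 2 * p * ((p - k) * (k + 1)) := by gcongr
    nlinarith

/-- The factor n^(1/4) is there to dominate log n later. At p the series is at most p^(-2 + 1/4) ≤
p^(-3/2) up to a constant; at p^(e+2) it is p^(-3/2) p^(-3e/4) up to a constant, a geometric series
of ratio at most θ = 2^(-3/4). -/
theorem summable_reducedDensity {k A : ℕ} (hA : A ≠ 0)
    (hkA : ∀ p : ℕ, p.Prime → ¬ p ∣ A → k < p) :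
    Summable (fun n : ℕ => |reducedDensity k A k n| * (n : ℝ) ^ (1 / 4 : ℝ)) := by
  set h := reducedDensity k A k with hh
  set B : ℝ := 2 ^ k * (k * (k + 1) + 1) with hB
  set B' : ℝ := k ^ 2 * (k + 1) + k * A with hB'
  set θ : ℝ := 2 ^ (-(3 / 4) : ℝ) with hθ
  have hθ0 : 0 ≤ θ := by positivity
  have hθ1 : θ < 1 := Real.rpow_lt_one_of_one_lt_of_neg (by norm_num) (by norm_num)
  have hB0 : 0 ≤ B := by positivity
  have hB0' : 0 ≤ B' := by positivity
  have hθ2 : 0 < 1 - θ := by linarith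
  have hsum32 : Summable (fun n : ℕ => (B' + B * (1 - θ)⁻¹) * (1 / (n : ℝ) ^ (3 / 2 : ℝ))) :=
    (Real.summable_one_div_nat_rpow.2 (by norm_num)).mul_left _
  refine summable_of_multiplicative (by simp) (fun n => by positivity)
    (by simp [hh, (isMultiplicative_reducedDensity k A k).1]) ?_ (fun n => by positivity) hsum32 ?_
  · intro m n hmn
    rw [hh, (isMultiplicative_reducedDensity k A k).2 hmn, abs_mul, Nat.cast_mul,
      Real.mul_rpow (by positivity) (by positivity)]
    ring
  · intro p hp
    have hp0 : (0 : ℝ) < p := by exact_mod_cast hp.pos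
    have hp2 : (2 : ℝ) ≤ p := by exact_mod_cast hp.two_le
    have hterm : ∀ e : ℕ, |h (p ^ (e + 2))| * ((p ^ (e + 2) : ℕ) : ℝ) ^ (1 / 4 : ℝ) ≤
        B * (1 / (p : ℝ) ^ (3 / 2 : ℝ)) * θ ^ e := by
      intro e
      have h1 := abs_reducedDensity_prime_pow_le hkA k hp (e + 2)
      have e1 : ((p ^ (e + 2) : ℕ) : ℝ) ^ (1 / 4 : ℝ) = (p : ℝ) ^ (((e : ℝ) + 2) * (1 / 4)) := by
        push_cast
        rw [← Real.rpow_natCast, ← Real.rpow_mul hp0.le]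
        push_cast; rfl
      have e2 : (p : ℝ) ^ (((e : ℝ) + 2) * (1 / 4)) / (p : ℝ) ^ (e + 2) =
          (1 / (p : ℝ) ^ (3 / 2 : ℝ)) * ((p : ℝ) ^ (-(3 / 4) : ℝ)) ^ e := by
        rw [one_div ((p : ℝ) ^ _), ← Real.rpow_neg hp0.le, ← Real.rpow_natCast, ← Real.rpow_natCast,
          ← Real.rpow_mul hp0.le, ← Real.rpow_add hp0, ← Real.rpow_sub hp0]
        congr 1
        push_cast
        ring
      rw [e1]
      calc _ ≤ B / (p : ℝ) ^ (e + 2) * (p : ℝ) ^ (((e : ℝ) + 2) * (1 / 4)) := by gcongr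
        _ = B * ((p : ℝ) ^ (((e : ℝ) + 2) * (1 / 4)) / (p : ℝ) ^ (e + 2)) := by ring
        _ = B * (1 / (p : ℝ) ^ (3 / 2 : ℝ)) * ((p : ℝ) ^ (-(3 / 4) : ℝ)) ^ e := by rw [e2]; ring
        _ ≤ _ := by
          gcongr
          exact Real.rpow_le_rpow_of_nonpos (by norm_num) hp2 (by norm_num)
    have hgeo := (hasSum_geometric_of_lt_one hθ0 hθ1).mul_left (B * (1 / (p : ℝ) ^ (3 / 2 : ℝ)))
    have hs2 : Summable (fun e : ℕ => |h (p ^ (e + 2))| * ((p ^ (e + 2) : ℕ) : ℝ) ^ (1 / 4 : ℝ)) :=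
      Summable.of_nonneg_of_le (fun e => by positivity) hterm hgeo.summable
    have hs : Summable (fun e : ℕ => |h (p ^ e)| * ((p ^ e : ℕ) : ℝ) ^ (1 / 4 : ℝ)) :=
      (summable_nat_add_iff 2).1 hs2
    refine ⟨hs, ?_⟩
    rw [← hs.sum_add_tsum_nat_add 2]
    have ht : ∑' e : ℕ, |h (p ^ (e + 2))| * ((p ^ (e + 2) : ℕ) : ℝ) ^ (1 / 4 : ℝ) ≤
        B * (1 / (p : ℝ) ^ (3 / 2 : ℝ)) * (1 - θ)⁻¹ := by
      rw [← hgeo.tsum_eq]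
      exact hs2.tsum_le_tsum hterm hgeo.summable
    have h1 : |h p| * (p : ℝ) ^ (1 / 4 : ℝ) ≤ B' * (1 / (p : ℝ) ^ (3 / 2 : ℝ)) := by
      have e3 : (p : ℝ) ^ (1 / 4 : ℝ) ≤ (p : ℝ) ^ (1 / 2 : ℝ) :=
        Real.rpow_le_rpow_of_exponent_le (by linarith) (by norm_num)
      have e4 : (p : ℝ) ^ (1 / 2 : ℝ) / (p : ℝ) ^ 2 = 1 / (p : ℝ) ^ (3 / 2 : ℝ) := by
        rw [one_div ((p : ℝ) ^ _), ← Real.rpow_neg hp0.le, ← Real.rpow_natCast, ← Real.rpow_sub hp0]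
        norm_num
      calc _ ≤ B' / (p : ℝ) ^ 2 * (p : ℝ) ^ (1 / 2 : ℝ) := by
            gcongr
            exact abs_reducedDensity_prime_le hA hkA hp
        _ = B' * ((p : ℝ) ^ (1 / 2 : ℝ) / (p : ℝ) ^ 2) := by ring
        _ = _ := by rw [e4]
    rw [Finset.sum_range_succ, Finset.sum_range_one]
    simp only [pow_zero, pow_one, Nat.cast_one, Real.one_rpow, mul_one]
    rw [hh, (isMultiplicative_reducedDensity k A k).1, abs_one, ← hh]
    calc _ ≤ 1 + B' * (1 / (p : ℝ) ^ (3 / 2 : ℝ)) + B * (1 / (p : ℝ) ^ (3 / 2 : ℝ)) * (1 - θ)⁻¹ := by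
          gcongr
      _ = _ := by ring

/-- Convolving back, 1/f₁ equals h convolved with the k-th power of 1/n, so the sum is ∑ h(m) (log
(x/m))^k / k! up to lower order. Replacing log (x/m) by log x costs a multiple of ∑ |h(m)| log m,
which converges. The Euler product of h is the inverse of that of the singular series, so ∑ h = 1/𝔖
and in particular 𝔖 ≠ 0. -/
theorem sum_sieveDensity_asymptotic {k A : ℕ} (hk : 1 ≤ k) (hA : A ≠ 0)
    (hkA : ∀ p : ℕ, p.Prime → ¬ p ∣ A → k < p) :
    singularSeries k A ≠ 0 ∧ ∃ K : ℝ, 0 ≤ K ∧ ∀ x : ℝ, 1 ≤ x →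
      |∑ r ∈ Ioc 0 ⌊x⌋₊, sieveDensity k A r -
        (singularSeries k A)⁻¹ * (Real.log x ^ k / (k.factorial : ℝ))| ≤
          K * (1 + Real.log x) ^ (k - 1) := by
  set h := reducedDensity k A k with hh
  have hs := summable_reducedDensity hA hkA
  rw [← hh] at hs
  have hpow1 : ∀ n : ℕ, 1 ≤ n → (1 : ℝ) ≤ (n : ℝ) ^ (1 / 4 : ℝ) := fun n hn =>
    Real.one_le_rpow (by exact_mod_cast hn) (by norm_num)
  have hlogn : ∀ n : ℕ, |h n| * Real.log n ≤ 4 * (|h n| * (n : ℝ) ^ (1 / 4 : ℝ)) := by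
    intro n
    have := Real.log_le_rpow_div (Nat.cast_nonneg n : (0 : ℝ) ≤ n) (ε := 1 / 4) (by norm_num)
    nlinarith [abs_nonneg (h n)]
  have hslog : Summable (fun n : ℕ => |h n| * Real.log n) :=
    Summable.of_nonneg_of_le (fun n => mul_nonneg (abs_nonneg _) (Real.log_natCast_nonneg n))
      hlogn (hs.mul_left 4)
  have hsabs : Summable (fun n : ℕ => ‖h n‖) := by
    refine Summable.of_nonneg_of_le (fun n => norm_nonneg _) (fun n => ?_) hs
    rw [Real.norm_eq_abs]
    rcases Nat.eq_zero_or_pos n with hn | hn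
    · subst hn; simp
    · exact le_mul_of_one_le_right (abs_nonneg _) (hpow1 n hn)
  have hsh : Summable (fun n : ℕ => h n) := hsabs.of_norm
  have hprod := (isMultiplicative_reducedDensity k A k).eulerProduct_hasProd hsabs
  have hlocal : ∀ p : Nat.Primes, localFactor k A p * ∑' e, h ((p : ℕ) ^ e) = 1 := by
    rintro ⟨p, hp⟩
    have hp0 : (0 : ℝ) < p := by exact_mod_cast hp.pos
    have hp2 : (2 : ℝ) ≤ p := by exact_mod_cast hp.two_le
    have hne : (1 - 1 / (p : ℝ)) ≠ 0 := by
      have : 1 / (p : ℝ) < 1 := (div_lt_one hp0).2 (by linarith)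
      linarith
    have hne' := pow_ne_zero k hne
    simp only
    rw [(hasSum_reducedDensity_prime_pow k A k hp).tsum_eq, localFactor]
    split_ifs with hd
    · rw [sieveDensity_prime_of_dvd hp hd, add_zero, one_mul, inv_mul_cancel₀ hne']
    · rw [sieveDensity_prime_of_not_dvd hp hd]
      have h1 : (k : ℝ) < p := by exact_mod_cast hkA p hp hd
      have h2 : (p : ℝ) - k ≠ 0 := by linarith
      have e : (1 - (k : ℝ) / p) * (1 + k / (p - k)) = 1 := by field_simp; ring
      calc _ = ((1 - (k : ℝ) / p) * (1 + k / (p - k))) *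
            (((1 - 1 / (p : ℝ)) ^ k)⁻¹ * (1 - 1 / (p : ℝ)) ^ k) := by ring
        _ = 1 := by rw [e, inv_mul_cancel₀ hne', one_mul]
  have hS : singularSeries k A * ∑' n, h n = 1 := by
    have h1 := (multipliable_localFactor k A hA).hasProd.mul hprod
    simp only [← hh, hlocal] at h1
    exact h1.unique hasProd_one
  have hS0 : singularSeries k A ≠ 0 := left_ne_zero_of_mul_eq_one hS
  have hSinv : (singularSeries k A)⁻¹ = ∑' n, h n := inv_eq_of_mul_eq_one_right hS
  obtain ⟨j, rfl⟩ : ∃ j, k = j + 1 := ⟨k - 1, by omega⟩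
  obtain ⟨K, hK0, hK⟩ := sum_invFun_pow j
  refine ⟨hS0, K * (∑' n, ‖h n‖) + (j + 1) * ∑' n : ℕ, |h n| * Real.log n, ?_, fun x hx => ?_⟩
  · exact add_nonneg (mul_nonneg hK0 (tsum_nonneg fun n => norm_nonneg _))
      (mul_nonneg (by positivity)
        (tsum_nonneg fun n => mul_nonneg (abs_nonneg _) (Real.log_natCast_nonneg n)))
  have hgh : sieveDensity (j + 1) A = h * invFun ^ (j + 1) := by
    rw [hh, reducedDensity, mul_assoc, ← mul_pow, moebiusDiv_mul_invFun, one_pow, mul_one]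
  set L := Real.log x with hL
  have hL0 : 0 ≤ L := Real.log_nonneg hx
  set c : ℝ := ((j + 1).factorial : ℝ) with hc
  have hc1 : 1 ≤ c := by rw [hc]; exact_mod_cast Nat.factorial_pos (j + 1)
  have hxm : ∀ m ∈ Ioc 0 ⌊x⌋₊, 1 ≤ x / m ∧ Real.log (x / m) = L - Real.log m ∧
      0 ≤ L - Real.log m := by
    intro m hm
    obtain ⟨h1, h2⟩ := mem_Ioc.1 hm
    have h3 : (0 : ℝ) < m := by exact_mod_cast h1
    have h4 : (m : ℝ) ≤ x := (Nat.le_floor_iff' h1.ne').1 h2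
    have h5 : 1 ≤ x / m := (one_le_div h3).2 h4
    have h6 : Real.log (x / m) = L - Real.log m := by rw [Real.log_div (by linarith) h3.ne']
    exact ⟨h5, h6, h6 ▸ Real.log_nonneg h5⟩
  have hsum : ∑ n ∈ Ioc 0 ⌊x⌋₊, sieveDensity (j + 1) A n =
      ∑ m ∈ Ioc 0 ⌊x⌋₊, h m * ∑ n ∈ Ioc 0 ⌊x / m⌋₊, (invFun ^ (j + 1)) n := by
    rw [hgh, sum_Ioc_mul_eq_sum_sum]
    refine Finset.sum_congr rfl fun m _ => ?_
    rw [Nat.floor_div_natCast]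
  have h1 : |∑ m ∈ Ioc 0 ⌊x⌋₊, h m * ∑ n ∈ Ioc 0 ⌊x / m⌋₊, (invFun ^ (j + 1)) n -
      ∑ m ∈ Ioc 0 ⌊x⌋₊, h m * ((L - Real.log m) ^ (j + 1) / c)| ≤
      (K * ∑' n, ‖h n‖) * (1 + L) ^ j := by
    rw [← Finset.sum_sub_distrib]
    refine (Finset.abs_sum_le_sum_abs _ _).trans ?_
    have : ∀ m ∈ Ioc 0 ⌊x⌋₊, |h m * ∑ n ∈ Ioc 0 ⌊x / m⌋₊, (invFun ^ (j + 1)) n -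
        h m * ((L - Real.log m) ^ (j + 1) / c)| ≤ ‖h m‖ * (K * (1 + L) ^ j) := by
      intro m hm
      obtain ⟨h5, h6, h7⟩ := hxm m hm
      rw [← mul_sub, abs_mul, Real.norm_eq_abs]
      refine mul_le_mul_of_nonneg_left ?_ (abs_nonneg _)
      have := hK _ h5
      rw [h6] at this
      refine this.trans ?_
      gcongr
      linarith [Real.log_natCast_nonneg m]
    refine (Finset.sum_le_sum this).trans ?_
    rw [← Finset.sum_mul]
    have := hsabs.sum_le_tsum (Ioc 0 ⌊x⌋₊) (fun i _ => norm_nonneg _)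
    calc _ ≤ (∑' n, ‖h n‖) * (K * (1 + L) ^ j) := by gcongr
      _ = _ := by ring
  have h2 : |∑ m ∈ Ioc 0 ⌊x⌋₊, h m * ((L - Real.log m) ^ (j + 1) / c) -
      (∑' n, h n) * (L ^ (j + 1) / c)| ≤
      ((j + 1) * ∑' n : ℕ, |h n| * Real.log n) * (1 + L) ^ j := by
    -- Extending the summand by 0 beyond x allows a termwise comparison with the full series ∑ h(n).
    -- For n > x the whole power L^(j+1) is missing, but then L ≤ log n, so the same bound by |h(n)|
    -- log n holds.
    set φ : ℕ → ℝ := fun n => if n ∈ Ioc 0 ⌊x⌋₊ then (L - Real.log n) ^ (j + 1) else 0 with hφ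
    have hdiff : ∀ n : ℕ, |h n * (φ n / c) - h n * (L ^ (j + 1) / c)| ≤
        (|h n| * Real.log n) * ((j + 1) * (1 + L) ^ j) := by
      intro n
      rcases Nat.eq_zero_or_pos n with hn | hn
      · subst hn; simp
      have hln : 0 ≤ Real.log n := Real.log_natCast_nonneg n
      have hφn : |φ n - L ^ (j + 1)| ≤ Real.log n * ((j + 1) * (1 + L) ^ j) := by
        have hLj : L ^ j ≤ (1 + L) ^ j := by gcongr; linarith
        simp only [hφ]
        split_ifs with hm
        · have h7 := (hxm n hm).2.2
          have hle : (L - Real.log n) ^ (j + 1) ≤ L ^ (j + 1) := by gcongr; linarith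
          rw [abs_sub_comm, abs_of_nonneg (by linarith)]
          have h8 := abs_pow_sub_pow_le L (L - Real.log n) (j + 1)
          rw [abs_of_nonneg (by linarith), abs_of_nonneg (by linarith), abs_of_nonneg h7,
            abs_of_nonneg hL0, max_eq_left (by linarith), sub_sub_cancel, Nat.add_sub_cancel] at h8
          refine h8.trans ?_
          push_cast
          rw [mul_assoc]
          gcongr
        · have hxn : L ≤ Real.log n := by
            have : x < n := by
              by_contra hcon
              exact hm (mem_Ioc.2 ⟨hn, Nat.le_floor (not_lt.1 hcon)⟩)
            exact Real.log_le_log (by linarith) this.le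
          rw [zero_sub, abs_neg, abs_of_nonneg (by positivity), pow_succ, mul_comm]
          have : L ^ j ≤ (j + 1) * (1 + L) ^ j := by
            have : (0 : ℝ) ≤ j * (1 + L) ^ j := by positivity
            linarith
          gcongr
      rw [← mul_sub, ← sub_div, abs_mul, abs_div, abs_of_pos (by linarith : 0 < c), mul_assoc]
      refine mul_le_mul_of_nonneg_left ?_ (abs_nonneg _)
      exact (div_le_self (abs_nonneg _) hc1).trans hφn
    have hφs : HasSum (fun n => h n * (φ n / c))
        (∑ m ∈ Ioc 0 ⌊x⌋₊, h m * ((L - Real.log m) ^ (j + 1) / c)) := by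
      have : ∑ m ∈ Ioc 0 ⌊x⌋₊, h m * ((L - Real.log m) ^ (j + 1) / c) =
          ∑ m ∈ Ioc 0 ⌊x⌋₊, h m * (φ m / c) := by
        refine Finset.sum_congr rfl fun m hm => ?_
        simp only [hφ, if_pos hm]
      rw [this]
      refine hasSum_sum_of_ne_finset_zero fun m hm => ?_
      simp only [hφ, if_neg hm]
      simp
    have hd := hφs.sub (hsh.hasSum.mul_right (L ^ (j + 1) / c))
    have hb := hslog.mul_right ((j + 1) * (1 + L) ^ j)
    have := tsum_of_norm_bounded hb.hasSum (fun n => by rw [Real.norm_eq_abs]; exact hdiff n)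
    rw [hd.tsum_eq, Real.norm_eq_abs, tsum_mul_right] at this
    refine this.trans (le_of_eq (by ring))
  rw [hsum, hSinv]
  refine (abs_sub_le _ _ _).trans ((add_le_add h1 h2).trans (le_of_eq ?_))
  simp only [Nat.add_sub_cancel]
  ring

/-! ### Sieve weights and their diagonalisation -/

/-- Squarefree integers in `[1, R]` coprime to `A`, the support of the sieve weights. -/
noncomputable def sieveSupport (A : ℕ) (R : ℝ) : Finset ℕ :=
  (Ioc 0 ⌊R⌋₊).filter fun d => Squarefree d ∧ d.Coprime A

theorem mem_sieveSupport {A d : ℕ} {R : ℝ} :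
    d ∈ sieveSupport A R ↔ (0 < d ∧ d ≤ ⌊R⌋₊) ∧ Squarefree d ∧ d.Coprime A := by
  simp [sieveSupport]

theorem y_eq_zero {k A m : ℕ} {P : Polynomial ℝ} {R : ℝ} (h : m ∉ sieveSupport A R) :
    y k A P R m = 0 := by
  rw [y]
  split_ifs with h1
  · by_cases hs : Squarefree m
    · exfalso
      have hm0 : m ≠ 0 := hs.ne_zero
      exact h (mem_sieveSupport.2 ⟨⟨Nat.pos_of_ne_zero hm0, (Nat.le_floor_iff' hm0).2 h1.1⟩, hs, h1.2⟩)
    · rw [moebius_eq_zero_of_not_squarefree hs]; simp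
  · rfl

theorem factor_ne_zero {k A : ℕ} (hk : 1 ≤ k) (hkA : ∀ p : ℕ, p.Prime → ¬ p ∣ A → k < p) {d : ℕ}
    (hd : d.Coprime A) : 0 < f k d ∧ 0 < f₁ k d := by
  have hk0 : (0 : ℝ) < k := by exact_mod_cast hk
  have : ∀ p ∈ d.primeFactors, (k : ℝ) < p := by
    intro p hp
    have hpp := Nat.prime_of_mem_primeFactors hp
    exact_mod_cast hkA p hpp (hpp.coprime_iff_not_dvd.1
      (Nat.Coprime.coprime_dvd_left (Nat.dvd_of_mem_primeFactors hp) hd))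
  refine ⟨Finset.prod_pos fun p hp => ?_, Finset.prod_pos fun p hp => ?_⟩
  · exact div_pos (hk0.trans (this p hp)) hk0
  · exact div_pos (by linarith [this p hp]) hk0

theorem sieveDensity_of_mem {k A d : ℕ} {R : ℝ} (h : d ∈ sieveSupport A R) :
    sieveDensity k A d = (f₁ k d)⁻¹ := by
  rw [sieveDensity_apply, if_pos (mem_sieveSupport.1 h).2]

theorem sieveDensity_nonneg {k A : ℕ} (hk : 1 ≤ k) (hkA : ∀ p : ℕ, p.Prime → ¬ p ∣ A → k < p)
    (r : ℕ) : 0 ≤ sieveDensity k A r := by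
  rw [sieveDensity_apply]
  split_ifs with h
  · exact inv_nonneg.2 (factor_ne_zero hk hkA h.2).2.le
  · exact le_rfl

theorem sieveWeight_eq_zero {k A d : ℕ} {P : Polynomial ℝ} {R : ℝ} (hd : 0 < d) (hdR : d ≤ ⌊R⌋₊)
    (h : d ∉ sieveSupport A R) : sieveWeight k A P R d = 0 := by
  rw [sieveWeight]
  by_cases hs : Squarefree d
  · rw [Finset.sum_eq_zero, mul_zero]
    intro r _
    rw [y_eq_zero, zero_div]
    intro hr
    exact h (mem_sieveSupport.2 ⟨⟨hd, hdR⟩, hs,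
      Nat.Coprime.coprime_dvd_left (dvd_mul_left d r) (mem_sieveSupport.1 hr).2.2⟩)
  · rw [moebius_eq_zero_of_not_squarefree hs]; simp

/-- Substitute m = rd. The conditions on r and its cut-off come for free, since y vanishes off the
squarefree m ≤ R coprime to A. -/
theorem sieveWeight_eq {k A d : ℕ} {P : Polynomial ℝ} {R : ℝ} (hd : 0 < d) :
    sieveWeight k A P R d = (moebius d : ℝ) * f k d *
      ∑ m ∈ sieveSupport A R with d ∣ m, y k A P R m * sieveDensity k A m := by
  rw [sieveWeight]
  congr 1
  symm
  refine Finset.sum_bij_ne_zero (fun m _ _ => m / d) ?_ ?_ ?_ ?_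
  · intro m hm _
    obtain ⟨h1, h2⟩ := mem_filter.1 hm
    obtain ⟨⟨h3, h4⟩, h5, h6⟩ := mem_sieveSupport.1 h1
    have hdv : m / d ∣ m := Nat.div_dvd_of_dvd h2
    refine mem_filter.2 ⟨mem_Icc.2 ⟨Nat.div_pos (Nat.le_of_dvd h3 h2) hd, (Nat.div_le_self _ _).trans h4⟩,
      h5.squarefree_of_dvd hdv, Nat.Coprime.coprime_dvd_left hdv h6⟩
  · intro m hm _ m' hm' _ h
    have h2 := (mem_filter.1 hm).2
    have h2' := (mem_filter.1 hm').2
    rw [← Nat.div_mul_cancel h2, ← Nat.div_mul_cancel h2', h]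
  · intro r hr hne
    have hy : y k A P R (r * d) ≠ 0 := fun h => hne (by rw [h, zero_div])
    have hmem : r * d ∈ sieveSupport A R := by
      by_contra h
      exact hy (y_eq_zero h)
    refine ⟨r * d, mem_filter.2 ⟨hmem, dvd_mul_left d r⟩, ?_, Nat.mul_div_cancel _ hd⟩
    rw [sieveDensity_of_mem hmem, ← div_eq_mul_inv]
    exact hne
  · intro m hm _
    obtain ⟨h1, h2⟩ := mem_filter.1 hm
    rw [Nat.div_mul_cancel h2, sieveDensity_of_mem h1, div_eq_mul_inv]

/-- Write d = ce with e | m/c; since m is squarefree, μ(ce) = μ(c) μ(e), and the sum of μ over the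
divisors of m/c detects m = c. -/
theorem sum_moebius_between {c m : ℕ} (hm : Squarefree m) :
    ∑ d ∈ m.divisors with c ∣ d, (moebius d : ℝ) = if c = m then (moebius c : ℝ) else 0 := by
  have hm0 : m ≠ 0 := hm.ne_zero
  by_cases hc : c ∣ m
  · obtain ⟨n, rfl⟩ := hc
    have hc0 : c ≠ 0 := left_ne_zero_of_mul hm0
    have hn0 : n ≠ 0 := right_ne_zero_of_mul hm0
    have hcop : c.Coprime n := Nat.coprime_of_squarefree_mul hm
    have himg : (c * n).divisors.filter (c ∣ ·) = n.divisors.image (c * ·) := by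
      ext d
      simp only [mem_filter, Nat.mem_divisors, mem_image]
      constructor
      · rintro ⟨⟨h1, _⟩, e, rfl⟩
        exact ⟨e, ⟨Nat.dvd_of_mul_dvd_mul_left (Nat.pos_of_ne_zero hc0) h1, hn0⟩, rfl⟩
      · rintro ⟨e, ⟨h1, _⟩, rfl⟩
        exact ⟨⟨mul_dvd_mul_left c h1, hm0⟩, dvd_mul_right c e⟩
    rw [himg, Finset.sum_image (fun a _ b _ h => Nat.eq_of_mul_eq_mul_left (Nat.pos_of_ne_zero hc0) h)]
    have h1 : ∀ e ∈ n.divisors, (moebius (c * e) : ℝ) = (moebius c : ℝ) * (moebius e : ℝ) := by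
      intro e he
      rw [isMultiplicative_moebius.map_mul_of_coprime
        (Nat.Coprime.coprime_dvd_right (Nat.dvd_of_mem_divisors he) hcop)]
      push_cast; rfl
    rw [Finset.sum_congr rfl h1, ← Finset.mul_sum]
    have h2 : ∑ e ∈ n.divisors, (moebius e : ℝ) = if n = 1 then 1 else 0 := by
      have h := congrArg (fun F : ArithmeticFunction ℤ => ((F n : ℤ) : ℝ)) moebius_mul_coe_zeta
      simp only [mul_comm moebius, coe_zeta_mul_apply, one_apply, Int.cast_sum] at h
      rw [h]
      split_ifs <;> simp
    rw [h2]
    by_cases hn : n = 1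
    · simp [hn]
    · rw [if_neg hn, if_neg, mul_zero]
      intro h
      exact hn (Nat.eq_of_mul_eq_mul_left (Nat.pos_of_ne_zero hc0) (by rw [← h, mul_one]))
  · rw [if_neg (by rintro rfl; exact hc dvd_rfl), Finset.sum_eq_zero]
    intro d hd
    obtain ⟨h1, h2⟩ := mem_filter.1 hd
    exact absurd (h2.trans (Nat.dvd_of_mem_divisors h1)) hc

/-- Möbius inversion of the definition of the sieve weights. -/
theorem sum_sieveWeight_div {k A c : ℕ} {P : Polynomial ℝ} {R : ℝ} (hk : 1 ≤ k)
    (hkA : ∀ p : ℕ, p.Prime → ¬ p ∣ A → k < p) :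
    ∑ d ∈ sieveSupport A R with c ∣ d, sieveWeight k A P R d / f k d =
      (moebius c : ℝ) * (y k A P R c * sieveDensity k A c) := by
  have h1 : ∀ d ∈ sieveSupport A R, sieveWeight k A P R d / f k d =
      ∑ m ∈ sieveSupport A R, if d ∣ m then (moebius d : ℝ) * (y k A P R m * sieveDensity k A m) else 0 := by
    intro d hd
    have hm := mem_sieveSupport.1 hd
    have hf := (factor_ne_zero hk hkA hm.2.2).1.ne'
    rw [sieveWeight_eq hm.1.1, mul_right_comm, mul_div_assoc, div_self hf, mul_one, Finset.mul_sum,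
      Finset.sum_filter]
  rw [Finset.sum_congr rfl fun d hd => h1 d (mem_filter.1 hd).1, Finset.sum_comm]
  have h2 : ∀ m ∈ sieveSupport A R, (∑ d ∈ sieveSupport A R with c ∣ d,
      if d ∣ m then (moebius d : ℝ) * (y k A P R m * sieveDensity k A m) else 0) =
      if c = m then (moebius c : ℝ) * (y k A P R c * sieveDensity k A c) else 0 := by
    intro m hm
    obtain ⟨⟨h3, h4⟩, h5, h6⟩ := mem_sieveSupport.1 hm
    rw [← Finset.sum_filter, ← Finset.sum_mul]
    have : ((sieveSupport A R).filter (c ∣ ·)).filter (· ∣ m) = m.divisors.filter (c ∣ ·) := by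
      ext d
      simp only [mem_filter, Nat.mem_divisors]
      constructor
      · rintro ⟨⟨_, h8⟩, h9⟩
        exact ⟨⟨h9, h3.ne'⟩, h8⟩
      · rintro ⟨⟨h7, _⟩, h8⟩
        exact ⟨⟨mem_sieveSupport.2 ⟨⟨Nat.pos_of_dvd_of_pos h7 h3, (Nat.le_of_dvd h3 h7).trans h4⟩,
          h5.squarefree_of_dvd h7, Nat.Coprime.coprime_dvd_left h7 h6⟩, h8⟩, h7⟩
    rw [this, sum_moebius_between h5]
    split_ifs with h
    · rw [h]
    · rw [zero_mul]
  rw [Finset.sum_congr rfl h2, Finset.sum_ite_eq]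
  split_ifs with h
  · rfl
  -- The formula thus holds for c outside the support too. This matters because it is applied to c
  -- times a prime, which may exceed R.
  · rw [y_eq_zero h]; simp

/-- At a prime, 1 + f₁(p) = f(p), and both functions are products over prime factors. Applied to a
gcd, the identity separates the two variables of the quadratic form. -/
theorem f_eq_sum_f₁ {k n : ℕ} (hk : 1 ≤ k) (hn : Squarefree n) :
    ∑ c ∈ n.divisors, f₁ k c = f k n := by
  have hk0 : (k : ℝ) ≠ 0 := by positivity
  have h := IsMultiplicative.prodPrimeFactors_one_add_of_squarefree
    (IsMultiplicative.prodPrimeFactors (fun p : ℕ => ((p : ℝ) - k) / k)) hn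
  have h1 : ∀ c ∈ n.divisors, f₁ k c =
      ArithmeticFunction.prodPrimeFactors (fun p : ℕ => ((p : ℝ) - k) / k) c := by
    intro c hc
    rw [ArithmeticFunction.prodPrimeFactors_apply
      (Nat.pos_of_mem_divisors hc).ne', f₁]
  rw [Finset.sum_congr rfl h1, ← h, f]
  refine Finset.prod_congr rfl fun p hp => ?_
  have hpp := Nat.prime_of_mem_primeFactors hp
  rw [ArithmeticFunction.prodPrimeFactors_apply hpp.ne_zero, hpp.primeFactors, Finset.prod_singleton]
  field_simp
  ring

/-- The product of `q / k` over the primes `q ≠ p` dividing `d`. -/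
noncomputable def fAway (k p d : ℕ) : ℝ := ∏ q ∈ d.primeFactors.erase p, (q : ℝ) / k

theorem fAway_mul {k p d : ℕ} (hp : p.Prime) (hd : d ≠ 0) :
    fAway k p d * (if p ∣ d then f k p else 1) = f k d := by
  rw [fAway, f_prime k hp, f]
  split_ifs with h
  · exact Finset.prod_erase_mul _ _ (Nat.mem_primeFactors.2 ⟨hp, h, hd⟩)
  · rw [mul_one, Finset.erase_eq_of_notMem]
    intro h2; exact h (Nat.dvd_of_mem_primeFactors h2)

/-- Omitting p from the product amounts to restricting to divisors prime to p. This is the origin of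
the condition p ∤ r in the diagonal form. -/
theorem fAway_eq_sum {k p n : ℕ} (hk : 1 ≤ k) (hp : p.Prime) (hn : Squarefree n) :
    ∑ c ∈ n.divisors with ¬ p ∣ c, f₁ k c = fAway k p n := by
  have hp0 : f k p ≠ 0 := by
    rw [f_prime k hp]
    have := hp.pos
    positivity
  by_cases h : p ∣ n
  · obtain ⟨m, rfl⟩ := h
    have hm0 : m ≠ 0 := right_ne_zero_of_mul hn.ne_zero
    have hcop : p.Coprime m := Nat.coprime_of_squarefree_mul hn
    have e : (p * m).divisors.filter (fun c => ¬ p ∣ c) = m.divisors := by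
      ext c
      simp only [mem_filter, Nat.mem_divisors]
      constructor
      · rintro ⟨⟨h1, _⟩, h3⟩
        exact ⟨((hp.coprime_iff_not_dvd.2 h3).symm).dvd_of_dvd_mul_left h1, hm0⟩
      · rintro ⟨h1, _⟩
        exact ⟨⟨h1.mul_left p, hn.ne_zero⟩, fun h3 =>
          hp.coprime_iff_not_dvd.1 hcop (h3.trans h1)⟩
    rw [e, f_eq_sum_f₁ hk (hn.squarefree_of_dvd (dvd_mul_left m p))]
    have := fAway_mul (k := k) hp hn.ne_zero
    rw [if_pos (dvd_mul_right p m), f_mul k hcop, mul_comm (f k p)] at this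
    exact (mul_right_cancel₀ hp0 this).symm
  · rw [Finset.filter_true_of_mem, f_eq_sum_f₁ hk hn]
    · have := fAway_mul (k := k) hp hn.ne_zero
      rwa [if_neg h, mul_one, eq_comm] at this
    · intro c hc h3
      exact h (h3.trans (Nat.dvd_of_mem_divisors hc))

theorem primeFactors_lcm_eq {a b : ℕ} (ha : a ≠ 0) (hb : b ≠ 0) :
    (Nat.lcm a b).primeFactors = a.primeFactors ∪ b.primeFactors := by
  ext q
  simp only [mem_union, Nat.mem_primeFactors]
  constructor
  · rintro ⟨hq, h, _⟩
    rcases hq.dvd_lcm.1 h with h | h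
    · exact Or.inl ⟨hq, h, ha⟩
    · exact Or.inr ⟨hq, h, hb⟩
  · rintro (⟨hq, h, _⟩ | ⟨hq, h, _⟩)
    · exact ⟨hq, h.trans (Nat.dvd_lcm_left a b), Nat.lcm_ne_zero ha hb⟩
    · exact ⟨hq, h.trans (Nat.dvd_lcm_right a b), Nat.lcm_ne_zero ha hb⟩

theorem primeFactors_gcd_eq {a b : ℕ} (ha : a ≠ 0) (hb : b ≠ 0) :
    (Nat.gcd a b).primeFactors = a.primeFactors ∩ b.primeFactors := by
  ext q
  simp only [mem_inter, Nat.mem_primeFactors, Nat.dvd_gcd_iff]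
  have : Nat.gcd a b ≠ 0 := fun h => ha (Nat.eq_zero_of_gcd_eq_zero_left h)
  tauto

/-- The prime p occurs exactly once in [d, e, p], whether or not it divides d or e. Once it is split
off, the product over a union times the product over the intersection is the product of the two
products. -/
theorem f_lcm_lcm {k p d e : ℕ} (hp : p.Prime) (hd : d ≠ 0) (he : e ≠ 0) :
    f k (Nat.lcm (Nat.lcm d e) p) * fAway k p (Nat.gcd d e) = f k p * (fAway k p d * fAway k p e) := by
  have h1 : (Nat.lcm (Nat.lcm d e) p).primeFactors =
      insert p ((d.primeFactors.erase p) ∪ (e.primeFactors.erase p)) := by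
    rw [primeFactors_lcm_eq (Nat.lcm_ne_zero hd he) hp.ne_zero, primeFactors_lcm_eq hd he,
      hp.primeFactors]
    ext q
    simp only [mem_union, mem_singleton, mem_insert, mem_erase]
    tauto
  have h2 : (Nat.gcd d e).primeFactors.erase p =
      (d.primeFactors.erase p) ∩ (e.primeFactors.erase p) := by
    rw [primeFactors_gcd_eq hd he]
    ext q
    simp only [mem_inter, mem_erase]
    tauto
  rw [f, h1, Finset.prod_insert (by simp), fAway, h2, mul_assoc, Finset.prod_union_inter, f_prime k hp]
  rfl

/-- Selberg diagonalisation with an additional prime modulus. -/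
theorem sum_sieveWeight_lcm {k A p : ℕ} (P : Polynomial ℝ) (R : ℝ) (hk : 1 ≤ k)
    (hkA : ∀ p : ℕ, p.Prime → ¬ p ∣ A → k < p) (hp : p.Prime) (hpA : ¬ p ∣ A) :
    ∑ d ∈ sieveSupport A R, ∑ e ∈ sieveSupport A R,
      sieveWeight k A P R d * sieveWeight k A P R e / f k (Nat.lcm (Nat.lcm d e) p) =
    (k / p : ℝ) * ∑ r ∈ Ioc 0 ⌊R⌋₊ with ¬ p ∣ r,
      sieveDensity k A r * (y k A P R r - y k A P R (r * p)) ^ 2 := by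
  have hk0 : (0 : ℝ) < k := by exact_mod_cast hk
  have hp0 : (0 : ℝ) < p := by exact_mod_cast hp.pos
  have hfp : 0 < f k p := by rw [f_prime k hp]; positivity
  have hkp : (k : ℝ) < p := by exact_mod_cast hkA p hp hpA
  set D := sieveSupport A R with hD
  set lam := sieveWeight k A P R with hlam
  have hfA : ∀ d ∈ D, 0 < fAway k p d := by
    intro d _
    refine Finset.prod_pos fun q hq => ?_
    have := (Nat.prime_of_mem_primeFactors (Finset.mem_of_mem_erase hq)).pos
    positivity
  -- The factor attached to gcd(d, e) is expanded over its divisors c prime to p; the dependence on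
  -- d and e then factors for each fixed c.
  have hterm : ∀ d ∈ D, ∀ e ∈ D, lam d * lam e / f k (Nat.lcm (Nat.lcm d e) p) =
      (f k p)⁻¹ * ∑ c ∈ D with ¬ p ∣ c, f₁ k c *
        ((if c ∣ d then lam d / fAway k p d else 0) * (if c ∣ e then lam e / fAway k p e else 0)) := by
    intro d hd e he
    obtain ⟨⟨hd1, hd2⟩, hd3, hd4⟩ := mem_sieveSupport.1 hd
    obtain ⟨⟨he1, he2⟩, he3, he4⟩ := mem_sieveSupport.1 he
    have hg : Squarefree (Nat.gcd d e) := hd3.squarefree_of_dvd (Nat.gcd_dvd_left d e)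
    have hsum : ∑ c ∈ D with ¬ p ∣ c, f₁ k c *
        ((if c ∣ d then lam d / fAway k p d else 0) * (if c ∣ e then lam e / fAway k p e else 0)) =
        fAway k p (Nat.gcd d e) * (lam d / fAway k p d * (lam e / fAway k p e)) := by
      rw [← fAway_eq_sum hk hp hg, Finset.sum_mul]
      have hsub : (Nat.gcd d e).divisors.filter (fun c => ¬ p ∣ c) ⊆ D.filter (fun c => ¬ p ∣ c) := by
        intro c hc
        obtain ⟨h1, h2⟩ := mem_filter.1 hc
        have h3 : c ∣ d := (Nat.dvd_of_mem_divisors h1).trans (Nat.gcd_dvd_left d e)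
        exact mem_filter.2 ⟨mem_sieveSupport.2 ⟨⟨Nat.pos_of_dvd_of_pos h3 hd1,
          (Nat.le_of_dvd hd1 h3).trans hd2⟩, hd3.squarefree_of_dvd h3,
          Nat.Coprime.coprime_dvd_left h3 hd4⟩, h2⟩
      rw [← Finset.sum_subset hsub]
      · refine Finset.sum_congr rfl fun c hc => ?_
        have h1 := Nat.dvd_of_mem_divisors (mem_filter.1 hc).1
        rw [if_pos (h1.trans (Nat.gcd_dvd_left d e)), if_pos (h1.trans (Nat.gcd_dvd_right d e))]
      · intro c hc hc'
        by_cases h1 : c ∣ d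
        · by_cases h2 : c ∣ e
          · exact absurd (mem_filter.2 ⟨Nat.mem_divisors.2 ⟨Nat.dvd_gcd h1 h2, hg.ne_zero⟩,
              (mem_filter.1 hc).2⟩) hc'
          · rw [if_neg h2]; simp
        · rw [if_neg h1]; simp
    rw [hsum]
    have h1 := f_lcm_lcm (k := k) hp hd1.ne' he1.ne'
    have h2 := hfA d hd
    have h3 := hfA e he
    have hF : f k (Nat.lcm (Nat.lcm d e) p) ≠ 0 := by
      intro h0
      rw [h0, zero_mul] at h1
      have : 0 < f k p * (fAway k p d * fAway k p e) := by positivity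
      linarith
    rw [div_eq_iff hF]
    calc lam d * lam e = (f k p)⁻¹ * (f k p * (fAway k p d * fAway k p e)) *
          (lam d / fAway k p d * (lam e / fAway k p e)) := by field_simp
      _ = _ := by rw [← h1]; ring
  have hinner : ∀ c ∈ D, ¬ p ∣ c → ∑ d ∈ D, (if c ∣ d then lam d / fAway k p d else 0) =
      (moebius c : ℝ) * sieveDensity k A c * (y k A P R c - y k A P R (c * p)) := by
    intro c hc hpc
    have hcop : c.Coprime p := (hp.coprime_iff_not_dvd.2 hpc).symm
    -- Removing p from f(d) multiplies 1/f(d) by f(p) exactly when p | d. The correction f(p) - 1 =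
    -- f₁(p) cancels the density at p, and μ(cp) = -μ(c) produces the difference y_c - y_{cp}.
    have h1 : ∀ d ∈ D, (if c ∣ d then lam d / fAway k p d else 0) =
        (if c ∣ d then lam d / f k d else 0) +
          (f k p - 1) * (if c * p ∣ d then lam d / f k d else 0) := by
      intro d hd
      have hm := mem_sieveSupport.1 hd
      have h2 := fAway_mul (k := k) hp hm.1.1.ne'
      have h3 := (hfA d hd).ne'
      have hiff : c * p ∣ d ↔ c ∣ d ∧ p ∣ d := by
        constructor
        · intro h; exact ⟨(dvd_mul_right c p).trans h, (dvd_mul_left p c).trans h⟩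
        · rintro ⟨h4, h5⟩; exact hcop.mul_dvd_of_dvd_of_dvd h4 h5
      by_cases h4 : c ∣ d
      · by_cases h5 : p ∣ d
        · rw [if_pos h4, if_pos h4, if_pos (hiff.2 ⟨h4, h5⟩), ← h2, if_pos h5]
          have := hfp.ne'
          field_simp
          ring
        · rw [if_pos h4, if_pos h4, if_neg (fun h => h5 (hiff.1 h).2), ← h2, if_neg h5]
          ring
      · rw [if_neg h4, if_neg h4, if_neg (fun h => h4 (hiff.1 h).1)]
        ring
    rw [Finset.sum_congr rfl h1, Finset.sum_add_distrib, ← Finset.mul_sum, ← Finset.sum_filter,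
      ← Finset.sum_filter, sum_sieveWeight_div hk hkA, sum_sieveWeight_div hk hkA,
      isMultiplicative_moebius.map_mul_of_coprime hcop, moebius_apply_prime hp,
      (isMultiplicative_sieveDensity k A).map_mul_of_coprime hcop,
      sieveDensity_prime_of_not_dvd hp hpA, f_prime k hp]
    have : (p : ℝ) - k ≠ 0 := by linarith
    push_cast
    field_simp
    ring
  rw [Finset.sum_congr rfl fun d hd => Finset.sum_congr rfl fun e he => hterm d hd e he]
  simp_rw [← Finset.mul_sum]
  have hkp' : (k / p : ℝ) = (f k p)⁻¹ := by rw [f_prime k hp, inv_div]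
  rw [hkp']
  congr 1
  have hsub : D.filter (fun r => ¬ p ∣ r) ⊆ (Ioc 0 ⌊R⌋₊).filter (fun r => ¬ p ∣ r) :=
    Finset.filter_subset_filter _ (Finset.filter_subset _ _)
  rw [← Finset.sum_subset hsub]
  · simp_rw [Finset.sum_comm (s := D) (t := D.filter (fun c => ¬ p ∣ c))]
    refine Finset.sum_congr rfl fun c hc => ?_
    obtain ⟨hc1, hc2⟩ := mem_filter.1 hc
    simp_rw [← Finset.mul_sum, ← Finset.sum_mul]
    rw [hinner c hc1 hc2]
    have hm := mem_sieveSupport.1 hc1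
    have hmu : ((moebius c : ℤ) : ℝ) ^ 2 = 1 := by
      exact_mod_cast moebius_sq_eq_one_of_squarefree hm.2.1
    have hf1 := (factor_ne_zero hk hkA hm.2.2).2.ne'
    rw [sieveDensity_of_mem hc1]
    calc _ = (moebius c : ℝ) ^ 2 * (f₁ k c * (f₁ k c)⁻¹) * (f₁ k c)⁻¹ *
          (y k A P R c - y k A P R (c * p)) ^ 2 := by ring
      _ = _ := by rw [hmu, mul_inv_cancel₀ hf1]; ring
  · intro r hr hr'
    rw [sieveDensity_apply, if_neg, zero_mul]
    intro h
    exact hr' (mem_filter.2 ⟨mem_filter.2 ⟨(mem_filter.1 hr).1, h⟩, (mem_filter.1 hr).2⟩)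

/-! ### Counting n in [N, 2N] with m | Π(n) -/

/-- The roots of `∏ (aᵢ x + bᵢ)` modulo `m`. -/
def RootMod {k : ℕ} (a : Fin k → ℕ) (b : Fin k → ℤ) (m : ℕ) : Type :=
  {x : ZMod m // ∏ i, ((a i : ZMod m) * x + (b i : ZMod m)) = 0}

theorem card_rootMod_mul {k : ℕ} (a : Fin k → ℕ) (b : Fin k → ℤ) {m n : ℕ} (h : m.Coprime n) :
    Nat.card (RootMod a b (m * n)) = Nat.card (RootMod a b m) * Nat.card (RootMod a b n) := by
  rw [← Nat.card_prod]
  refine Nat.card_congr ((Equiv.subtypeEquiv (ZMod.chineseRemainder h).toEquiv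
    (q := fun z => (∏ i, ((a i : ZMod m) * z.1 + (b i : ZMod m)) = 0) ∧
      (∏ i, ((a i : ZMod n) * z.2 + (b i : ZMod n)) = 0)) ?_).trans (Equiv.subtypeProdEquivProd
      (p := fun z : ZMod m => ∏ i, ((a i : ZMod m) * z + (b i : ZMod m)) = 0)
      (q := fun z : ZMod n => ∏ i, ((a i : ZMod n) * z + (b i : ZMod n)) = 0)))
  intro x
  rw [← map_eq_zero_iff (ZMod.chineseRemainder h) (ZMod.chineseRemainder h).injective, map_prod]
  simp only [map_add, map_mul, map_natCast, map_intCast, RingEquiv.toEquiv_eq_coe, EquivLike.coe_coe]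
  rw [Prod.ext_iff, Prod.fst_prod, Prod.snd_prod]
  rfl

theorem not_dvd_of_not_dvd_prod {k : ℕ} {a : Fin k → ℕ} {p : ℕ}
    (h : ¬ p ∣ ∏ i, a i) (i : Fin k) : ¬ p ∣ a i := fun hi =>
  h (hi.trans (Finset.dvd_prod_of_mem a (mem_univ i)))

/-- Each linear factor has the single root -bᵢ/aᵢ modulo p. Two equal roots would make p divide aᵢbⱼ
- aⱼbᵢ, which `cross` allows only for p | A. -/
theorem Normalised.card_rootMod_prime {k : ℕ} {a : Fin k → ℕ} {b : Fin k → ℤ} (hab : Normalised a b)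
    {p : ℕ} (hp : p.Prime) (h : ¬ p ∣ ∏ i, a i) : Nat.card (RootMod a b p) = k := by
  have : Fact p.Prime := ⟨hp⟩
  have ha : ∀ i, (a i : ZMod p) ≠ 0 := fun i h0 =>
    not_dvd_of_not_dvd_prod h i ((ZMod.natCast_eq_zero_iff _ _).1 h0)
  set φ : Fin k → RootMod a b p := fun i => ⟨-(b i : ZMod p) / (a i : ZMod p), by
    refine Finset.prod_eq_zero (mem_univ i) ?_
    have := ha i
    field_simp
    ring⟩ with hφ
  have hbij : Function.Bijective φ := by
    constructor
    · intro i j hij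
      by_contra hne
      have h1 : -(b i : ZMod p) / (a i : ZMod p) = -(b j : ZMod p) / (a j : ZMod p) :=
        congrArg Subtype.val hij
      rw [div_eq_div_iff (ha i) (ha j)] at h1
      have h2 : (((a i : ℤ) * b j - (a j : ℤ) * b i : ℤ) : ZMod p) = 0 := by
        push_cast
        linear_combination h1
      exact not_dvd_of_not_dvd_prod h i
        (hab.cross i j hne p hp ((ZMod.intCast_zmod_eq_zero_iff_dvd _ _).1 h2) i)
    · rintro ⟨x, hx⟩
      obtain ⟨i, _, hi⟩ := Finset.prod_eq_zero_iff.1 hx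
      refine ⟨i, Subtype.ext ?_⟩
      change -(b i : ZMod p) / (a i : ZMod p) = x
      rw [div_eq_iff (ha i)]
      linear_combination -hi
  rw [← Nat.card_eq_of_bijective φ hbij, Nat.card_fin]

theorem Normalised.card_rootMod {k : ℕ} {a : Fin k → ℕ} {b : Fin k → ℤ} (hab : Normalised a b)
    {m : ℕ} (hm : Squarefree m) (h : m.Coprime (∏ i, a i)) :
    Nat.card (RootMod a b m) = k ^ m.primeFactors.card := by
  induction m using induction_on_primes with
  | zero => exact absurd hm not_squarefree_zero
  | one =>
    rw [Nat.primeFactors_one, Finset.card_empty, pow_zero]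
    refine Nat.card_eq_one_iff_unique.2 ⟨⟨?_⟩, ⟨⟨0, Subsingleton.elim _ _⟩⟩⟩
    rintro ⟨x, hx⟩ ⟨z, hz⟩
    exact Subtype.ext (Subsingleton.elim _ _)
  | prime_mul p n hp ih =>
    have hcop : p.Coprime n := Nat.coprime_of_squarefree_mul hm
    have hpA : ¬ p ∣ ∏ i, a i :=
      (hp.coprime_iff_not_dvd).1 (Nat.Coprime.coprime_dvd_left (dvd_mul_right p n) h)
    rw [card_rootMod_mul a b hcop, hab.card_rootMod_prime hp hpA,
      ih (hm.squarefree_of_dvd (dvd_mul_left n p))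
        (Nat.Coprime.coprime_dvd_left (dvd_mul_left n p) h),
      hcop.primeFactors_mul, Finset.card_union_of_disjoint hcop.disjoint_primeFactors,
      hp.primeFactors, Finset.card_singleton, pow_add, pow_one]

/-- The interval contains N + O(1) integers with constant 1, and rounding the two quotients costs
less than 1 more; the constant 3 leaves room. -/
theorem abs_card_residue_sub_le {N : ℝ} (hN : 1 ≤ N) {m : ℕ} (hm : 0 < m) (v : ZMod m) :
    |((((Icc ⌈N⌉₊ ⌊2 * N⌋₊).filter fun n : ℕ => (n : ZMod m) = v).card : ℕ) : ℝ) - N / m| ≤ 3 := by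
  have : NeZero m := ⟨hm.ne'⟩
  have hc : 1 ≤ ⌈N⌉₊ := Nat.one_le_ceil_iff.2 (by linarith)
  obtain ⟨u, hu⟩ : ∃ u, ⌈N⌉₊ = u + 1 := ⟨⌈N⌉₊ - 1, by omega⟩
  have hset : (Icc ⌈N⌉₊ ⌊2 * N⌋₊).filter (fun n : ℕ => (n : ZMod m) = v) =
      (Ioc u ⌊2 * N⌋₊).filter (fun n : ℕ => n ≡ v.val [MOD m]) := by
    ext n
    simp only [mem_filter, mem_Icc, mem_Ioc, hu, Nat.succ_le_iff, ← ZMod.natCast_eq_natCast_iff,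
      ZMod.natCast_val, ZMod.cast_id', id_eq]
  have hcard := Nat.Ioc_filter_modEq_card u ⌊2 * N⌋₊ hm v.val
  rw [hset]
  have hm1 : (1 : ℝ) ≤ m := by exact_mod_cast hm
  have hu1 : (u : ℝ) < N := by
    have := Nat.ceil_lt_add_one (by linarith : 0 ≤ N)
    rw [hu] at this; push_cast at this; linarith
  have hu2 : N ≤ u + 1 := by
    have := Nat.le_ceil N
    rw [hu] at this; push_cast at this; linarith
  have ht1 : ((⌊2 * N⌋₊ : ℕ) : ℝ) ≤ 2 * N := Nat.floor_le (by linarith)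
  have ht2 : 2 * N < (⌊2 * N⌋₊ : ℕ) + 1 := Nat.lt_floor_add_one _
  set T : ℕ := ⌊2 * N⌋₊ with hT
  set X : ℚ := ((T : ℚ) - (v.val : ℚ)) / (m : ℚ) with hX
  set Y : ℚ := ((u : ℚ) - (v.val : ℚ)) / (m : ℚ) with hY
  have hXY : ((X : ℝ)) - (Y : ℝ) = ((T : ℝ) - u) / m := by
    rw [hX, hY]; push_cast; ring
  have hX1 := Int.floor_le X
  have hX2 := Int.lt_floor_add_one X
  have hY1 := Int.floor_le Y
  have hY2 := Int.lt_floor_add_one Y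
  have hX1' : ((⌊X⌋ : ℤ) : ℝ) ≤ (X : ℝ) := by exact_mod_cast hX1
  have hX2' : (X : ℝ) < ((⌊X⌋ : ℤ) : ℝ) + 1 := by exact_mod_cast hX2
  have hY1' : ((⌊Y⌋ : ℤ) : ℝ) ≤ (Y : ℝ) := by exact_mod_cast hY1
  have hY2' : (Y : ℝ) < ((⌊Y⌋ : ℤ) : ℝ) + 1 := by exact_mod_cast hY2
  have hcardR : ((((Ioc u T).filter (fun n : ℕ => n ≡ v.val [MOD m])).card : ℕ) : ℝ) =
      max (((⌊X⌋ : ℤ) : ℝ) - ((⌊Y⌋ : ℤ) : ℝ)) 0 := by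
    exact_mod_cast hcard
  rw [hcardR]
  have hdiv : |((T : ℝ) - u) / m - N / m| ≤ 1 := by
    rw [← sub_div, abs_div, abs_of_pos (by linarith : (0 : ℝ) < m), div_le_one (by linarith)]
    refine le_trans ?_ hm1
    rw [abs_le]; constructor <;> linarith
  obtain ⟨hd1, hd2⟩ := abs_le.1 hdiv
  have hNm : 0 ≤ N / m := by positivity
  rw [abs_le]
  constructor
  · have := le_max_left (((⌊X⌋ : ℤ) : ℝ) - ((⌊Y⌋ : ℤ) : ℝ)) 0
    linarith
  · have : max (((⌊X⌋ : ℤ) : ℝ) - ((⌊Y⌋ : ℤ) : ℝ)) 0 ≤ N / m + 3 := max_le (by linarith) (by linarith)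
    linarith

theorem f_eq_div {k m : ℕ} (hm : Squarefree m) :
    f k m = m / (k : ℝ) ^ m.primeFactors.card := by
  rw [f, Finset.prod_div_distrib, Finset.prod_const]
  congr 1
  rw [← Nat.cast_prod, Nat.prod_primeFactors_of_squarefree hm]

/-- The number of `n ∈ [N, 2N]` with `m ∣ Π(n)`. -/
theorem Normalised.abs_card_dvd_sub_le {k : ℕ} {a : Fin k → ℕ} {b : Fin k → ℤ} (hab : Normalised a b)
    {m : ℕ} (hm : Squarefree m) (h : m.Coprime (∏ i, a i)) {N : ℝ} (hN : 1 ≤ N) :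
    |((((Icc ⌈N⌉₊ ⌊2 * N⌋₊).filter fun n : ℕ => (m : ℤ) ∣ bigPi a b n).card : ℕ) : ℝ) - N / f k m| ≤
      3 * (k : ℝ) ^ m.primeFactors.card := by
  classical
  have hm0 : m ≠ 0 := hm.ne_zero
  have : NeZero m := ⟨hm0⟩
  set Z : Finset (ZMod m) := univ.filter fun x => ∏ i, ((a i : ZMod m) * x + (b i : ZMod m)) = 0 with hZ
  have hZc : Z.card = k ^ m.primeFactors.card := by
    rw [← hab.card_rootMod hm h, RootMod, Nat.card_eq_fintype_card, Fintype.card_subtype]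
  have hcast : ∀ n : ℕ, (m : ℤ) ∣ bigPi a b n ↔ (n : ZMod m) ∈ Z := by
    intro n
    rw [← ZMod.intCast_zmod_eq_zero_iff_dvd, hZ, mem_filter, bigPi]
    push_cast
    simp
  have hsum : (((Icc ⌈N⌉₊ ⌊2 * N⌋₊).filter fun n : ℕ => (m : ℤ) ∣ bigPi a b n).card) =
      ∑ v ∈ Z, ((Icc ⌈N⌉₊ ⌊2 * N⌋₊).filter fun n : ℕ => (n : ZMod m) = v).card := by
    rw [Finset.card_eq_sum_card_fiberwise (f := fun n : ℕ => (n : ZMod m)) (t := Z)]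
    · refine Finset.sum_congr rfl fun v hv => ?_
      congr 1
      ext n
      simp only [mem_filter, hcast]
      constructor
      · rintro ⟨⟨h1, _⟩, h3⟩; exact ⟨h1, h3⟩
      · rintro ⟨h1, h3⟩; exact ⟨⟨h1, h3 ▸ hv⟩, h3⟩
    · intro n hn
      have := (mem_filter.1 (Finset.mem_coe.1 hn)).2
      exact Finset.mem_coe.2 ((hcast n).1 this)
  rw [hsum]
  have hN' : N / f k m = ∑ v ∈ Z, N / (m : ℝ) := by
    rw [Finset.sum_const, hZc, f_eq_div hm, nsmul_eq_mul]
    push_cast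
    rw [div_div_eq_mul_div]; ring
  rw [hN']
  push_cast
  rw [← Finset.sum_sub_distrib]
  refine (Finset.abs_sum_le_sum_abs _ _).trans ?_
  refine (Finset.sum_le_sum fun v _ => abs_card_residue_sub_le hN (Nat.pos_of_ne_zero hm0) v).trans ?_
  rw [Finset.sum_const, hZc, nsmul_eq_mul]
  push_cast
  linarith

/-- Π has k roots modulo p, and admissibility provides a residue class that is not a root. Hence
every factor p - k that occurs is positive. -/
theorem Normalised.lt_of_not_dvd {k : ℕ} {a : Fin k → ℕ} {b : Fin k → ℤ} (hab : Normalised a b)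
    {p : ℕ} (hp : p.Prime) (h : ¬ p ∣ ∏ i, a i) : k < p := by
  classical
  have : Fact p.Prime := ⟨hp⟩
  have hc := hab.card_rootMod_prime hp h
  rw [RootMod, Nat.card_eq_fintype_card] at hc
  obtain ⟨n, hn⟩ := hab.admissible p hp
  have hlt := Fintype.card_subtype_lt
    (p := fun x : ZMod p => ∏ i, ((a i : ZMod p) * x + (b i : ZMod p)) = 0) (x := (n : ZMod p)) ?_
  · rwa [hc, ZMod.card] at hlt
  · intro h0
    obtain ⟨i, _, hi⟩ := Finset.prod_eq_zero_iff.1 h0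
    refine hn i ((ZMod.intCast_zmod_eq_zero_iff_dvd _ _).1 ?_)
    push_cast
    exact hi

/-! ### Expanding the weighted sum and bounding its remainder -/

theorem squarefree_lcm {a b : ℕ} (ha : Squarefree a) (hb : Squarefree b) : Squarefree (Nat.lcm a b) := by
  have ha0 := ha.ne_zero
  have hb0 := hb.ne_zero
  rw [Nat.squarefree_iff_factorization_le_one (Nat.lcm_ne_zero ha0 hb0), ]
  intro p
  rw [Nat.factorization_lcm ha0 hb0, Finsupp.sup_apply]
  exact sup_le (ha.natFactorization_le_one p) (hb.natFactorization_le_one p)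

theorem coprime_lcm {a b A : ℕ} (ha : a.Coprime A) (hb : b.Coprime A) : (Nat.lcm a b).Coprime A :=
  Nat.Coprime.coprime_dvd_left (Nat.lcm_dvd_mul a b) (ha.mul_left hb)

/-- If p divides one aᵢ it divides all of them, so Lⱼ(n) ≡ bⱼ, which is nonzero modulo p. Primes
dividing A can therefore be dropped from the sum over p. -/
theorem Normalised.not_dvd_bigPi {k : ℕ} {a : Fin k → ℕ} {b : Fin k → ℤ} (hab : Normalised a b)
    {p : ℕ} (hp : p.Prime) (h : p ∣ ∏ i, a i) (n : ℕ) : ¬ (p : ℤ) ∣ bigPi a b n := by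
  intro hd
  obtain ⟨i, _, hi⟩ := (hp.prime.dvd_finsetProd_iff _).1 h
  obtain ⟨j, _, hj⟩ := ((Nat.prime_iff_prime_int.1 hp).dvd_finsetProd_iff _).1 hd
  have h1 : (p : ℤ) ∣ (a j : ℤ) := by exact_mod_cast hab.same_primes i j p hp hi
  exact hab.coprime i j p hp hi ((dvd_add_right (h1.mul_right _)).1 hj)

/-- After squaring, the three conditions d, e, p | Π(n) merge into a single divisibility by their
least common multiple. -/
theorem weightedSum_eq {k : ℕ} {a : Fin k → ℕ} {b : Fin k → ℤ} (hab : Normalised a b)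
    (P : Polynomial ℝ) (W : ℝ → ℝ) (N R₁ R₂ : ℝ) :
    weightedSum a b P W N R₁ R₂ =
      ∑ p ∈ Icc 1 ⌊R₁⌋₊ with p.Prime ∧ ¬ p ∣ ∏ i, a i, W (Real.log p / Real.log R₂) *
        ∑ d ∈ sieveSupport (∏ i, a i) R₂, ∑ e ∈ sieveSupport (∏ i, a i) R₂,
          sieveWeight k (∏ i, a i) P R₂ d * sieveWeight k (∏ i, a i) P R₂ e *
          (((Icc ⌈N⌉₊ ⌊2 * N⌋₊).filter fun n : ℕ =>
            ((Nat.lcm (Nat.lcm d e) p : ℕ) : ℤ) ∣ bigPi a b n).card : ℝ) := by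
  set A := ∏ i, a i with hA
  set D := sieveSupport A R₂ with hD
  set lam := sieveWeight k A P R₂ with hlam
  set Q := (Icc 1 ⌊R₁⌋₊).filter fun p : ℕ => p.Prime ∧ ¬ p ∣ A with hQ
  have hd : ∀ n : ℕ, ∑ d ∈ (Icc 1 ⌊R₂⌋₊).filter (fun d : ℕ => (d : ℤ) ∣ bigPi a b n), lam d =
      ∑ d ∈ D, if (d : ℤ) ∣ bigPi a b n then lam d else 0 := by
    intro n
    rw [Finset.sum_filter, Icc_one_eq_Ioc]
    symm
    refine Finset.sum_subset (Finset.filter_subset _ _) fun d hd hd' => ?_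
    obtain ⟨h1, h2⟩ := mem_Ioc.1 hd
    rw [hlam, sieveWeight_eq_zero h1 h2 hd', ite_self]
  have hp : ∀ n : ℕ, ∑ p ∈ (Icc 1 ⌊R₁⌋₊).filter (fun p : ℕ => p.Prime ∧ (p : ℤ) ∣ bigPi a b n),
      W (Real.log (p : ℝ) / Real.log R₂) =
      ∑ p ∈ Q, if (p : ℤ) ∣ bigPi a b n then W (Real.log (p : ℝ) / Real.log R₂) else 0 := by
    intro n
    rw [← Finset.sum_filter]
    congr 1
    ext p
    simp only [hQ, mem_filter]
    constructor
    · rintro ⟨h1, h2, h3⟩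
      exact ⟨⟨h1, h2, fun h => hab.not_dvd_bigPi h2 h n h3⟩, h3⟩
    · rintro ⟨⟨h1, h2, _⟩, h3⟩
      exact ⟨h1, h2, h3⟩
  rw [weightedSum, ← hA, ← hlam]
  simp_rw [hd, hp, Finset.card_eq_sum_ones, Nat.cast_sum, Finset.sum_filter]
  simp_rw [Finset.mul_sum]
  have hterm : ∀ n : ℕ, (∑ p ∈ Q, if (p : ℤ) ∣ bigPi a b n then W (Real.log (p : ℝ) / Real.log R₂) else 0) *
      (∑ d ∈ D, if (d : ℤ) ∣ bigPi a b n then lam d else 0) ^ 2 =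
      ∑ p ∈ Q, ∑ d ∈ D, ∑ e ∈ D, W (Real.log p / Real.log R₂) * (lam d * lam e *
        if ((Nat.lcm (Nat.lcm d e) p : ℕ) : ℤ) ∣ bigPi a b n then ((1 : ℕ) : ℝ) else 0) := by
    intro n
    rw [Finset.sum_mul]
    refine Finset.sum_congr rfl fun p _ => ?_
    rw [pow_two, Finset.sum_mul_sum, Finset.mul_sum]
    refine Finset.sum_congr rfl fun d _ => ?_
    rw [Finset.mul_sum]
    refine Finset.sum_congr rfl fun e _ => ?_
    have hiff : ((Nat.lcm (Nat.lcm d e) p : ℕ) : ℤ) ∣ bigPi a b n ↔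
        ((d : ℤ) ∣ bigPi a b n ∧ (e : ℤ) ∣ bigPi a b n) ∧ (p : ℤ) ∣ bigPi a b n := by
      simp only [Int.natCast_dvd, Nat.lcm_dvd_iff]
    by_cases h1 : (d : ℤ) ∣ bigPi a b n <;> by_cases h2 : (e : ℤ) ∣ bigPi a b n <;>
      by_cases h3 : (p : ℤ) ∣ bigPi a b n <;> simp [hiff, h1, h2, h3]
  rw [Finset.sum_congr rfl fun n _ => hterm n, Finset.sum_comm]
  refine Finset.sum_congr rfl fun p _ => ?_
  rw [Finset.sum_comm]
  refine Finset.sum_congr rfl fun d _ => ?_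
  rw [Finset.sum_comm]

/-- A triple (d, e, p) contributes an error of at most 3 k^ω([d, e, p]) ≤ 3k · k^ω(d) k^ω(e). The
bound factors, so the sum over d and e becomes a square; there are at most R₁ primes. -/
theorem abs_weightedSum_sub_le {k : ℕ} (hk : 1 ≤ k) {a : Fin k → ℕ} {b : Fin k → ℤ}
    (hab : Normalised a b) (P : Polynomial ℝ) (W : ℝ → ℝ) {N R₁ R₂ B : ℝ} (hN : 1 ≤ N) (hR₁ : 0 ≤ R₁) (hB0 : 0 ≤ B)
    (hB : ∀ p ∈ Icc 1 ⌊R₁⌋₊, p.Prime → |W (Real.log p / Real.log R₂)| ≤ B) :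
    |weightedSum a b P W N R₁ R₂ - N * ∑ p ∈ Icc 1 ⌊R₁⌋₊ with p.Prime ∧ ¬ p ∣ ∏ i, a i,
      W (Real.log p / Real.log R₂) * ((k / p : ℝ) * ∑ r ∈ Ioc 0 ⌊R₂⌋₊ with ¬ p ∣ r,
        sieveDensity k (∏ i, a i) r *
          (y k (∏ i, a i) P R₂ r - y k (∏ i, a i) P R₂ (r * p)) ^ 2)| ≤
    R₁ * (B * (3 * k)) * (∑ d ∈ sieveSupport (∏ i, a i) R₂,
      |sieveWeight k (∏ i, a i) P R₂ d| * (k : ℝ) ^ d.primeFactors.card) ^ 2 := by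
  have hkA : ∀ p : ℕ, p.Prime → ¬ p ∣ ∏ i, a i → k < p := fun p hp h => hab.lt_of_not_dvd hp h
  rw [weightedSum_eq hab]
  set A := ∏ i, a i with hA
  set D := sieveSupport A R₂ with hD
  set lam := sieveWeight k A P R₂ with hlam
  set Q := (Icc 1 ⌊R₁⌋₊).filter fun p : ℕ => p.Prime ∧ ¬ p ∣ A with hQ
  have hk1 : (1 : ℝ) ≤ k := by exact_mod_cast hk
  set E : ℝ := ∑ d ∈ D, |lam d| * (k : ℝ) ^ d.primeFactors.card with hE
  rw [Finset.mul_sum, ← Finset.sum_sub_distrib]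
  have hterm : ∀ p ∈ Q, |W (Real.log p / Real.log R₂) * (∑ d ∈ D, ∑ e ∈ D, lam d * lam e *
      (((Icc ⌈N⌉₊ ⌊2 * N⌋₊).filter fun n : ℕ =>
        ((Nat.lcm (Nat.lcm d e) p : ℕ) : ℤ) ∣ bigPi a b n).card : ℝ)) -
      N * (W (Real.log p / Real.log R₂) * ((k / p : ℝ) * ∑ r ∈ Ioc 0 ⌊R₂⌋₊ with ¬ p ∣ r,
        sieveDensity k A r * (y k A P R₂ r - y k A P R₂ (r * p)) ^ 2))| ≤ B * (3 * k) * E ^ 2 := by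
    intro p hp
    obtain ⟨hp1, hp2, hp3⟩ := mem_filter.1 hp
    rw [← sum_sieveWeight_lcm P R₂ hk hkA hp2 hp3, mul_left_comm N, ← mul_sub, abs_mul, mul_assoc B]
    refine mul_le_mul (hB p hp1 hp2) ?_ (abs_nonneg _) ((abs_nonneg _).trans (hB p hp1 hp2))
    simp_rw [Finset.mul_sum]
    rw [← Finset.sum_sub_distrib]
    refine (Finset.abs_sum_le_sum_abs _ _).trans ?_
    have hE2 : 3 * k * E ^ 2 = ∑ d ∈ D, ∑ e ∈ D, 3 * k *
        ((|lam d| * (k : ℝ) ^ d.primeFactors.card) * (|lam e| * (k : ℝ) ^ e.primeFactors.card)) := by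
      rw [pow_two, hE, Finset.sum_mul_sum, Finset.mul_sum]
      simp_rw [Finset.mul_sum]
    rw [hE2]
    refine Finset.sum_le_sum fun d hd => ?_
    rw [← Finset.sum_sub_distrib]
    refine (Finset.abs_sum_le_sum_abs _ _).trans (Finset.sum_le_sum fun e he => ?_)
    obtain ⟨⟨hd1, hd2⟩, hd3, hd4⟩ := mem_sieveSupport.1 hd
    obtain ⟨⟨he1, he2⟩, he3, he4⟩ := mem_sieveSupport.1 he
    have hcard := hab.abs_card_dvd_sub_le
      (squarefree_lcm (squarefree_lcm hd3 he3) hp2.prime.squarefree)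
      (coprime_lcm (coprime_lcm hd4 he4) (hp2.coprime_iff_not_dvd.2 hp3)) hN
    have hω : ((Nat.lcm (Nat.lcm d e) p).primeFactors).card ≤
        d.primeFactors.card + e.primeFactors.card + 1 := by
      rw [primeFactors_lcm_eq (Nat.lcm_ne_zero hd1.ne' he1.ne') hp2.ne_zero,
        primeFactors_lcm_eq hd1.ne' he1.ne', hp2.primeFactors]
      refine (Finset.card_union_le _ _).trans ?_
      rw [Finset.card_singleton]
      exact Nat.add_le_add_right (Finset.card_union_le _ _) 1
    have e1 : ∀ c : ℝ, lam d * lam e * c - N * (lam d * lam e / f k (Nat.lcm (Nat.lcm d e) p)) =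
        lam d * lam e * (c - N / f k (Nat.lcm (Nat.lcm d e) p)) := fun c => by ring
    rw [e1, abs_mul, abs_mul]
    calc _ ≤ |lam d| * |lam e| * (3 * (k : ℝ) ^ (d.primeFactors.card + e.primeFactors.card + 1)) := by
          refine mul_le_mul_of_nonneg_left (hcard.trans ?_) (by positivity)
          gcongr
      _ = _ := by ring
  refine (Finset.abs_sum_le_sum_abs _ _).trans ((Finset.sum_le_sum hterm).trans ?_)
  rw [Finset.sum_const, nsmul_eq_mul, mul_assoc R₁]
  refine mul_le_mul_of_nonneg_right ?_ (by positivity)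
  have h1 : Q.card ≤ ⌊R₁⌋₊ := (Finset.card_filter_le _ _).trans (by simp)
  exact (Nat.cast_le.2 h1).trans (Nat.floor_le hR₁)

/-- The factor k^ω(d) cancels the denominator of f(d) and leaves d. After exchanging sums, the
divisors of m contribute ∑ d = m ∑ 1/d ≤ R (1 + log R). -/
theorem sum_abs_sieveWeight_le {k A : ℕ} (hk : 1 ≤ k)
    (hkA : ∀ p : ℕ, p.Prime → ¬ p ∣ A → k < p) (P : Polynomial ℝ) {R M : ℝ} (hR : 1 ≤ R)
    (hM : ∀ m ∈ sieveSupport A R, |y k A P R m| ≤ M) (hM0 : 0 ≤ M) :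
    ∑ d ∈ sieveSupport A R, |sieveWeight k A P R d| * (k : ℝ) ^ d.primeFactors.card ≤
      M * (R * (1 + Real.log R)) * ∑ m ∈ Ioc 0 ⌊R⌋₊, sieveDensity k A m := by
  set D := sieveSupport A R with hD
  have hg := fun m => sieveDensity_nonneg hk hkA m
  have h1 : ∀ d ∈ D, |sieveWeight k A P R d| * (k : ℝ) ^ d.primeFactors.card ≤
      ∑ m ∈ D, if d ∣ m then (d : ℝ) * (M * sieveDensity k A m) else 0 := by
    intro d hd
    obtain ⟨⟨hd1, hd2⟩, hd3, hd4⟩ := mem_sieveSupport.1 hd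
    have hfd : f k d * (k : ℝ) ^ d.primeFactors.card = d := by
      rw [f_eq_div hd3, div_mul_cancel₀]
      positivity
    have hmu : |((moebius d : ℤ) : ℝ)| = 1 := by
      rw [← Int.cast_abs, abs_moebius_eq_one_of_squarefree hd3, Int.cast_one]
    rw [sieveWeight_eq hd1, abs_mul, abs_mul, hmu, one_mul,
      abs_of_pos (factor_ne_zero hk hkA hd4).1, mul_right_comm, hfd, ← Finset.sum_filter,
      ← Finset.mul_sum]
    refine mul_le_mul_of_nonneg_left ?_ (Nat.cast_nonneg d)
    refine (Finset.abs_sum_le_sum_abs _ _).trans (Finset.sum_le_sum fun m hm => ?_)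
    rw [abs_mul, abs_of_nonneg (hg m)]
    exact mul_le_mul_of_nonneg_right (hM m (mem_filter.1 hm).1) (hg m)
  refine (Finset.sum_le_sum h1).trans ?_
  rw [Finset.sum_comm]
  have h2 : ∀ m ∈ D, (∑ d ∈ D, if d ∣ m then (d : ℝ) * (M * sieveDensity k A m) else 0) ≤
      M * (R * (1 + Real.log R)) * sieveDensity k A m := by
    intro m hm
    obtain ⟨⟨hm1, hm2⟩, hm3, hm4⟩ := mem_sieveSupport.1 hm
    rw [← Finset.sum_filter, ← Finset.sum_mul]
    have h3 : ∑ d ∈ D with d ∣ m, (d : ℝ) ≤ R * (1 + Real.log R) := by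
      have hmR : (m : ℝ) ≤ R := (Nat.le_floor_iff' hm1.ne').1 hm2
      have h4 : ∑ d ∈ D with d ∣ m, (d : ℝ) ≤ ∑ d ∈ m.divisors, (d : ℝ) := by
        refine Finset.sum_le_sum_of_subset_of_nonneg ?_ (fun d _ _ => Nat.cast_nonneg d)
        intro d hd
        exact Nat.mem_divisors.2 ⟨(mem_filter.1 hd).2, hm1.ne'⟩
      have h5 : ∑ d ∈ m.divisors, (d : ℝ) = ∑ d ∈ m.divisors, (m : ℝ) * (d : ℝ)⁻¹ := by
        rw [← Nat.sum_div_divisors m (fun d => (d : ℝ))]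
        refine Finset.sum_congr rfl fun d hd => ?_
        have hdm := Nat.dvd_of_mem_divisors hd
        have hd0 : (d : ℝ) ≠ 0 := by
          have := Nat.pos_of_mem_divisors hd
          positivity
        rw [Nat.cast_div hdm hd0, div_eq_mul_inv]
      have h6 : ∑ d ∈ m.divisors, (d : ℝ)⁻¹ ≤ ∑ d ∈ Ioc 0 ⌊R⌋₊, (d : ℝ)⁻¹ := by
        refine Finset.sum_le_sum_of_subset_of_nonneg ?_ (fun d _ _ => by positivity)
        intro d hd
        exact mem_Ioc.2 ⟨Nat.pos_of_mem_divisors hd, (Nat.divisor_le hd).trans hm2⟩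
      have h7 := (abs_le.1 (sum_inv_bounds hR)).2
      rw [← Finset.mul_sum] at h5
      calc _ ≤ (m : ℝ) * ∑ d ∈ m.divisors, (d : ℝ)⁻¹ := h4.trans h5.le
        _ ≤ _ := by
          gcongr
          linarith
    calc _ ≤ R * (1 + Real.log R) * (M * sieveDensity k A m) :=
          mul_le_mul_of_nonneg_right h3 (mul_nonneg hM0 (hg m))
      _ = _ := by ring
  refine (Finset.sum_le_sum h2).trans ?_
  rw [← Finset.mul_sum]
  refine mul_le_mul_of_nonneg_left ?_ ?_
  · exact Finset.sum_le_sum_of_subset_of_nonneg (Finset.filter_subset _ _) fun m _ _ => hg m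
  · have := Real.log_nonneg hR
    positivity

/-! ### The sum over r for a fixed prime -/

/-- Partial summation against `sieveDensity` in the variable `log r / log R`. -/
theorem abs_sum_sieveDensity_mul_sub_le {k A : ℕ} (hk : 1 ≤ k) {S K : ℝ} (hK0 : 0 ≤ K)
    (hK : ∀ x : ℝ, 1 ≤ x → |∑ r ∈ Ioc 0 ⌊x⌋₊, sieveDensity k A r -
      S⁻¹ * (Real.log x ^ k / (k.factorial : ℝ))| ≤ K * (1 + Real.log x) ^ (k - 1))
    {L : ℝ} (hL : 1 ≤ L) {u v c : ℝ} (hu : 0 ≤ u) (huv : u ≤ v) (hv : v ≤ 1) (s : Finset ℕ)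
    (hx : ∀ r ∈ s, Real.log r / L ∈ Set.Icc u v)
    (hs : ∀ t ∈ Set.Icc u v, ∑ r ∈ s.filter (fun r : ℕ => Real.log r / L ≤ t), sieveDensity k A r =
      ∑ r ∈ Ioc 0 ⌊Real.exp (t * L)⌋₊, sieveDensity k A r - c)
    (hc : |c - S⁻¹ * ((u * L) ^ k / (k.factorial : ℝ))| ≤ K * (2 * L) ^ (k - 1))
    {F F' : ℝ → ℝ} (hF : ContinuousOn F (Set.Icc u v)) (hF' : ContinuousOn F' (Set.Icc u v))
    (hd : ∀ t ∈ Set.Ioo u v, HasDerivAt F (F' t) t) {B₀ B₁ : ℝ} (hB₀ : |F v| ≤ B₀)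
    (hB₁ : ∀ t ∈ Set.Icc u v, |F' t| ≤ B₁) :
    |∑ r ∈ s, sieveDensity k A r * F (Real.log r / L) -
      S⁻¹ * L ^ k / ((k - 1).factorial : ℝ) * ∫ x in u..v, F x * x ^ (k - 1)| ≤
      2 * K * (2 * L) ^ (k - 1) * (B₀ + B₁) := by
  obtain ⟨j, rfl⟩ : ∃ j, k = j + 1 := ⟨k - 1, by omega⟩
  simp only [Nat.add_sub_cancel] at *
  have hL0 : 0 ≤ L := by linarith
  have hfac : ((j + 1).factorial : ℝ) = (j + 1) * (j.factorial : ℝ) := by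
    rw [Nat.factorial_succ]; push_cast; ring
  have hfj : (j.factorial : ℝ) ≠ 0 := by exact_mod_cast j.factorial_ne_zero
  have hj1 : (j : ℝ) + 1 ≠ 0 := by positivity
  -- The mass in (u, t] is a difference of two cumulative sums, at t and at u (the latter being c),
  -- which explains the factor 2 in E. The base 2L comes from 1 + tL ≤ 2L.
  have h := abs_sum_mul_sub_integral_le s (sieveDensity (j + 1) A) (fun r => Real.log r / L)
    (u := u) (v := v) (E := 2 * K * (2 * L) ^ j) huv hx
    (fun x => S⁻¹ * L ^ (j + 1) / (j.factorial : ℝ) * x ^ j) F F' (by fun_prop) hF hF' hd ?_ hB₀ hB₁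
  · have e : ∫ t in u..v, F t * (S⁻¹ * L ^ (j + 1) / (j.factorial : ℝ) * t ^ j) =
        S⁻¹ * L ^ (j + 1) / (j.factorial : ℝ) * ∫ t in u..v, F t * t ^ j := by
      rw [← intervalIntegral.integral_const_mul]
      congr 1; funext t; ring
    rw [e] at h
    refine h.trans ?_
    have hB1 : 0 ≤ B₁ := (abs_nonneg _).trans (hB₁ u ⟨le_rfl, huv⟩)
    have : (v - u) * B₁ ≤ B₁ := mul_le_of_le_one_left hB1 (by linarith)
    gcongr
  · intro t ht
    have ht0 : 0 ≤ t := hu.trans ht.1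
    have htL : 0 ≤ t * L := by positivity
    rw [hs t ht, intervalIntegral.integral_const_mul, integral_pow]
    have h1 := hK (Real.exp (t * L)) (Real.one_le_exp htL)
    rw [Real.log_exp] at h1
    have h2 : (1 + t * L) ^ j ≤ (2 * L) ^ j := by
      gcongr
      have : t * L ≤ 1 * L := by gcongr; exact ht.2.trans hv
      linarith
    have h3 : K * (1 + t * L) ^ j ≤ K * (2 * L) ^ j := by gcongr
    have e : ∑ r ∈ Ioc 0 ⌊Real.exp (t * L)⌋₊, sieveDensity (j + 1) A r - c -
        S⁻¹ * L ^ (j + 1) / (j.factorial : ℝ) * ((t ^ (j + 1) - u ^ (j + 1)) / (j + 1)) =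
        (∑ r ∈ Ioc 0 ⌊Real.exp (t * L)⌋₊, sieveDensity (j + 1) A r -
          S⁻¹ * ((t * L) ^ (j + 1) / ((j + 1).factorial : ℝ))) -
        (c - S⁻¹ * ((u * L) ^ (j + 1) / ((j + 1).factorial : ℝ))) := by
      rw [hfac, mul_pow, mul_pow]
      field_simp
      ring
    rw [e]
    refine (abs_sub _ _).trans ((add_le_add (h1.trans h3) hc).trans (le_of_eq (by ring)))

/-- Sums of `sieveDensity` over short logarithmic intervals. -/
theorem sum_sieveDensity_interval_le {k A : ℕ} (hk : 1 ≤ k) (hg : ∀ r, 0 ≤ sieveDensity k A r)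
    {S K : ℝ} (hK0 : 0 ≤ K)
    (hK : ∀ x : ℝ, 1 ≤ x → |∑ r ∈ Ioc 0 ⌊x⌋₊, sieveDensity k A r -
      S⁻¹ * (Real.log x ^ k / (k.factorial : ℝ))| ≤ K * (1 + Real.log x) ^ (k - 1))
    {L : ℝ} (hL : 1 ≤ L) {w v : ℝ} (hwv : w ≤ v) (hv0 : 0 ≤ v) (hv : v ≤ 1) :
    ∑ r ∈ (Ioc 0 ⌊Real.exp (v * L)⌋₊).filter (fun r : ℕ => w < Real.log r / L), sieveDensity k A r ≤
      |S⁻¹| * (k * (v - w) * L ^ k) + 2 * K * (2 * L) ^ (k - 1) := by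
  have hL0 : 0 < L := by linarith
  have hfac : (1 : ℝ) ≤ (k.factorial : ℝ) := by exact_mod_cast Nat.factorial_pos k
  have hG : ∀ t : ℝ, 0 ≤ t → t ≤ 1 → |∑ r ∈ Ioc 0 ⌊Real.exp (t * L)⌋₊, sieveDensity k A r -
      S⁻¹ * ((t * L) ^ k / (k.factorial : ℝ))| ≤ K * (2 * L) ^ (k - 1) := by
    intro t ht ht1
    have h1 := hK (Real.exp (t * L)) (Real.one_le_exp (by positivity))
    rw [Real.log_exp] at h1
    refine h1.trans ?_
    gcongr
    have : t * L ≤ 1 * L := by gcongr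
    linarith
  have hmono : ∀ t : ℝ, 0 ≤ t → t ≤ v → S⁻¹ * ((v * L) ^ k / (k.factorial : ℝ)) -
      S⁻¹ * ((t * L) ^ k / (k.factorial : ℝ)) ≤ |S⁻¹| * (k * (v - t) * L ^ k) := by
    intro t ht htv
    rw [← mul_sub, ← sub_div]
    refine (le_abs_self _).trans ?_
    rw [abs_mul]
    refine mul_le_mul_of_nonneg_left ?_ (abs_nonneg _)
    rw [abs_div, abs_of_pos (by linarith : (0 : ℝ) < k.factorial)]
    refine (div_le_self (abs_nonneg _) hfac).trans ?_
    rw [mul_pow, mul_pow, ← sub_mul, abs_mul, abs_of_nonneg (by positivity : 0 ≤ L ^ k)]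
    refine mul_le_mul_of_nonneg_right ?_ (by positivity)
    refine (abs_pow_sub_pow_le v t k).trans ?_
    rw [abs_of_nonneg (by linarith), abs_of_nonneg hv0, abs_of_nonneg ht, max_eq_left htv]
    have : v ^ (k - 1) ≤ 1 := pow_le_one₀ hv0 hv
    have h2 : 0 ≤ (v - t) * k := mul_nonneg (by linarith) (Nat.cast_nonneg k)
    nlinarith
  -- A negative w is allowed and imposes no condition, as log r ≥ 0; the interval then effectively
  -- starts at 0.
  rcases le_or_gt 0 w with hw | hw
  · have hsplit := Finset.sum_filter_add_sum_filter_not (Ioc 0 ⌊Real.exp (v * L)⌋₊)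
      (fun r : ℕ => w < Real.log r / L) (fun r => sieveDensity k A r)
    have hset : (Ioc 0 ⌊Real.exp (v * L)⌋₊).filter (fun r : ℕ => ¬ w < Real.log r / L) =
        Ioc 0 ⌊Real.exp (w * L)⌋₊ := by
      have := filter_log_le (x := Real.exp (v * L)) (t := w * L) (Real.one_le_exp (by positivity))
        (by rw [Real.log_exp]; gcongr)
      rw [← this]
      refine Finset.filter_congr fun r _ => ?_
      rw [not_lt, div_le_iff₀ hL0]
    rw [hset] at hsplit
    have h1 := (abs_le.1 (hG v hv0 hv)).2
    have h2 := (abs_le.1 (hG w hw (hwv.trans hv))).1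
    have h3 := hmono w hw hwv
    linarith
  · have h1 := (abs_le.1 (hG v hv0 hv)).2
    have h3 := hmono 0 le_rfl hv0
    have h4 : ∑ r ∈ (Ioc 0 ⌊Real.exp (v * L)⌋₊).filter (fun r : ℕ => w < Real.log r / L), sieveDensity k A r ≤
        ∑ r ∈ Ioc 0 ⌊Real.exp (v * L)⌋₊, sieveDensity k A r :=
      Finset.sum_le_sum_of_subset_of_nonneg (Finset.filter_subset _ _) fun r _ _ => hg r
    have h5 : |S⁻¹| * (k * (v - 0) * L ^ k) ≤ |S⁻¹| * (k * (v - w) * L ^ k) := by gcongr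
    have h6 : 0 ≤ K * (2 * L) ^ (k - 1) := by positivity
    have h7 : S⁻¹ * ((0 * L) ^ k / (k.factorial : ℝ)) = 0 := by
      rw [zero_mul, zero_pow (by omega)]; simp
    linarith

theorem polynomial_bound (P : Polynomial ℝ) : ∃ B : ℝ, 1 ≤ B ∧ (∀ x ∈ Set.Icc (0 : ℝ) 1,
    |P.eval x| ≤ B ∧ |P.derivative.eval x| ≤ B) ∧
    ∀ x ∈ Set.Icc (0 : ℝ) 1, ∀ z ∈ Set.Icc (0 : ℝ) 1, |P.eval x - P.eval z| ≤ B * |x - z| := by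
  obtain ⟨B₁, hB₁⟩ := (isCompact_Icc (a := (0 : ℝ)) (b := 1)).exists_bound_of_continuousOn
    (f := fun x => P.eval x) P.continuous.continuousOn
  obtain ⟨B₂, hB₂⟩ := (isCompact_Icc (a := (0 : ℝ)) (b := 1)).exists_bound_of_continuousOn
    (f := fun x => P.derivative.eval x) P.derivative.continuous.continuousOn
  refine ⟨max 1 (max B₁ B₂), le_max_left _ _, fun x hx => ⟨?_, ?_⟩, fun x hx z hz => ?_⟩
  · exact (hB₁ x hx).trans ((le_max_left _ _).trans (le_max_right _ _))
  · exact (hB₂ x hx).trans ((le_max_right _ _).trans (le_max_right _ _))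
  · exact (convex_Icc (0 : ℝ) 1).norm_image_sub_le_of_norm_hasDerivWithin_le
      (fun t _ => (P.hasDerivAt t).hasDerivWithinAt)
      (fun t ht => (hB₂ t ht).trans ((le_max_right _ _).trans (le_max_right _ _))) hz hx

/-- The weight attached to a prime `p = R ^ y` with `y ≤ 1`. -/
noncomputable def innerIntegral (k : ℕ) (P : Polynomial ℝ) (y : ℝ) : ℝ :=
  (∫ x in (0 : ℝ)..(1 - y), (P.eval (1 - x) - P.eval (1 - x - y)) ^ 2 * x ^ (k - 1)) +
    ∫ x in (1 - y)..(1 : ℝ), (P.eval (1 - x)) ^ 2 * x ^ (k - 1)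

theorem y_eq_of_mem {k A r : ℕ} {P : Polynomial ℝ} {R : ℝ} (hR : 1 < R) (h : r ∈ sieveSupport A R) :
    y k A P R r = singularSeries k A * P.eval (1 - Real.log r / Real.log R) := by
  obtain ⟨⟨h1, h2⟩, h3, h4⟩ := mem_sieveSupport.1 h
  have hmu : ((moebius r : ℤ) : ℝ) ^ 2 = 1 := by
    exact_mod_cast moebius_sq_eq_one_of_squarefree h3
  have hr0 : (0 : ℝ) < r := by exact_mod_cast h1
  rw [y, if_pos ⟨(Nat.le_floor_iff' h1.ne').1 h2, h4⟩, hmu, one_mul,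
    Real.log_div (by linarith) hr0.ne', sub_div, div_self (Real.log_pos hR).ne']

theorem hasDerivAt_eval_sub (P : Polynomial ℝ) (c t : ℝ) :
    HasDerivAt (fun x => P.eval (c - x)) (-P.derivative.eval (c - t)) t := by
  have := (P.hasDerivAt (c - t)).comp t ((hasDerivAt_id t).const_sub c)
  simpa [Function.comp_def] using this

/-- For p > R no r ≤ R is divisible by p and y_{rp} = 0, so a single partial summation over [0, 1]
suffices. One of the two factors 𝔖 in y_r² cancels against the 1/𝔖 of the density. -/
theorem sum_density_of_large_prime {k A : ℕ} (hk : 1 ≤ k)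
    {K : ℝ} (hS : singularSeries k A ≠ 0) (hK0 : 0 ≤ K)
    (hK : ∀ x : ℝ, 1 ≤ x → |∑ r ∈ Ioc 0 ⌊x⌋₊, sieveDensity k A r -
      (singularSeries k A)⁻¹ * (Real.log x ^ k / (k.factorial : ℝ))| ≤ K * (1 + Real.log x) ^ (k - 1))
    (P : Polynomial ℝ) : ∃ K' : ℝ, 0 ≤ K' ∧ ∀ R : ℝ, 0 < R → 1 ≤ Real.log R → ∀ p : ℕ, R < p →
      |∑ r ∈ Ioc 0 ⌊R⌋₊ with ¬ p ∣ r, sieveDensity k A r * (y k A P R r - y k A P R (r * p)) ^ 2 -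
        singularSeries k A * Real.log R ^ k / ((k - 1).factorial : ℝ) *
          ∫ x in (0 : ℝ)..1, (P.eval (1 - x)) ^ 2 * x ^ (k - 1)| ≤ K' * Real.log R ^ (k - 1) := by
  obtain ⟨B, hB1, hB, -⟩ := polynomial_bound P
  set S := singularSeries k A with hSdef
  refine ⟨S ^ 2 * (2 * K * 2 ^ (k - 1) * (B ^ 2 + 2 * B ^ 2)), by positivity, fun R hR0 hL p hp => ?_⟩
  set L := Real.log R with hLdef
  have hLpos : 0 < L := by linarith
  have hR : 1 < R := (Real.log_pos_iff hR0.le).1 hLpos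
  have hexp : Real.exp (1 * L) = R := by rw [one_mul, hLdef, Real.exp_log hR0]
  have hfil : (Ioc 0 ⌊R⌋₊).filter (fun r => ¬ p ∣ r) = Ioc 0 ⌊R⌋₊ := by
    refine Finset.filter_true_of_mem fun r hr hpr => ?_
    obtain ⟨h1, h2⟩ := mem_Ioc.1 hr
    have h3 : (p : ℝ) ≤ r := by exact_mod_cast Nat.le_of_dvd h1 hpr
    have h4 : (r : ℝ) ≤ R := (Nat.le_floor_iff' h1.ne').1 h2
    linarith
  rw [hfil]
  have hterm : ∀ r ∈ Ioc 0 ⌊R⌋₊, sieveDensity k A r * (y k A P R r - y k A P R (r * p)) ^ 2 =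
      S ^ 2 * (sieveDensity k A r * (P.eval (1 - Real.log r / L)) ^ 2) := by
    intro r hr
    by_cases hmem : r ∈ sieveSupport A R
    · have h0 : y k A P R (r * p) = 0 := by
        refine y_eq_zero fun h => ?_
        obtain ⟨⟨h1, h2⟩, _⟩ := mem_sieveSupport.1 h
        have h3 : ((r * p : ℕ) : ℝ) ≤ R := (Nat.le_floor_iff' h1.ne').1 h2
        have h4 : (p : ℝ) ≤ ((r * p : ℕ) : ℝ) := by
          exact_mod_cast Nat.le_mul_of_pos_left p (mem_Ioc.1 hr).1
        linarith
      rw [h0, y_eq_of_mem hR hmem]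
      ring
    · have : sieveDensity k A r = 0 := by
        rw [sieveDensity_apply, if_neg]
        intro h; exact hmem (mem_filter.2 ⟨hr, h⟩)
      rw [this]; ring
  rw [Finset.sum_congr rfl hterm, ← Finset.mul_sum]
  have hmain := abs_sum_sieveDensity_mul_sub_le hk hK0 hK hL (u := 0) (v := 1) (c := 0) le_rfl
    zero_le_one le_rfl (Ioc 0 ⌊R⌋₊)
    (fun r hr => by
      obtain ⟨h1, h2⟩ := log_mem_Icc hr
      exact ⟨div_nonneg h1 hLpos.le, (div_le_one hLpos).2 h2⟩)
    (fun t ht => by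
      rw [sub_zero, ← filter_log_le hR.le (t := t * L) (by
        have : t * L ≤ 1 * L := by gcongr; exact ht.2
        linarith)]
      exact Finset.sum_congr (Finset.filter_congr fun r _ => by rw [div_le_iff₀ hLpos])
        fun _ _ => rfl)
    (by rw [zero_mul, zero_pow (by omega)]; simp; positivity)
    (F := fun x => (P.eval (1 - x)) ^ 2)
    (F' := fun x => 2 * P.eval (1 - x) * (-P.derivative.eval (1 - x)))
    (by fun_prop) (by fun_prop)
    (fun t _ => by simpa using (hasDerivAt_eval_sub P 1 t).fun_pow 2)
    (B₀ := B ^ 2) (B₁ := 2 * B ^ 2)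
    (by
      have := (hB 0 (by simp)).1
      simp only [sub_self]
      rw [abs_pow]
      gcongr)
    (fun t ht => by
      have := hB (1 - t) ⟨by linarith [ht.2], by linarith [ht.1]⟩
      rw [abs_mul, abs_mul, abs_neg, abs_two]
      calc 2 * |P.eval (1 - t)| * |P.derivative.eval (1 - t)| ≤ 2 * B * B := by
            gcongr
            · exact this.1
            · exact this.2
        _ = _ := by ring)
  have e : S ^ 2 * ∑ r ∈ Ioc 0 ⌊R⌋₊, sieveDensity k A r * (P.eval (1 - Real.log r / L)) ^ 2 -
      S * L ^ k / ((k - 1).factorial : ℝ) * ∫ x in (0 : ℝ)..1, (P.eval (1 - x)) ^ 2 * x ^ (k - 1) =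
      S ^ 2 * (∑ r ∈ Ioc 0 ⌊R⌋₊, sieveDensity k A r * (P.eval (1 - Real.log r / L)) ^ 2 -
      S⁻¹ * L ^ k / ((k - 1).factorial : ℝ) *
        ∫ x in (0 : ℝ)..1, (P.eval (1 - x)) ^ 2 * x ^ (k - 1)) := by
    field_simp
  rw [e, abs_mul, abs_of_nonneg (by positivity : 0 ≤ S ^ 2)]
  refine (mul_le_mul_of_nonneg_left hmain (by positivity)).trans (le_of_eq ?_)
  rw [mul_pow]; ring

/-- The squared difference `(y_r - y_{rp})² / S²` as a function of `x = log r / log R`, where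
`z = log p / log R`. -/
noncomputable def weightProfile (P : Polynomial ℝ) (z x : ℝ) : ℝ :=
  if x ≤ 1 - z then (P.eval (1 - x) - P.eval (1 - x - z)) ^ 2 else (P.eval (1 - x)) ^ 2

theorem weightProfile_nonneg (P : Polynomial ℝ) (z x : ℝ) : 0 ≤ weightProfile P z x := by
  rw [weightProfile]; split_ifs <;> positivity

/-- This is the cost of dropping the condition p ∤ r. With r = p r', the density gains a factor
O(1/p). Below the cut the squared difference is O(z²), hence O(z), by the Lipschitz bound; above it
log r' / L runs through an interval of length z. As z = log p / L, both ranges give O((log p / p)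
L^(k-1)), besides lower-order errors. The trivial bound L^k / p would, after summation over p, be as
large as the main term. -/
theorem sum_multiples_le {k A : ℕ} (hk : 1 ≤ k) (hkA : ∀ p : ℕ, p.Prime → ¬ p ∣ A → k < p)
    {S K : ℝ} (hK0 : 0 ≤ K)
    (hK : ∀ x : ℝ, 1 ≤ x → |∑ r ∈ Ioc 0 ⌊x⌋₊, sieveDensity k A r -
      S⁻¹ * (Real.log x ^ k / (k.factorial : ℝ))| ≤ K * (1 + Real.log x) ^ (k - 1))
    {P : Polynomial ℝ} {B : ℝ}
    (hB : ∀ x ∈ Set.Icc (0 : ℝ) 1, |P.eval x| ≤ B)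
    (hLip : ∀ x ∈ Set.Icc (0 : ℝ) 1, ∀ z ∈ Set.Icc (0 : ℝ) 1, |P.eval x - P.eval z| ≤ B * |x - z|)
    {R : ℝ} (hR0 : 0 < R) (hL : 1 ≤ Real.log R) {p : ℕ} (hp : p.Prime) (hpR : (p : ℝ) ≤ R) :
    ∑ r ∈ Ioc 0 ⌊R⌋₊ with p ∣ r,
      sieveDensity k A r * weightProfile P (Real.log p / Real.log R) (Real.log r / Real.log R) ≤
      B ^ 2 * (k * (k + 1)) * (3 * k * |S⁻¹| + 4 * K * 2 ^ (k - 1)) * Real.log R ^ (k - 1) := by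
  have hg := fun m => sieveDensity_nonneg hk hkA m
  set L := Real.log R with hLdef
  have hLpos : 0 < L := by linarith
  have hp0 : (0 : ℝ) < p := by exact_mod_cast hp.pos
  have hp1 : (1 : ℝ) ≤ p := by exact_mod_cast hp.one_lt.le
  have hlogp : 0 ≤ Real.log p := Real.log_nonneg hp1
  set z := Real.log p / L with hz
  have hz0 : 0 ≤ z := div_nonneg hlogp hLpos.le
  have hz1 : z ≤ 1 := (div_le_one hLpos).2 (Real.log_le_log hp0 hpR)
  have hzL : z * L = Real.log p := div_mul_cancel₀ _ hLpos.ne'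
  have hexp : Real.exp ((1 - z) * L) = R / p := by
    rw [sub_mul, one_mul, hzL, Real.exp_sub, hLdef, Real.exp_log hR0, Real.exp_log hp0]
  have hreidx : ∑ r ∈ Ioc 0 ⌊R⌋₊ with p ∣ r, sieveDensity k A r * weightProfile P z (Real.log r / L) =
      ∑ r ∈ Ioc 0 ⌊Real.exp ((1 - z) * L)⌋₊,
        sieveDensity k A (p * r) * weightProfile P z (Real.log (p * r : ℕ) / L) := by
    symm
    refine Finset.sum_nbij (fun r => p * r) ?_ ?_ ?_ (fun _ _ => rfl)
    · intro r hr
      obtain ⟨h1, h2⟩ := mem_Ioc.1 hr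
      have h3 : (r : ℝ) ≤ R / p := hexp ▸ (Nat.le_floor_iff' h1.ne').1 h2
      rw [le_div_iff₀ hp0] at h3
      refine mem_filter.2 ⟨mem_Ioc.2 ⟨Nat.mul_pos hp.pos h1, Nat.le_floor ?_⟩, dvd_mul_right p r⟩
      push_cast; linarith
    · intro r _ r' _ h
      exact Nat.eq_of_mul_eq_mul_left hp.pos h
    · intro r hr
      obtain ⟨h1, c, rfl⟩ := mem_filter.1 (Finset.mem_coe.1 hr)
      obtain ⟨h2, h3⟩ := mem_Ioc.1 h1
      have hc : 0 < c := Nat.pos_of_mul_pos_left h2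
      have h4 : ((p * c : ℕ) : ℝ) ≤ R := (Nat.le_floor_iff' h2.ne').1 h3
      refine ⟨c, Finset.mem_coe.2 (mem_Ioc.2 ⟨hc, Nat.le_floor ?_⟩), rfl⟩
      rw [hexp, le_div_iff₀ hp0]
      push_cast at h4; linarith
  have hgp : ∀ r : ℕ, sieveDensity k A (p * r) ≤ sieveDensity k A p * sieveDensity k A r := by
    intro r
    by_cases h : p ∣ r
    · rw [sieveDensity_apply, if_neg]
      · exact mul_nonneg (hg _) (hg _)
      · rintro ⟨h1, _⟩
        exact hp.coprime_iff_not_dvd.1 (Nat.coprime_of_squarefree_mul h1) h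
    · rw [(isMultiplicative_sieveDensity k A).map_mul_of_coprime (hp.coprime_iff_not_dvd.2 h)]
  have hterm : ∀ r ∈ Ioc 0 ⌊Real.exp ((1 - z) * L)⌋₊,
      sieveDensity k A (p * r) * weightProfile P z (Real.log (p * r : ℕ) / L) ≤
      sieveDensity k A p * B ^ 2 * (z * sieveDensity k A r +
        if 1 - 2 * z < Real.log r / L then sieveDensity k A r else 0) := by
    intro r hr
    have hr1 := (mem_Ioc.1 hr).1
    have hr0 : (0 : ℝ) < r := by exact_mod_cast hr1
    obtain ⟨h1, h2⟩ := log_mem_Icc hr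
    rw [Real.log_exp] at h2
    have hx : Real.log (p * r : ℕ) / L = z + Real.log r / L := by
      push_cast
      rw [Real.log_mul hp0.ne' hr0.ne', add_div]
    have hx0 : 0 ≤ Real.log r / L := div_nonneg h1 hLpos.le
    have hx1 : Real.log r / L ≤ 1 - z := (div_le_iff₀ hLpos).2 h2
    rw [hx]
    set x := Real.log r / L with hxdef
    have hw : weightProfile P z (z + x) ≤ B ^ 2 * (z + if 1 - 2 * z < x then 1 else 0) := by
      rw [weightProfile]
      split_ifs with h3 h4 h4
      · linarith
      · have := hLip (1 - (z + x)) ⟨by linarith, by linarith⟩ (1 - (z + x) - z)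
          ⟨by linarith, by linarith⟩
        rw [sub_sub_cancel, abs_of_nonneg hz0] at this
        calc _ ≤ (B * z) ^ 2 := by
              rw [← sq_abs]
              gcongr
          _ = B ^ 2 * (z * z) := by ring
          _ ≤ B ^ 2 * (z + 0) := by
              gcongr
              nlinarith
      · have := hB (1 - (z + x)) ⟨by linarith, by linarith⟩
        calc _ ≤ B ^ 2 * 1 := by
              rw [← sq_abs, mul_one]
              gcongr
          _ ≤ _ := by
              gcongr
              linarith
      · exact absurd (by linarith : 1 - 2 * z < x) h4
    calc _ ≤ (sieveDensity k A p * sieveDensity k A r) *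
          (B ^ 2 * (z + if 1 - 2 * z < x then 1 else 0)) :=
          mul_le_mul (hgp r) hw (weightProfile_nonneg _ _ _) (mul_nonneg (hg _) (hg _))
      _ = _ := by split_ifs <;> ring
  rw [hreidx]
  refine (Finset.sum_le_sum hterm).trans ?_
  rw [← Finset.mul_sum, Finset.sum_add_distrib, ← Finset.mul_sum, ← Finset.sum_filter]
  have h1 := sum_sieveDensity_interval_le hk hg hK0 hK hL (w := 1 - 2 * z) (v := 1 - z)
    (by linarith) (by linarith) (by linarith)
  -- The choice w = -1 bounds the complete sum with v - w ≤ 2; together with the short interval of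
  -- length z this gives the coefficient 3 = 2 + 1 in the statement.
  have h2 := sum_sieveDensity_interval_le hk hg hK0 hK hL (w := -1) (v := 1 - z)
    (by linarith) (by linarith) (by linarith)
  rw [Finset.filter_true_of_mem (fun r hr => by
    have : 0 ≤ Real.log r / L := div_nonneg (Real.log_natCast_nonneg r) hLpos.le
    linarith)] at h2
  have hLk : L ^ k = L * L ^ (k - 1) := by
    rw [← pow_succ']; congr 1; omega
  set X := L ^ (k - 1) with hX
  have hX0 : 0 ≤ X := by positivity
  have hE : 2 * K * (2 * L) ^ (k - 1) = 2 * K * 2 ^ (k - 1) * X := by rw [mul_pow]; ring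
  set E := 2 * K * 2 ^ (k - 1) with hEdef
  have hE0 : 0 ≤ E := by positivity
  rw [hE, hLk] at h1 h2
  have ha : 0 ≤ |S⁻¹| := abs_nonneg _
  have hk0 : (0 : ℝ) ≤ k := Nat.cast_nonneg k
  have h3 : z * ∑ r ∈ Ioc 0 ⌊Real.exp ((1 - z) * L)⌋₊, sieveDensity k A r ≤
      2 * k * |S⁻¹| * Real.log p * X + E * X := by
    calc _ ≤ z * (|S⁻¹| * (k * (1 - z - -1) * (L * X)) + E * X) := by gcongr
      _ ≤ z * (|S⁻¹| * (k * 2 * (L * X))) + E * X := by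
          rw [mul_add]
          have h4 : z * (E * X) ≤ E * X := mul_le_of_le_one_left (by positivity) hz1
          have h5 : (1 - z - -1) ≤ 2 := by linarith
          have h6 : z * (|S⁻¹| * (k * (1 - z - -1) * (L * X))) ≤ z * (|S⁻¹| * (k * 2 * (L * X))) := by
            gcongr
          linarith
      _ = 2 * k * |S⁻¹| * (z * L) * X + E * X := by ring
      _ = _ := by rw [hzL]
  have h4 : |S⁻¹| * (k * (1 - z - (1 - 2 * z)) * (L * X)) = k * |S⁻¹| * Real.log p * X := by
    rw [← hzL]; ring
  rw [h4] at h1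
  have h5 := (sieveDensity_prime_bounds hkA hp)
  have h6 : sieveDensity k A p * (3 * k * |S⁻¹| * Real.log p + 2 * E) ≤
      k * (k + 1) * (3 * k * |S⁻¹| + 2 * E) := by
    have h7 : Real.log p ≤ p := (Real.log_le_sub_one_of_pos hp0).trans (by linarith)
    have h8 : 2 * E ≤ 2 * E * p := le_mul_of_one_le_right (by positivity) hp1
    have h9 : 3 * k * |S⁻¹| * Real.log p ≤ 3 * k * |S⁻¹| * p := by gcongr
    calc _ ≤ k * (k + 1) / p * (3 * k * |S⁻¹| * p + 2 * E * p) :=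
          mul_le_mul h5.2 (add_le_add h9 h8) (by positivity) (by positivity)
      _ = _ := by field_simp
  calc _ ≤ sieveDensity k A p * B ^ 2 * ((2 * k * |S⁻¹| * Real.log p * X + E * X) +
        (k * |S⁻¹| * Real.log p * X + E * X)) := by
        refine mul_le_mul_of_nonneg_left (add_le_add h3 h1) (mul_nonneg (hg _) (by positivity))
    _ = B ^ 2 * (sieveDensity k A p * (3 * k * |S⁻¹| * Real.log p + 2 * E)) * X := by ring
    _ ≤ B ^ 2 * (k * (k + 1) * (3 * k * |S⁻¹| + 2 * E)) * X := by gcongr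
    _ = _ := by rw [hEdef]; ring

/-- Restore the multiples of p by `sum_multiples_le`, then cut the range of x = log r / L at 1 - z.
Below the cut both y_r and y_{rp} are present, above it only y_r; partial summation on each side
yields the two integrals of `innerIntegral`. -/
theorem sum_density_of_small_prime {k A : ℕ} (hk : 1 ≤ k)
    (hkA : ∀ p : ℕ, p.Prime → ¬ p ∣ A → k < p)
    {K : ℝ} (hS : singularSeries k A ≠ 0) (hK0 : 0 ≤ K)
    (hK : ∀ x : ℝ, 1 ≤ x → |∑ r ∈ Ioc 0 ⌊x⌋₊, sieveDensity k A r -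
      (singularSeries k A)⁻¹ * (Real.log x ^ k / (k.factorial : ℝ))| ≤ K * (1 + Real.log x) ^ (k - 1))
    (P : Polynomial ℝ) : ∃ K' : ℝ, 0 ≤ K' ∧ ∀ R : ℝ, 0 < R → 1 ≤ Real.log R → ∀ p : ℕ, p.Prime →
      ¬ p ∣ A → (p : ℝ) ≤ R →
      |∑ r ∈ Ioc 0 ⌊R⌋₊ with ¬ p ∣ r, sieveDensity k A r * (y k A P R r - y k A P R (r * p)) ^ 2 -
        singularSeries k A * Real.log R ^ k / ((k - 1).factorial : ℝ) *
          innerIntegral k P (Real.log p / Real.log R)| ≤ K' * Real.log R ^ (k - 1) := by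
  obtain ⟨B, hB1, hB, hLip⟩ := polynomial_bound P
  set S := singularSeries k A with hSdef
  refine ⟨S ^ 2 * (2 * K * 2 ^ (k - 1) * (4 * B ^ 2 + 8 * B ^ 2) +
    2 * K * 2 ^ (k - 1) * (B ^ 2 + 2 * B ^ 2) +
    B ^ 2 * (k * (k + 1)) * (3 * k * |S⁻¹| + 4 * K * 2 ^ (k - 1))), by positivity,
    fun R hR0 hL p hp hpA hpR => ?_⟩
  have hmult := sum_multiples_le hk hkA hK0 hK (fun x hx => (hB x hx).1) hLip hR0 hL hp hpR
  set L := Real.log R with hLdef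
  have hLpos : 0 < L := by linarith
  have hR : 1 < R := (Real.log_pos_iff hR0.le).1 hLpos
  have hp0 : (0 : ℝ) < p := by exact_mod_cast hp.pos
  have hp1 : (1 : ℝ) ≤ p := by exact_mod_cast hp.one_lt.le
  set z := Real.log p / L with hz
  have hz0 : 0 ≤ z := div_nonneg (Real.log_nonneg hp1) hLpos.le
  have hz1 : z ≤ 1 := (div_le_one hLpos).2 (Real.log_le_log hp0 hpR)
  have hzL : z * L = Real.log p := div_mul_cancel₀ _ hLpos.ne'
  have hterm : ∀ r ∈ (Ioc 0 ⌊R⌋₊).filter (fun r => ¬ p ∣ r),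
      sieveDensity k A r * (y k A P R r - y k A P R (r * p)) ^ 2 =
      S ^ 2 * (sieveDensity k A r * weightProfile P z (Real.log r / L)) := by
    intro r hr
    obtain ⟨hr1, hr2⟩ := mem_filter.1 hr
    by_cases hmem : r ∈ sieveSupport A R
    · obtain ⟨⟨h1, h2⟩, h3, h4⟩ := mem_sieveSupport.1 hmem
      have hr0 : (0 : ℝ) < r := by exact_mod_cast h1
      -- Squarefreeness and coprimality of rp are automatic because p ∤ r and p ∤ A, so only the
      -- size condition remains.
      have hiff : Real.log r / L ≤ 1 - z ↔ r * p ∈ sieveSupport A R := by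
        have hcop : r.Coprime p := (hp.coprime_iff_not_dvd.2 hr2).symm
        have e1 : Real.log r / L ≤ 1 - z ↔ ((r * p : ℕ) : ℝ) ≤ R := by
          rw [div_le_iff₀ hLpos, sub_mul, hzL, one_mul, hLdef, le_sub_iff_add_le,
            ← Real.log_mul hr0.ne' hp0.ne', Real.log_le_log_iff (by positivity) hR0]
          push_cast; rfl
        rw [e1, mem_sieveSupport, Nat.squarefree_mul hcop]
        constructor
        · intro h
          exact ⟨⟨Nat.mul_pos h1 hp.pos, Nat.le_floor h⟩, ⟨h3, hp.prime.squarefree⟩,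
            h4.mul_left (hp.coprime_iff_not_dvd.2 hpA)⟩
        · rintro ⟨⟨h5, h6⟩, _⟩
          exact (Nat.le_floor_iff' h5.ne').1 h6
      rw [y_eq_of_mem hR hmem, weightProfile]
      by_cases hx : Real.log r / L ≤ 1 - z
      · rw [if_pos hx, y_eq_of_mem hR (hiff.1 hx)]
        push_cast
        rw [Real.log_mul hr0.ne' hp0.ne', add_div, ← sub_sub]
        ring
      · rw [if_neg hx, y_eq_zero (fun h => hx (hiff.2 h))]
        ring
    · have : sieveDensity k A r = 0 := by
        rw [sieveDensity_apply, if_neg]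
        intro h; exact hmem (mem_filter.2 ⟨hr1, h⟩)
      rw [this]; ring
  rw [Finset.sum_congr rfl hterm, ← Finset.mul_sum]
  have hsplit := Finset.sum_filter_add_sum_filter_not (Ioc 0 ⌊R⌋₊) (fun r => p ∣ r)
    (fun r => sieveDensity k A r * weightProfile P z (Real.log r / L))
  have hsplit2 := Finset.sum_filter_add_sum_filter_not (Ioc 0 ⌊R⌋₊)
    (fun r : ℕ => Real.log r / L ≤ 1 - z)
    (fun r => sieveDensity k A r * weightProfile P z (Real.log r / L))
  have hxIcc : ∀ r ∈ Ioc 0 ⌊R⌋₊, 0 ≤ Real.log r / L ∧ Real.log r / L ≤ 1 := by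
    intro r hr
    obtain ⟨h1, h2⟩ := log_mem_Icc hr
    exact ⟨div_nonneg h1 hLpos.le, (div_le_one hLpos).2 h2⟩
  have hcount : ∀ t : ℝ, t ≤ 1 → (Ioc 0 ⌊R⌋₊).filter (fun r : ℕ => Real.log r / L ≤ t) =
      Ioc 0 ⌊Real.exp (t * L)⌋₊ := by
    intro t ht
    rw [← filter_log_le hR.le (t := t * L) (by
        have : t * L ≤ 1 * L := by gcongr
        linarith)]
    exact Finset.filter_congr fun r _ => by rw [div_le_iff₀ hLpos]
  have hlow := abs_sum_sieveDensity_mul_sub_le hk hK0 hK hL (u := 0) (v := 1 - z) (c := 0) le_rfl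
    (by linarith) (by linarith) ((Ioc 0 ⌊R⌋₊).filter (fun r : ℕ => Real.log r / L ≤ 1 - z))
    (fun r hr => ⟨(hxIcc r (mem_filter.1 hr).1).1, (mem_filter.1 hr).2⟩)
    (fun t ht => by
      rw [sub_zero, ← hcount t (by linarith [ht.2]), Finset.filter_filter]
      refine Finset.sum_congr (Finset.filter_congr fun r _ => ?_) fun _ _ => rfl
      exact ⟨fun h => h.2, fun h => ⟨h.trans ht.2, h⟩⟩)
    (by rw [zero_mul, zero_pow (by omega)]; simp; positivity)
    (F := fun x => (P.eval (1 - x) - P.eval (1 - x - z)) ^ 2)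
    (F' := fun x => 2 * (P.eval (1 - x) - P.eval (1 - x - z)) *
      (-P.derivative.eval (1 - x) - -P.derivative.eval (1 - z - x)))
    (by fun_prop) (by fun_prop)
    (fun t _ => by
      have h1 := hasDerivAt_eval_sub P 1 t
      have h2 := hasDerivAt_eval_sub P (1 - z) t
      have h3 := (h1.fun_sub h2).fun_pow 2
      simp only [sub_right_comm (1 : ℝ) z] at h3
      simpa [sub_right_comm (1 : ℝ) z] using h3)
    (B₀ := 4 * B ^ 2) (B₁ := 8 * B ^ 2)
    (by
      have h1 := (hB (1 - (1 - z)) ⟨by linarith, by linarith⟩).1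
      have h2 := (hB (1 - (1 - z) - z) ⟨by linarith, by linarith⟩).1
      rw [abs_pow]
      calc _ ≤ (B + B) ^ 2 := by
            gcongr
            exact (abs_sub _ _).trans (add_le_add h1 h2)
        _ = _ := by ring)
    (fun t ht => by
      have h1 := hB (1 - t) ⟨by linarith [ht.2], by linarith [ht.1]⟩
      have h2 := hB (1 - t - z) ⟨by linarith [ht.2], by linarith [ht.1]⟩
      have h3 := hB (1 - z - t) ⟨by linarith [ht.2], by linarith [ht.1]⟩
      rw [abs_mul, abs_mul, abs_two]
      calc _ ≤ 2 * (B + B) * (B + B) := by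
            gcongr
            · exact (abs_sub _ _).trans (add_le_add h1.1 h2.1)
            · refine (abs_sub _ _).trans ?_
              rw [abs_neg, abs_neg]
              exact add_le_add h1.2 h3.2
        _ = _ := by ring)
  have hhigh := abs_sum_sieveDensity_mul_sub_le hk hK0 hK hL (u := 1 - z) (v := 1)
    (c := ∑ r ∈ Ioc 0 ⌊Real.exp ((1 - z) * L)⌋₊, sieveDensity k A r) (by linarith)
    (by linarith) le_rfl ((Ioc 0 ⌊R⌋₊).filter (fun r : ℕ => ¬ Real.log r / L ≤ 1 - z))
    (fun r hr => ⟨(not_le.1 (mem_filter.1 hr).2).le, (hxIcc r (mem_filter.1 hr).1).2⟩)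
    (fun t ht => by
      rw [← hcount t ht.2, ← hcount (1 - z) (by linarith), eq_sub_iff_add_eq, add_comm,
        Finset.filter_filter, ← Finset.sum_filter_add_sum_filter_not
          ((Ioc 0 ⌊R⌋₊).filter (fun r : ℕ => Real.log r / L ≤ t)) (fun r : ℕ => Real.log r / L ≤ 1 - z),
        Finset.filter_filter, Finset.filter_filter]
      congr 1
      · refine Finset.sum_congr (Finset.filter_congr fun r _ => ?_) fun _ _ => rfl
        exact ⟨fun h => ⟨h.trans ht.1, h⟩, fun h => h.2⟩
      · refine Finset.sum_congr (Finset.filter_congr fun r _ => ?_) fun _ _ => rfl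
        exact and_comm)
    (by
      have h1 := hK (Real.exp ((1 - z) * L)) (Real.one_le_exp (mul_nonneg (by linarith) hLpos.le))
      rw [Real.log_exp] at h1
      refine h1.trans ?_
      have : (1 - z) * L ≤ L := mul_le_of_le_one_left hLpos.le (by linarith)
      have : 0 ≤ (1 - z) * L := mul_nonneg (by linarith) hLpos.le
      gcongr
      linarith)
    (F := fun x => (P.eval (1 - x)) ^ 2)
    (F' := fun x => 2 * P.eval (1 - x) * (-P.derivative.eval (1 - x)))
    (by fun_prop) (by fun_prop)
    (fun t _ => by simpa using (hasDerivAt_eval_sub P 1 t).fun_pow 2)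
    (B₀ := B ^ 2) (B₁ := 2 * B ^ 2)
    (by
      have := (hB 0 (by simp)).1
      simp only [sub_self]
      rw [abs_pow]
      gcongr)
    (fun t ht => by
      have := hB (1 - t) ⟨by linarith [ht.2], by linarith [ht.1]⟩
      rw [abs_mul, abs_mul, abs_neg, abs_two]
      calc 2 * |P.eval (1 - t)| * |P.derivative.eval (1 - t)| ≤ 2 * B * B := by
            gcongr
            · exact this.1
            · exact this.2
        _ = _ := by ring)
  have e1 : ∑ r ∈ Ioc 0 ⌊R⌋₊ with Real.log (r : ℕ) / L ≤ 1 - z,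
      sieveDensity k A r * weightProfile P z (Real.log r / L) =
      ∑ r ∈ Ioc 0 ⌊R⌋₊ with Real.log (r : ℕ) / L ≤ 1 - z, sieveDensity k A r *
        (P.eval (1 - Real.log r / L) - P.eval (1 - Real.log r / L - z)) ^ 2 := by
    refine Finset.sum_congr rfl fun r hr => ?_
    rw [weightProfile, if_pos (mem_filter.1 hr).2]
  have e2 : ∑ r ∈ Ioc 0 ⌊R⌋₊ with ¬ Real.log (r : ℕ) / L ≤ 1 - z,
      sieveDensity k A r * weightProfile P z (Real.log r / L) =
      ∑ r ∈ Ioc 0 ⌊R⌋₊ with ¬ Real.log (r : ℕ) / L ≤ 1 - z, sieveDensity k A r *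
        (P.eval (1 - Real.log r / L)) ^ 2 := by
    refine Finset.sum_congr rfl fun r hr => ?_
    rw [weightProfile, if_neg (mem_filter.1 hr).2]
  rw [e1, e2] at hsplit2
  have hnn : 0 ≤ ∑ r ∈ Ioc 0 ⌊R⌋₊ with p ∣ r,
      sieveDensity k A r * weightProfile P z (Real.log r / L) :=
    Finset.sum_nonneg fun r _ => mul_nonneg (sieveDensity_nonneg hk hkA r) (weightProfile_nonneg _ _ _)
  set a1 := ∑ r ∈ Ioc 0 ⌊R⌋₊ with Real.log (r : ℕ) / L ≤ 1 - z, sieveDensity k A r *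
        (P.eval (1 - Real.log r / L) - P.eval (1 - Real.log r / L - z)) ^ 2 with ha1
  set a2 := ∑ r ∈ Ioc 0 ⌊R⌋₊ with ¬ Real.log (r : ℕ) / L ≤ 1 - z, sieveDensity k A r *
        (P.eval (1 - Real.log r / L)) ^ 2 with ha2
  set a3 := ∑ r ∈ Ioc 0 ⌊R⌋₊ with p ∣ r,
      sieveDensity k A r * weightProfile P z (Real.log r / L) with ha3
  set a4 := ∑ r ∈ Ioc 0 ⌊R⌋₊ with ¬ p ∣ r,
      sieveDensity k A r * weightProfile P z (Real.log r / L) with ha4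
  have ha : a4 = a1 + a2 - a3 := by linarith
  rw [ha, innerIntegral]
  set I1 := ∫ x in (0 : ℝ)..(1 - z), (P.eval (1 - x) - P.eval (1 - x - z)) ^ 2 * x ^ (k - 1) with hI1
  set I2 := ∫ x in (1 - z)..(1 : ℝ), (P.eval (1 - x)) ^ 2 * x ^ (k - 1) with hI2
  have e : S ^ 2 * (a1 + a2 - a3) - S * L ^ k / ((k - 1).factorial : ℝ) * (I1 + I2) =
      S ^ 2 * ((a1 - S⁻¹ * L ^ k / ((k - 1).factorial : ℝ) * I1) +
        (a2 - S⁻¹ * L ^ k / ((k - 1).factorial : ℝ) * I2) - a3) := by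
    field_simp
    ring
  rw [e, abs_mul, abs_of_nonneg (by positivity : 0 ≤ S ^ 2), mul_assoc]
  refine mul_le_mul_of_nonneg_left ?_ (by positivity)
  refine (abs_sub _ _).trans ((add_le_add ((abs_add_le _ _).trans (add_le_add hlow hhigh))
    ((abs_of_nonneg hnn).le.trans hmult)).trans (le_of_eq ?_))
  rw [mul_pow]; ring

/-! ### Sums over primes -/

/-- Primes `p` with `α < log p / L ≤ β`. -/
noncomputable def primesBetween (L α β : ℝ) : Finset ℕ :=
  (Icc 1 ⌊Real.exp (β * L)⌋₊).filter fun p : ℕ => p.Prime ∧ α < Real.log p / L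

theorem mem_primesBetween {L α β : ℝ} (hL : 0 < L) {p : ℕ} :
    p ∈ primesBetween L α β ↔ p.Prime ∧ α < Real.log p / L ∧ Real.log p / L ≤ β := by
  simp only [primesBetween, mem_filter, mem_Icc]
  constructor
  · rintro ⟨⟨h1, h2⟩, h3, h4⟩
    have hp0 : (0 : ℝ) < p := by exact_mod_cast h1
    refine ⟨h3, h4, ?_⟩
    rw [div_le_iff₀ hL, Real.log_le_iff_le_exp hp0]
    exact (Nat.le_floor_iff' h3.ne_zero).1 h2
  · rintro ⟨h1, h2, h3⟩
    have hp0 : (0 : ℝ) < p := by exact_mod_cast h1.pos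
    rw [div_le_iff₀ hL, Real.log_le_iff_le_exp hp0] at h3
    exact ⟨⟨h1.one_lt.le, Nat.le_floor h3⟩, h1, h2⟩

theorem sum_primesBetween_add {L α β γ : ℝ} (hL : 0 < L) (h1 : α ≤ β) (h2 : β ≤ γ) (F : ℕ → ℝ) :
    ∑ p ∈ primesBetween L α γ, F p = ∑ p ∈ primesBetween L α β, F p + ∑ p ∈ primesBetween L β γ, F p := by
  rw [← Finset.sum_filter_add_sum_filter_not (primesBetween L α γ) (fun p : ℕ => Real.log p / L ≤ β)]
  congr 1
  · refine Finset.sum_congr ?_ fun _ _ => rfl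
    ext p
    simp only [mem_filter, mem_primesBetween hL]
    constructor
    · rintro ⟨⟨a, b, c⟩, d⟩; exact ⟨a, b, d⟩
    · rintro ⟨a, b, c⟩; exact ⟨⟨a, b, c.trans h2⟩, c⟩
  · refine Finset.sum_congr ?_ fun _ _ => rfl
    ext p
    simp only [mem_filter, mem_primesBetween hL, not_le]
    constructor
    · rintro ⟨⟨a, b, c⟩, d⟩; exact ⟨a, d, c⟩
    · rintro ⟨a, b, c⟩; exact ⟨⟨a, h1.trans_lt b, c⟩, b⟩

/-- `H` is integrable on `[u, v]` and its weighted sum over primes in any subinterval is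
approximated by the integral, uniformly in the scale. -/
def PrimeSummable (H : ℝ → ℝ) (u v : ℝ) : Prop :=
  IntervalIntegrable H volume u v ∧ ∃ K : ℝ, 0 ≤ K ∧ ∀ L α β : ℝ, 1 ≤ L → u ≤ α → α ≤ β → β ≤ v →
    |∑ p ∈ primesBetween L α β, Real.log p / p * H (Real.log p / L) - L * ∫ t in α..β, H t| ≤ K

theorem PrimeSummable.refl (H : ℝ → ℝ) (u : ℝ) : PrimeSummable H u u := by
  refine ⟨IntervalIntegrable.refl, 0, le_rfl, fun L α β hL h1 h2 h3 => ?_⟩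
  have e1 : α = u := le_antisymm (h2.trans h3) h1
  have e2 : β = u := le_antisymm h3 (h1.trans h2)
  subst e1
  rw [e2, intervalIntegral.integral_same]
  have : primesBetween L α α = ∅ := by
    ext p
    simp only [mem_primesBetween (by linarith : 0 < L), notMem_empty, iff_false]
    rintro ⟨_, h4, h5⟩
    linarith
  simp [this]

/-- The prime ranges are half-open, so adjacent ones neither overlap nor miss a prime, and the two
errors add. -/
theorem PrimeSummable.trans {H : ℝ → ℝ} {u w v : ℝ} (huw : u ≤ w) (hwv : w ≤ v)
    (h1 : PrimeSummable H u w) (h2 : PrimeSummable H w v) : PrimeSummable H u v := by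
  obtain ⟨i1, K1, hK1, b1⟩ := h1
  obtain ⟨i2, K2, hK2, b2⟩ := h2
  have hint := i1.trans i2
  refine ⟨hint, K1 + K2, by positivity, fun L α β hL ha hab hb => ?_⟩
  have hL0 : 0 < L := by linarith
  rcases le_total β w with h | h
  · exact (b1 L α β hL ha hab h).trans (by linarith)
  rcases le_total w α with h' | h'
  · exact (b2 L α β hL h' hab hb).trans (by linarith)
  have hsub1 : Set.uIcc α w ⊆ Set.uIcc u v := by
    rw [Set.uIcc_of_le h', Set.uIcc_of_le (huw.trans hwv)]; exact Set.Icc_subset_Icc ha hwv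
  have hsub2 : Set.uIcc w β ⊆ Set.uIcc u v := by
    rw [Set.uIcc_of_le h, Set.uIcc_of_le (huw.trans hwv)]; exact Set.Icc_subset_Icc huw hb
  rw [sum_primesBetween_add hL0 h' h,
    ← intervalIntegral.integral_add_adjacent_intervals (hint.mono_set hsub1) (hint.mono_set hsub2)]
  have c1 := b1 L α w hL ha h' le_rfl
  have c2 := b2 L w β hL le_rfl h hb
  have e : ∀ a b c d : ℝ, a + b - L * (c + d) = (a - L * c) + (b - L * d) := fun a b c d => by ring
  rw [e]
  exact (abs_add_le _ _).trans (add_le_add c1 c2)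

/-- By Mertens the weights log p / p have density L in the variable log p / L, with an error bounded
independently of L; partial summation preserves this uniformity. -/
theorem PrimeSummable.of_contDiffOn {H g : ℝ → ℝ} {u v : ℝ} (hu : 0 ≤ u) (huv : u < v)
    (hg : ContDiffOn ℝ 1 g (Set.Icc u v)) (hHg : Set.EqOn H g (Set.Ioo u v)) : PrimeSummable H u v := by
  obtain ⟨K₀, hK₀⟩ := mertens
  have hK₀0 : 0 ≤ K₀ := (abs_nonneg _).trans (hK₀ 1 le_rfl)
  have hgc := hg.continuousOn
  have hg'c : ContinuousOn (derivWithin g (Set.Icc u v)) (Set.Icc u v) :=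
    hg.continuousOn_derivWithin (uniqueDiffOn_Icc huv) le_rfl
  obtain ⟨B₀, hB₀⟩ := isCompact_Icc.exists_bound_of_continuousOn hgc
  obtain ⟨B₁, hB₁⟩ := isCompact_Icc.exists_bound_of_continuousOn hg'c
  have hgint : IntervalIntegrable g volume u v :=
    (by rwa [Set.uIcc_of_le huv.le] : ContinuousOn g (Set.uIcc u v)).intervalIntegrable
  have hint : IntervalIntegrable H volume u v := by
    rw [intervalIntegrable_iff_integrableOn_Ioo_of_le huv.le] at hgint ⊢
    exact hgint.congr_fun (fun t ht => (hHg ht).symm) measurableSet_Ioo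
  have hB00 : 0 ≤ B₀ := (norm_nonneg _).trans (hB₀ u ⟨le_rfl, huv.le⟩)
  have hB10 : 0 ≤ B₁ := (norm_nonneg _).trans (hB₁ u ⟨le_rfl, huv.le⟩)
  refine ⟨hint, 2 * K₀ * (B₀ + (v - u) * B₁) + |H v - g v|, ?_, fun L α β hL ha hab hb => ?_⟩
  · have : 0 ≤ v - u := by linarith
    positivity
  have hL0 : 0 < L := by linarith
  have hsub : Set.Icc α β ⊆ Set.Icc u v := Set.Icc_subset_Icc ha hb
  have hmem : ∀ p ∈ primesBetween L α β, Real.log p / L ∈ Set.Icc α β := by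
    intro p hp
    obtain ⟨_, h2, h3⟩ := (mem_primesBetween hL0).1 hp
    exact ⟨h2.le, h3⟩
  have habel := abs_sum_mul_sub_integral_le (primesBetween L α β) (fun p : ℕ => Real.log p / p)
    (fun p : ℕ => Real.log p / L) (E := 2 * K₀) (B₀ := B₀) (B₁ := B₁) hab hmem (fun _ => L) g
    (derivWithin g (Set.Icc u v)) continuousOn_const (hgc.mono hsub) (hg'c.mono hsub)
    (fun t ht => by
      have hnt : Set.Icc u v ∈ nhds t := Icc_mem_nhds (ha.trans_lt ht.1) (ht.2.trans_le hb)
      exact ((hg.differentiableOn one_ne_zero) t (mem_of_mem_nhds hnt)).hasDerivWithinAt.hasDerivAt hnt)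
    (fun t ht => by
      have hfil : (primesBetween L α β).filter (fun p : ℕ => Real.log p / L ≤ t) =
          primesBetween L α t := by
        ext p
        simp only [mem_filter, mem_primesBetween hL0]
        constructor
        · rintro ⟨⟨h1, h2, _⟩, h4⟩; exact ⟨h1, h2, h4⟩
        · rintro ⟨h1, h2, h4⟩; exact ⟨⟨h1, h2, h4.trans ht.2⟩, h4⟩
      -- The lower end -1 imposes no condition on p, so this is the complete Mertens sum.
      have hall : ∀ s : ℝ, 0 ≤ s →
          |∑ p ∈ primesBetween L (-1) s, Real.log p / p - s * L| ≤ K₀ := by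
        intro s hs
        have h1 := hK₀ (Real.exp (s * L)) (Real.one_le_exp (by positivity))
        rw [Real.log_exp] at h1
        have h2 : primesBetween L (-1) s =
            (Icc 1 ⌊Real.exp (s * L)⌋₊).filter fun p : ℕ => p.Prime := by
          refine Finset.filter_congr fun p _ => ?_
          have : 0 ≤ Real.log p / L := div_nonneg (Real.log_natCast_nonneg p) hL0.le
          exact ⟨fun h => h.1, fun h => ⟨h, by linarith⟩⟩
        rw [h2]; exact h1
      have hα0 : 0 ≤ α := hu.trans ha
      rw [hfil, intervalIntegral.integral_const, smul_eq_mul]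
      have h1 := abs_le.1 (hall t (hα0.trans ht.1))
      have h2 := abs_le.1 (hall α hα0)
      rw [sum_primesBetween_add hL0 (by linarith : (-1 : ℝ) ≤ α) ht.1] at h1
      rw [abs_le]
      constructor <;> linarith [h1.1, h1.2, h2.1, h2.2])
    (hB₀ β (hsub ⟨hab, le_rfl⟩)) (fun t ht => hB₁ t (hsub ht))
  have hHint : ∫ t in α..β, g t * L = L * ∫ t in α..β, H t := by
    rw [intervalIntegral.integral_mul_const, mul_comm]
    congr 1
    rw [intervalIntegral.integral_of_le hab, intervalIntegral.integral_of_le hab,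
      integral_Ioc_eq_integral_Ioo, integral_Ioc_eq_integral_Ioo]
    refine setIntegral_congr_fun measurableSet_Ioo fun t ht => ?_
    exact (hHg ⟨ha.trans_lt ht.1, ht.2.trans_le hb⟩).symm
  rw [hHint] at habel
  -- H is arbitrary at the endpoints. The left one is excluded by the strict inequality, and at most
  -- one prime sits at the right one, with weight log p / p ≤ 1.
  have hend : |∑ p ∈ primesBetween L α β, Real.log p / p * H (Real.log p / L) -
      ∑ p ∈ primesBetween L α β, Real.log p / p * g (Real.log p / L)| ≤ |H v - g v| := by
    rw [← Finset.sum_sub_distrib]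
    have hterm : ∀ p ∈ primesBetween L α β, Real.log p / p * H (Real.log p / L) -
        Real.log p / p * g (Real.log p / L) =
        if Real.log p / L = v then Real.log p / p * (H v - g v) else 0 := by
      intro p hp
      obtain ⟨_, h2, h3⟩ := (mem_primesBetween hL0).1 hp
      split_ifs with h
      · rw [h]; ring
      · rw [hHg ⟨ha.trans_lt h2, lt_of_le_of_ne (h3.trans hb) h⟩, sub_self]
    rw [Finset.sum_congr rfl hterm, ← Finset.sum_filter]
    have hcard : ((primesBetween L α β).filter (fun p : ℕ => Real.log p / L = v)).card ≤ 1 := by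
      refine Finset.card_le_one.2 fun p hp q hq => ?_
      obtain ⟨hp1, hp2⟩ := mem_filter.1 hp
      obtain ⟨hq1, hq2⟩ := mem_filter.1 hq
      have hpp := ((mem_primesBetween hL0).1 hp1).1.pos
      have hqp := ((mem_primesBetween hL0).1 hq1).1.pos
      rw [← hq2, div_left_inj' hL0.ne'] at hp2
      have := Real.log_injOn_pos (Set.mem_Ioi.2 (by exact_mod_cast hpp : (0 : ℝ) < p))
        (Set.mem_Ioi.2 (by exact_mod_cast hqp : (0 : ℝ) < q)) hp2
      exact_mod_cast this
    refine (Finset.abs_sum_le_sum_abs _ _).trans ((Finset.sum_le_card_nsmul _ _ |H v - g v| ?_).trans ?_)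
    · intro p hp
      have hpp := ((mem_primesBetween hL0).1 (mem_filter.1 hp).1).1.pos
      have hp0 : (0 : ℝ) < p := by exact_mod_cast hpp
      rw [abs_mul]
      refine mul_le_of_le_one_left (abs_nonneg _) ?_
      rw [abs_of_nonneg (div_nonneg (Real.log_natCast_nonneg p) hp0.le), div_le_one hp0]
      linarith [Real.log_le_sub_one_of_pos hp0]
    · rw [nsmul_eq_mul]
      exact mul_le_of_le_one_left (abs_nonneg _) (by exact_mod_cast hcard)
  refine (abs_sub_le _ _ _).trans ((add_le_add hend habel).trans ?_)
  have : (β - α) * B₁ ≤ (v - u) * B₁ := by gcongr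
  have h2 : 2 * K₀ * (B₀ + (β - α) * B₁) ≤ 2 * K₀ * (B₀ + (v - u) * B₁) := by gcongr
  linarith

/-- Prime sums of a piecewise smooth function times a `C¹` function. -/
theorem PrimeSummable.of_piecewiseSmoothOn {W V : ℝ → ℝ} {ρ A B : ℝ} (hW : PiecewiseSmoothOn W 0 ρ)
    (hA : 0 ≤ A) (hAB : A ≤ B) (hB : B ≤ ρ) (hV : ContDiffOn ℝ 1 V (Set.Icc A B)) :
    PrimeSummable (fun t => W t * V t) A B := by
  obtain ⟨m, t, ht, ht0, htm, hpiece⟩ := hW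
  -- The partition of [0, ρ] is clamped to [A, B]. Pieces outside collapse to a point; a piece that
  -- does not collapse lies inside the original one, so the smooth extension is available there.
  set τ : Fin (m + 1) → ℝ := fun i => max A (min B (t i)) with hτ
  have hAτ : ∀ i, A ≤ τ i := fun i => le_max_left _ _
  have hτB : ∀ i, τ i ≤ B := fun i => max_le hAB (min_le_left _ _)
  have key : ∀ i, PrimeSummable (fun t => W t * V t) A (τ i) := by
    intro i
    induction i using Fin.induction with
    | zero =>
      have : τ 0 = A := by
        simp only [hτ, ht0]
        exact max_eq_left ((min_le_right _ _).trans hA)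
      rw [this]
      exact PrimeSummable.refl _ _
    | succ i ih =>
      have hlt : t i.castSucc < t i.succ := ht (Fin.castSucc_lt_succ)
      have hmono : τ i.castSucc ≤ τ i.succ := max_le_max le_rfl (min_le_min le_rfl hlt.le)
      refine PrimeSummable.trans (hAτ _) hmono ih ?_
      rcases hmono.eq_or_lt with h | h
      · rw [h]; exact PrimeSummable.refl _ _
      · obtain ⟨g, hg1, hg2⟩ := hpiece i
        have h1 : t i.castSucc ≤ τ i.castSucc := by
          by_contra hc
          have h3 := hτB i.succ
          have h4 : min B (t i.castSucc) ≤ τ i.castSucc := le_max_right _ _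
          rcases min_le_iff.1 h4 with h5 | h5
          · linarith
          · exact hc h5
        have h2 : τ i.succ ≤ t i.succ := by
          refine max_le ?_ (min_le_right _ _)
          by_contra hc
          have h3 : τ i.succ = A := max_eq_left ((min_le_right _ _).trans (not_le.1 hc).le)
          have h4 := hAτ i.castSucc
          linarith
        refine PrimeSummable.of_contDiffOn (g := fun s => g s * V s) (hA.trans (hAτ _)) h ?_ ?_
        · refine ContDiffOn.mul ?_ ?_
          · exact (hg1.of_le (by exact_mod_cast le_top)).mono (Set.Icc_subset_Icc h1 h2)
          · exact hV.mono (Set.Icc_subset_Icc (hAτ _) (hτB _))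
        · intro s hs
          simp only
          rw [hg2 ⟨h1.trans_lt hs.1, hs.2.trans_le h2⟩]
  have hlast : τ (Fin.last m) = B := by
    simp only [hτ, htm]
    rw [min_eq_left hB, max_eq_right hAB]
  have := key (Fin.last m)
  rwa [hlast] at this

theorem PiecewiseSmoothOn.bounded {W : ℝ → ℝ} {u v : ℝ} (hW : PiecewiseSmoothOn W u v) :
    ∃ B : ℝ, 0 ≤ B ∧ ∀ x ∈ Set.Icc u v, |W x| ≤ B := by
  obtain ⟨m, t, ht, ht0, htm, hpiece⟩ := hW
  have key : ∀ i, ∃ B : ℝ, 0 ≤ B ∧ ∀ x ∈ Set.Icc u (t i), |W x| ≤ B := by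
    intro i
    induction i using Fin.induction with
    | zero =>
      refine ⟨|W u|, abs_nonneg _, fun x hx => ?_⟩
      rw [ht0] at hx
      rw [le_antisymm hx.2 hx.1]
    | succ i ih =>
      obtain ⟨B, hB0, hB⟩ := ih
      obtain ⟨g, hg1, hg2⟩ := hpiece i
      obtain ⟨B', hB'⟩ := isCompact_Icc.exists_bound_of_continuousOn hg1.continuousOn
      refine ⟨max B (max B' |W (t i.succ)|), le_max_of_le_left hB0, fun x hx => ?_⟩
      rcases le_or_gt x (t i.castSucc) with h | h
      · exact (hB x ⟨hx.1, h⟩).trans (le_max_left _ _)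
      · rcases hx.2.eq_or_lt with h' | h'
        · rw [h']
          exact (le_max_right _ _).trans (le_max_right _ _)
        · rw [hg2 ⟨h, h'⟩]
          exact (hB' x ⟨h.le, h'.le⟩).trans ((le_max_left _ _).trans (le_max_right _ _))
  have := key (Fin.last m)
  rwa [htm] at this

/-- `∑_{p ≤ x} 1 / p ≪ log log x`. -/
theorem sum_prime_inv_le : ∃ K : ℝ, 0 ≤ K ∧ ∀ x : ℝ, Real.exp 1 ≤ x →
    ∑ p ∈ Icc 1 ⌊x⌋₊ with p.Prime, (p : ℝ)⁻¹ ≤ K * (1 + Real.log (Real.log x)) := by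
  obtain ⟨K₀, hK₀⟩ := mertens
  have hK₀0 : 0 ≤ K₀ := (abs_nonneg _).trans (hK₀ 1 le_rfl)
  set u := Real.log (Real.log 2) with hu
  have hlog2 : 0 < Real.log 2 := Real.log_pos (by norm_num)
  have hu0 : u ≤ 0 := Real.log_nonpos hlog2.le (by linarith [Real.log_two_lt_d9])
  have hexpu : Real.exp u = Real.log 2 := Real.exp_log hlog2
  set c := (Real.log 2)⁻¹ with hc
  have hc0 : 0 < c := inv_pos.2 hlog2
  refine ⟨(K₀ + 1) * (c + (1 - u) * c) + (1 - u), by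
    have : 0 ≤ 1 - u := by linarith
    positivity, fun x hx => ?_⟩
  have hx0 : 0 < x := (Real.exp_pos 1).trans_le hx
  have hlx : 1 ≤ Real.log x := (Real.le_log_iff_exp_le hx0).2 hx
  have hlx0 : 0 < Real.log x := by linarith
  set v := Real.log (Real.log x) with hv
  have hv0 : 0 ≤ v := Real.log_nonneg hlx
  have hexpv : Real.exp v = Real.log x := Real.exp_log hlx0
  set s := (Icc 1 ⌊x⌋₊).filter Nat.Prime with hs
  have hsp : ∀ p ∈ s, 2 ≤ p ∧ (p : ℝ) ≤ x ∧ 0 < Real.log p := by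
    intro p hp
    obtain ⟨h1, h2⟩ := mem_filter.1 hp
    have := h2.two_le
    exact ⟨this, (Nat.le_floor_iff' h2.ne_zero).1 (mem_Icc.1 h1).2, Real.log_pos (by exact_mod_cast h2.one_lt)⟩
  -- In the variable t = log log p the density is e^t, and F(t) = e^(-t) turns log p / p into 1/p,
  -- so the integral is just the length v - u. The extra 1 in E pays for log 2, since the integral
  -- starts at log log 2.
  have habel := abs_sum_mul_sub_integral_le s (fun p : ℕ => Real.log p / p)
    (fun p : ℕ => Real.log (Real.log p)) (u := u) (v := v) (E := K₀ + 1) (B₀ := c) (B₁ := c)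
    (by linarith)
    (fun p hp => by
      obtain ⟨h1, h2, h3⟩ := hsp p hp
      exact ⟨Real.log_le_log hlog2 (Real.log_le_log (by norm_num) (by exact_mod_cast h1)),
        Real.log_le_log h3 (Real.log_le_log (by have := h1; positivity) h2)⟩)
    (fun t => Real.exp t) (fun t => Real.exp (-t)) (fun t => -Real.exp (-t))
    (by fun_prop) (by fun_prop) (by fun_prop)
    (fun t _ => by simpa using ((hasDerivAt_id t).neg).exp)
    (fun t ht => by
      have het : Real.log 2 ≤ Real.exp t := hexpu ▸ Real.exp_le_exp.2 ht.1
      have hfil : s.filter (fun p : ℕ => Real.log (Real.log p) ≤ t) =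
          (Icc 1 ⌊Real.exp (Real.exp t)⌋₊).filter Nat.Prime := by
        ext p
        simp only [hs, mem_filter, mem_Icc]
        have hiff : p.Prime → (Real.log (Real.log p) ≤ t ↔ p ≤ ⌊Real.exp (Real.exp t)⌋₊) := by
          intro hp
          have h1 : (0 : ℝ) < p := by exact_mod_cast hp.pos
          rw [Real.log_le_iff_le_exp (Real.log_pos (by exact_mod_cast hp.one_lt)),
            Real.log_le_iff_le_exp h1, Nat.le_floor_iff' hp.ne_zero]
        constructor
        · rintro ⟨⟨⟨h1, _⟩, h3⟩, h4⟩
          exact ⟨⟨h1, (hiff h3).1 h4⟩, h3⟩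
        · rintro ⟨⟨h1, h2⟩, h3⟩
          refine ⟨⟨⟨h1, h2.trans (Nat.floor_mono ?_)⟩, h3⟩, (hiff h3).2 h2⟩
          rw [← Real.exp_log hx0, ← hexpv]
          exact Real.exp_le_exp.2 (Real.exp_le_exp.2 ht.2)
      rw [hfil, integral_exp, hexpu]
      have h1 := abs_le.1 (hK₀ (Real.exp (Real.exp t)) (Real.one_le_exp (by positivity)))
      rw [Real.log_exp] at h1
      have := Real.log_two_lt_d9
      rw [abs_le]
      constructor <;> linarith [h1.1, h1.2])
    (by
      rw [abs_of_nonneg (Real.exp_pos _).le, Real.exp_neg, hexpv, hc]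
      exact inv_anti₀ hlog2 (by linarith [Real.log_two_lt_d9]))
    (fun t ht => by
      rw [abs_neg, abs_of_nonneg (Real.exp_pos _).le, Real.exp_neg, hc, ← hexpu]
      exact inv_anti₀ (Real.exp_pos _) (Real.exp_le_exp.2 ht.1))
  have hint : ∫ t in u..v, Real.exp (-t) * Real.exp t = v - u := by
    simp [← Real.exp_add]
  have hsum : ∑ p ∈ s, Real.log p / p * Real.exp (-Real.log (Real.log p)) = ∑ p ∈ s, (p : ℝ)⁻¹ := by
    refine Finset.sum_congr rfl fun p hp => ?_
    have h3 := (hsp p hp).2.2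
    rw [Real.exp_neg, Real.exp_log h3]
    field_simp
  rw [hint, hsum] at habel
  have h1 := (abs_le.1 habel).2
  have h2 : v - u ≤ (1 - u) * (1 + v) := by nlinarith
  have h3 : (K₀ + 1) * (c + (v - u) * c) ≤ (K₀ + 1) * (c + (1 - u) * c) * (1 + v) := by
    have h4 : (v - u) * c ≤ (1 - u) * (1 + v) * c := by gcongr
    have h5 : c ≤ c * (1 + v) := le_mul_of_one_le_right hc0.le (by linarith)
    calc _ ≤ (K₀ + 1) * (c * (1 + v) + (1 - u) * (1 + v) * c) := by gcongr
      _ = _ := by ring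
  calc _ ≤ (K₀ + 1) * (c + (1 - u) * c) * (1 + v) + (1 - u) * (1 + v) := by linarith
    _ = _ := by ring

/-! ### The inner integrals as polynomials vanishing at 0 -/

theorem exists_polynomial_integral (q : Polynomial (Polynomial ℝ)) : ∃ T : Polynomial ℝ, ∀ s : ℝ,
    ∫ x in (0 : ℝ)..(1 - s), (q.map (Polynomial.evalRingHom s)).eval x = T.eval s := by
  induction q using Polynomial.induction_on' with
  | add p q hp hq =>
    obtain ⟨T₁, h₁⟩ := hp
    obtain ⟨T₂, h₂⟩ := hq
    refine ⟨T₁ + T₂, fun s => ?_⟩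
    simp only [Polynomial.map_add, Polynomial.eval_add]
    rw [intervalIntegral.integral_add ((Polynomial.continuous _).intervalIntegrable _ _)
      ((Polynomial.continuous _).intervalIntegrable _ _), h₁, h₂]
  | monomial n c =>
    refine ⟨c * (1 - Polynomial.X) ^ (n + 1) * Polynomial.C ((n : ℝ) + 1)⁻¹, fun s => ?_⟩
    simp only [Polynomial.map_monomial, Polynomial.eval_monomial, intervalIntegral.integral_const_mul,
      integral_pow]
    simp
    ring

/-- The expression is a polynomial in s, and the hypothesis says that 0 is a root. Dividing by s
removes the apparent singularity of W(y)/y at y = 0. -/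
theorem exists_polynomial_of_integral_zero (q : Polynomial (Polynomial ℝ)) (c₀ c₁ : ℝ)
    (h : c₀ + c₁ * ∫ x in (0 : ℝ)..1, (q.map (Polynomial.evalRingHom 0)).eval x = 0) :
    ∃ Q : Polynomial ℝ, ∀ s : ℝ,
      c₀ + c₁ * ∫ x in (0 : ℝ)..(1 - s), (q.map (Polynomial.evalRingHom s)).eval x = s * Q.eval s := by
  obtain ⟨T, hT⟩ := exists_polynomial_integral q
  have h0 : (Polynomial.C c₀ + Polynomial.C c₁ * T).IsRoot 0 := by
    have := hT 0
    rw [sub_zero] at this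
    simp [← this, h]
  obtain ⟨Q, hQ⟩ := Polynomial.dvd_iff_isRoot.2 h0
  refine ⟨Q, fun s => ?_⟩
  rw [hT]
  have := congrArg (Polynomial.eval s) hQ
  simpa using this

/-- The integrand is a polynomial in s and x, and it vanishes identically at s = 0. -/
theorem exists_quotient_first (k : ℕ) (P : Polynomial ℝ) : ∃ Q : Polynomial ℝ, ∀ s : ℝ,
    ∫ x in (0 : ℝ)..(1 - s), (P.eval (1 - x) - P.eval (1 - x - s)) ^ 2 * x ^ (k - 1) =
      s * Q.eval s := by
  set q : Polynomial (Polynomial ℝ) :=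
    (P.eval₂ (Polynomial.C.comp Polynomial.C) (1 - Polynomial.X) -
      P.eval₂ (Polynomial.C.comp Polynomial.C) (1 - Polynomial.X - Polynomial.C Polynomial.X)) ^ 2 *
      Polynomial.X ^ (k - 1) with hq
  have hmap : ∀ s x : ℝ, (q.map (Polynomial.evalRingHom s)).eval x =
      (P.eval (1 - x) - P.eval (1 - x - s)) ^ 2 * x ^ (k - 1) := by
    intro s x
    have h1 : ∀ z : Polynomial (Polynomial ℝ),
        ((P.eval₂ (Polynomial.C.comp Polynomial.C) z).map (Polynomial.evalRingHom s)).eval x =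
        P.eval ((z.map (Polynomial.evalRingHom s)).eval x) := by
      intro z
      have := Polynomial.hom_eval₂ P (Polynomial.C.comp Polynomial.C)
        ((Polynomial.evalRingHom x).comp (Polynomial.mapRingHom (Polynomial.evalRingHom s))) z
      simp only [RingHom.comp_apply, Polynomial.coe_mapRingHom, Polynomial.coe_evalRingHom] at this
      rw [this, ← Polynomial.eval₂_id]
      congr 1
      ext; simp
    rw [hq]
    simp only [Polynomial.map_mul, Polynomial.map_pow, Polynomial.map_sub, Polynomial.eval_mul,
      Polynomial.eval_pow, Polynomial.eval_sub, h1]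
    simp
  obtain ⟨Q, hQ⟩ := exists_polynomial_of_integral_zero q 0 1 (by simp [hmap])
  refine ⟨Q, fun s => ?_⟩
  rw [← hQ s]
  simp [hmap]

/-- The integral is the full one over [0, 1] minus the one over [0, 1 - s], which accounts for c₁ =
-1; the two agree at s = 0. -/
theorem exists_quotient_second (k : ℕ) (P : Polynomial ℝ) : ∃ Q : Polynomial ℝ, ∀ s : ℝ,
    ∫ x in (1 - s)..(1 : ℝ), (P.eval (1 - x)) ^ 2 * x ^ (k - 1) = s * Q.eval s := by
  set q₀ : Polynomial ℝ := (P.comp (1 - Polynomial.X)) ^ 2 * Polynomial.X ^ (k - 1) with hq₀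
  set q : Polynomial (Polynomial ℝ) := q₀.map Polynomial.C with hq
  have hmap : ∀ s x : ℝ, (q.map (Polynomial.evalRingHom s)).eval x =
      (P.eval (1 - x)) ^ 2 * x ^ (k - 1) := by
    intro s x
    have : (Polynomial.evalRingHom s).comp Polynomial.C = RingHom.id ℝ := by
      ext; simp
    rw [hq, Polynomial.map_map, this, Polynomial.map_id, hq₀]
    simp
  obtain ⟨Q, hQ⟩ := exists_polynomial_of_integral_zero q
    (∫ x in (0 : ℝ)..1, (P.eval (1 - x)) ^ 2 * x ^ (k - 1)) (-1) (by simp [hmap])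
  refine ⟨Q, fun s => ?_⟩
  rw [← hQ s]
  simp only [hmap]
  have hc : Continuous fun x : ℝ => (P.eval (1 - x)) ^ 2 * x ^ (k - 1) := by fun_prop
  have := intervalIntegral.integral_add_adjacent_intervals (hc.intervalIntegrable (μ := volume) 0 (1 - s))
    (hc.intervalIntegrable (μ := volume) (1 - s) 1)
  linarith

/-! ### The main term -/

/-- The function integrated against primes in the main term. -/
noncomputable def primeProfile (W : ℝ → ℝ) (Q : Polynomial ℝ) (c t : ℝ) : ℝ :=
  if t ≤ 1 then W t * Q.eval t else W t * (c / t)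

/-- J₀ is k times the integral of `primeProfile` over [0, u]. On each of [0, 1] and [1, u] the
profile is W times a C¹ function, so `PrimeSummable` applies. The division by t is legitimate
because integrands need only agree on open intervals. -/
theorem primeSum_asymptotic (k : ℕ) (P : Polynomial ℝ) {W : ℝ → ℝ} {ρ : ℝ} (hρ : 1 ≤ ρ)
    (hW : PiecewiseSmoothOn W 0 ρ) : ∃ Q : Polynomial ℝ,
    (∀ s : ℝ, innerIntegral k P s = s * Q.eval s) ∧
    (∃ B : ℝ, 0 ≤ B ∧ ∀ t ∈ Set.Icc 0 ρ, |primeProfile W Q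
      (∫ x in (0 : ℝ)..1, (P.eval (1 - x)) ^ 2 * x ^ (k - 1)) t| ≤ B) ∧
    ∃ K : ℝ, 0 ≤ K ∧ ∀ L u : ℝ, 1 ≤ L → 1 ≤ u → u ≤ ρ →
      |k * ∑ p ∈ primesBetween L 0 u, Real.log p / p * primeProfile W Q
        (∫ x in (0 : ℝ)..1, (P.eval (1 - x)) ^ 2 * x ^ (k - 1)) (Real.log p / L) -
        L * J₀ k P W u| ≤ K := by
  obtain ⟨Q₁, hQ₁⟩ := exists_quotient_first k P
  obtain ⟨Q₂, hQ₂⟩ := exists_quotient_second k P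
  set c := ∫ x in (0 : ℝ)..1, (P.eval (1 - x)) ^ 2 * x ^ (k - 1) with hc
  refine ⟨Q₁ + Q₂, fun s => ?_, ?_, ?_⟩
  · rw [innerIntegral, hQ₁, hQ₂, Polynomial.eval_add]; ring
  · obtain ⟨Bw, hBw0, hBw⟩ := hW.bounded
    obtain ⟨B₁, hB₁⟩ := (isCompact_Icc (a := (0 : ℝ)) (b := 1)).exists_bound_of_continuousOn
      (f := fun x => (Q₁ + Q₂).eval x) (Polynomial.continuous _).continuousOn
    refine ⟨Bw * max B₁ |c|, mul_nonneg hBw0 (le_max_of_le_right (abs_nonneg _)), fun t ht => ?_⟩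
    rw [primeProfile]
    split_ifs with h
    · rw [abs_mul]
      exact mul_le_mul (hBw t ht) ((hB₁ t ⟨ht.1, h⟩).trans (le_max_left _ _)) (abs_nonneg _) hBw0
    · rw [abs_mul]
      refine mul_le_mul (hBw t ht) (le_trans ?_ (le_max_right _ _)) (abs_nonneg _) hBw0
      rw [abs_div, abs_of_pos (by linarith : 0 < t)]
      exact div_le_self (abs_nonneg _) (by linarith)
  · have s₁ := PrimeSummable.of_piecewiseSmoothOn hW le_rfl zero_le_one hρ
      (V := fun t => Q₁.eval t) (Polynomial.contDiff_aeval Q₁ 1).contDiffOn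
    have s₂ := PrimeSummable.of_piecewiseSmoothOn hW le_rfl zero_le_one hρ
      (V := fun t => Q₂.eval t) (Polynomial.contDiff_aeval Q₂ 1).contDiffOn
    have s₃ := PrimeSummable.of_piecewiseSmoothOn hW zero_le_one hρ le_rfl
      (V := fun t => c / t) (contDiffOn_const.div contDiffOn_id
        (fun x hx => by have := hx.1; linarith))
    obtain ⟨i₁, K₁, hK₁, b₁⟩ := s₁
    obtain ⟨i₂, K₂, hK₂, b₂⟩ := s₂
    obtain ⟨i₃, K₃, hK₃, b₃⟩ := s₃
    refine ⟨k * (K₁ + K₂ + K₃), by positivity, fun L u hL hu huρ => ?_⟩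
    have hL0 : 0 < L := by linarith
    have c₁ := b₁ L 0 1 hL le_rfl zero_le_one le_rfl
    have c₂ := b₂ L 0 1 hL le_rfl zero_le_one le_rfl
    have c₃ := b₃ L 1 u hL le_rfl hu huρ
    have hJ₁ : J₀₁ k P W = k * ∫ t in (0 : ℝ)..1, W t * Q₁.eval t := by
      rw [J₀₁]
      congr 1
      refine intervalIntegral.integral_congr_Ioo_of_le zero_le_one fun t ht => ?_
      rw [hQ₁]
      have := ht.1.ne'
      field_simp
    have hJ₂ : J₀₂ k P W = k * ∫ t in (0 : ℝ)..1, W t * Q₂.eval t := by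
      rw [J₀₂]
      congr 1
      refine intervalIntegral.integral_congr_Ioo_of_le zero_le_one fun t ht => ?_
      rw [hQ₂]
      have := ht.1.ne'
      field_simp
    have hJ₃ : J₀₃ k P W u = k * ∫ t in (1 : ℝ)..u, W t * (c / t) := by
      rw [J₀₃]
      congr 1
      refine intervalIntegral.integral_congr_Ioo_of_le hu fun t ht => ?_
      ring
    have hsum : ∑ p ∈ primesBetween L 0 u, Real.log p / p * primeProfile W (Q₁ + Q₂) c (Real.log p / L) =
        (∑ p ∈ primesBetween L 0 1, Real.log p / p * (W (Real.log p / L) * Q₁.eval (Real.log p / L)) +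
        ∑ p ∈ primesBetween L 0 1, Real.log p / p * (W (Real.log p / L) * Q₂.eval (Real.log p / L))) +
        ∑ p ∈ primesBetween L 1 u, Real.log p / p * (W (Real.log p / L) * (c / (Real.log p / L))) := by
      rw [sum_primesBetween_add hL0 zero_le_one hu, ← Finset.sum_add_distrib]
      congr 1
      · refine Finset.sum_congr rfl fun p hp => ?_
        rw [primeProfile, if_pos ((mem_primesBetween hL0).1 hp).2.2, Polynomial.eval_add]
        ring
      · refine Finset.sum_congr rfl fun p hp => ?_
        rw [primeProfile, if_neg (not_le.2 ((mem_primesBetween hL0).1 hp).2.1)]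
    rw [hsum, J₀, hJ₁, hJ₂, hJ₃]
    have e : ∀ a₁ a₂ a₃ j₁ j₂ j₃ : ℝ, k * (a₁ + a₂ + a₃) - L * (k * j₁ + k * j₂ + k * j₃) =
        k * ((a₁ - L * j₁) + (a₂ - L * j₂) + (a₃ - L * j₃)) := fun _ _ _ _ _ _ => by ring
    rw [e, abs_mul, abs_of_nonneg (Nat.cast_nonneg k)]
    refine mul_le_mul_of_nonneg_left ?_ (Nat.cast_nonneg k)
    exact (abs_add_le _ _).trans (add_le_add ((abs_add_le _ _).trans (add_le_add c₁ c₂)) c₃)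

/-- For each p the sum over r is replaced by its integral with error O(L^(k-1)); weighted by k/p,
these errors total O(L^(k-1) log log R₁) with log R₁ = uL. The weight 1/p is rewritten as (1/L)(log
p / p)(1/y) with y = log p / L, which is what `primeProfile` expects. Restoring the at most A primes
dividing A costs O(1) before the factor L^(k-1). -/
theorem mainTerm_asymptotic {k A : ℕ} (hk : 1 ≤ k) (hA : A ≠ 0)
    (hkA : ∀ p : ℕ, p.Prime → ¬ p ∣ A → k < p) (P : Polynomial ℝ) {W : ℝ → ℝ} {ρ : ℝ} (hρ : 1 ≤ ρ)
    (hW : PiecewiseSmoothOn W 0 ρ) :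
    ∃ K : ℝ, 0 ≤ K ∧ ∀ R u : ℝ, 0 < R → 1 ≤ Real.log R → 1 ≤ u → u ≤ ρ →
      |∑ p ∈ primesBetween (Real.log R) 0 u with ¬ p ∣ A, W (Real.log p / Real.log R) *
        ((k / p : ℝ) * ∑ r ∈ Ioc 0 ⌊R⌋₊ with ¬ p ∣ r,
          sieveDensity k A r * (y k A P R r - y k A P R (r * p)) ^ 2) -
        singularSeries k A * Real.log R ^ k / ((k - 1).factorial : ℝ) * J₀ k P W u| ≤
      K * Real.log R ^ (k - 1) * (1 + Real.log (u * Real.log R)) := by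
  obtain ⟨hS, Kd, hKd0, hKd⟩ := sum_sieveDensity_asymptotic hk hA hkA
  obtain ⟨Ks, hKs0, hKs⟩ := sum_density_of_small_prime hk hkA hS hKd0 hKd P
  obtain ⟨Kl, hKl0, hKl⟩ := sum_density_of_large_prime hk hS hKd0 hKd P
  obtain ⟨Bw, hBw0, hBw⟩ := hW.bounded
  obtain ⟨Kp, hKp0, hKp⟩ := sum_prime_inv_le
  obtain ⟨Q, hQ, ⟨B, hB0, hB⟩, Kj, hKj0, hKj⟩ := primeSum_asymptotic k P hρ hW
  set S := singularSeries k A with hSdef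
  set c := ∫ x in (0 : ℝ)..1, (P.eval (1 - x)) ^ 2 * x ^ (k - 1) with hc
  refine ⟨Bw * k * (Ks + Kl) * Kp + |S| * (Kj + k * A * B), by positivity,
    fun R u hR0 hL hu huρ => ?_⟩
  set L := Real.log R with hLdef
  have hL0 : 0 < L := by linarith
  have hu0 : 0 < u := by linarith
  have huL : 1 ≤ u * L := by nlinarith
  have hll : 0 ≤ Real.log (u * L) := Real.log_nonneg huL
  set PS := primesBetween L 0 u with hPS
  have hmem : ∀ p ∈ PS, p.Prime ∧ 0 < Real.log p / L ∧ Real.log p / L ≤ u := fun p hp =>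
    (mem_primesBetween hL0).1 hp
  set T : ℕ → ℝ := fun p => ∑ r ∈ Ioc 0 ⌊R⌋₊ with ¬ p ∣ r,
    sieveDensity k A r * (y k A P R r - y k A P R (r * p)) ^ 2 with hT
  set X : ℝ := S * L ^ k / ((k - 1).factorial : ℝ) with hX
  set H : ℕ → ℝ := fun p => Real.log p / p * primeProfile W Q c (Real.log p / L) with hH
  have hterm : ∀ p ∈ PS.filter (fun p => ¬ p ∣ A),
      |W (Real.log p / L) * ((k / p : ℝ) * T p) - X * (k / L * H p)| ≤
      Bw * k * (Ks + Kl) * L ^ (k - 1) * (p : ℝ)⁻¹ := by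
    intro p hp
    obtain ⟨hp1, hpA⟩ := mem_filter.1 hp
    obtain ⟨hpp, hy0, hyu⟩ := hmem p hp1
    have hp0 : (0 : ℝ) < p := by exact_mod_cast hpp.pos
    have hlogp : 0 < Real.log p := Real.log_pos (by exact_mod_cast hpp.one_lt)
    -- φ is the limiting integral attached to p: `innerIntegral` for p ≤ R and the constant c for p
    -- > R. This is the same division as in `primeProfile`.
    obtain ⟨φ, hφ1, hφ2⟩ : ∃ φ : ℝ, k / L * H p = W (Real.log p / L) * ((k / p : ℝ) * φ) ∧
        |T p - X * φ| ≤ (Ks + Kl) * L ^ (k - 1) := by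
      have hpow : 0 ≤ L ^ (k - 1) := by positivity
      rcases le_or_gt (p : ℝ) R with h | h
      · refine ⟨innerIntegral k P (Real.log p / L), ?_, (hKs R hR0 hL p hpp hpA h).trans ?_⟩
        · have h1 : Real.log p / L ≤ 1 := (div_le_one hL0).2 (Real.log_le_log hp0 h)
          simp only [hH]
          rw [primeProfile, if_pos h1, hQ]
          field_simp
        · gcongr
          linarith
      · refine ⟨c, ?_, (hKl R hR0 hL p h).trans ?_⟩
        · have h1 : ¬ Real.log p / L ≤ 1 := by
            rw [div_le_one hL0, not_le]
            exact Real.log_lt_log hR0 h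
          simp only [hH]
          rw [primeProfile, if_neg h1]
          field_simp
        · gcongr
          linarith
    rw [hφ1]
    have e : W (Real.log p / L) * ((k / p : ℝ) * T p) - X * (W (Real.log p / L) * ((k / p : ℝ) * φ)) =
        W (Real.log p / L) * (k / p : ℝ) * (T p - X * φ) := by ring
    rw [e, abs_mul, abs_mul, abs_of_nonneg (by positivity : (0 : ℝ) ≤ k / p)]
    calc _ ≤ Bw * (k / p : ℝ) * ((Ks + Kl) * L ^ (k - 1)) := by
          gcongr
          exact hBw _ ⟨hy0.le, hyu.trans huρ⟩
      _ = _ := by ring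
  have hinv : ∑ p ∈ PS.filter (fun p => ¬ p ∣ A), (p : ℝ)⁻¹ ≤ Kp * (1 + Real.log (u * L)) := by
    have h1 := hKp (Real.exp (u * L)) (Real.exp_le_exp.2 huL)
    rw [Real.log_exp] at h1
    refine le_trans (Finset.sum_le_sum_of_subset_of_nonneg ?_ fun p _ _ => by positivity) h1
    intro p hp
    have h2 := (mem_filter.1 hp).1
    rw [hPS, primesBetween] at h2
    obtain ⟨h3, h4, _⟩ := mem_filter.1 h2
    exact mem_filter.2 ⟨h3, h4⟩
  have h1 : |∑ p ∈ PS with ¬ p ∣ A, W (Real.log p / L) * ((k / p : ℝ) * T p) -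
      X * (k / L * ∑ p ∈ PS with ¬ p ∣ A, H p)| ≤
      Bw * k * (Ks + Kl) * Kp * L ^ (k - 1) * (1 + Real.log (u * L)) := by
    rw [Finset.mul_sum, Finset.mul_sum, ← Finset.sum_sub_distrib]
    refine (Finset.abs_sum_le_sum_abs _ _).trans ((Finset.sum_le_sum hterm).trans ?_)
    rw [← Finset.mul_sum]
    calc _ ≤ Bw * k * (Ks + Kl) * L ^ (k - 1) * (Kp * (1 + Real.log (u * L))) := by gcongr
      _ = _ := by ring
  have hHb : ∀ p ∈ PS, |H p| ≤ B := by
    intro p hp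
    obtain ⟨hpp, hy0, hyu⟩ := hmem p hp
    have hp0 : (0 : ℝ) < p := by exact_mod_cast hpp.pos
    have hlogp : 0 ≤ Real.log p := Real.log_natCast_nonneg p
    simp only [hH]
    rw [abs_mul, abs_of_nonneg (by positivity)]
    refine (mul_le_of_le_one_left (abs_nonneg _) ?_).trans (hB _ ⟨hy0.le, hyu.trans huρ⟩)
    rw [div_le_one hp0]
    linarith [Real.log_le_sub_one_of_pos hp0]
  have h2 : |∑ p ∈ PS with p ∣ A, H p| ≤ A * B := by
    refine (Finset.abs_sum_le_sum_abs _ _).trans ((Finset.sum_le_card_nsmul _ _ B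
      fun p hp => hHb p (mem_filter.1 hp).1).trans ?_)
    rw [nsmul_eq_mul]
    refine mul_le_mul_of_nonneg_right ?_ hB0
    have hsub : PS.filter (fun p => p ∣ A) ⊆ Icc 1 A := by
      intro p hp
      obtain ⟨hp1, hp2⟩ := mem_filter.1 hp
      exact mem_Icc.2 ⟨(hmem p hp1).1.one_lt.le, Nat.le_of_dvd (Nat.pos_of_ne_zero hA) hp2⟩
    have := Finset.card_le_card hsub
    rw [Nat.card_Icc, Nat.add_sub_cancel] at this
    exact_mod_cast this
  have h3 := hKj L u hL hu huρ
  have hsplit := Finset.sum_filter_add_sum_filter_not PS (fun p => p ∣ A) H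
  have h4 : |k / L * ∑ p ∈ PS with ¬ p ∣ A, H p - J₀ k P W u| ≤ (Kj + k * A * B) / L := by
    have e : k / L * ∑ p ∈ PS with ¬ p ∣ A, H p - J₀ k P W u =
        ((k * ∑ p ∈ PS, H p - L * J₀ k P W u) - k * ∑ p ∈ PS with p ∣ A, H p) / L := by
      rw [← hsplit]
      field_simp
      ring
    rw [e, abs_div, abs_of_pos hL0]
    gcongr
    refine (abs_sub _ _).trans (add_le_add h3 ?_)
    rw [abs_mul, abs_of_nonneg (Nat.cast_nonneg k), mul_assoc]
    gcongr
  have hXb : |X| ≤ |S| * L ^ k := by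
    rw [hX, abs_div, abs_mul, abs_of_nonneg (by positivity : 0 ≤ L ^ k),
      abs_of_nonneg (by positivity : (0 : ℝ) ≤ ((k - 1).factorial : ℝ))]
    refine div_le_self (by positivity) ?_
    exact_mod_cast Nat.factorial_pos (k - 1)
  have h5 : |X * (k / L * ∑ p ∈ PS with ¬ p ∣ A, H p) - X * J₀ k P W u| ≤
      |S| * (Kj + k * A * B) * L ^ (k - 1) * (1 + Real.log (u * L)) := by
    rw [← mul_sub, abs_mul]
    have hLk : L ^ k = L * L ^ (k - 1) := by rw [← pow_succ']; congr 1; omega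
    calc _ ≤ (|S| * L ^ k) * ((Kj + k * A * B) / L) := by gcongr
      _ = |S| * (Kj + k * A * B) * L ^ (k - 1) := by rw [hLk]; field_simp
      _ ≤ _ := le_mul_of_one_le_right (by positivity) (by linarith)
  refine (abs_sub_le _ _ _).trans ((add_le_add h1 h5).trans (le_of_eq ?_))
  ring

/-! ### The remainder and the final estimate -/

theorem exists_sum_abs_sieveWeight_le {k A : ℕ} (hk : 1 ≤ k) (hA : A ≠ 0)
    (hkA : ∀ p : ℕ, p.Prime → ¬ p ∣ A → k < p) (P : Polynomial ℝ) :
    ∃ K : ℝ, 0 ≤ K ∧ ∀ R : ℝ, 0 < R → 1 ≤ Real.log R →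
      ∑ d ∈ sieveSupport A R, |sieveWeight k A P R d| * (k : ℝ) ^ d.primeFactors.card ≤
        K * R * (1 + Real.log R) ^ (k + 1) := by
  obtain ⟨-, Kd, hKd0, hKd⟩ := sum_sieveDensity_asymptotic hk hA hkA
  obtain ⟨B, hB1, hB, -⟩ := polynomial_bound P
  set S := singularSeries k A with hS
  refine ⟨|S| * B * (|S⁻¹| + Kd), by positivity, fun R hR0 hL => ?_⟩
  have hR1 : 1 < R := by
    by_contra! h
    have := Real.log_nonpos hR0.le h
    linarith
  set L := Real.log R with hLdef
  have hM : ∀ m ∈ sieveSupport A R, |y k A P R m| ≤ |S| * B := by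
    intro m hm
    rw [y_eq_of_mem hR1 hm, abs_mul]
    obtain ⟨⟨h1, h2⟩, -⟩ := mem_sieveSupport.1 hm
    have hm1 : (1 : ℝ) ≤ m := by exact_mod_cast h1
    have hmR : (m : ℝ) ≤ R := (Nat.le_floor_iff hR0.le).1 h2
    have h3 : 0 ≤ Real.log m := Real.log_nonneg hm1
    have h4 : Real.log m ≤ L := Real.log_le_log (by linarith) hmR
    have h5 : Real.log m / L ≤ 1 := (div_le_one (by linarith)).2 h4
    have h6 : 0 ≤ Real.log m / L := by positivity
    gcongr
    exact (hB _ ⟨by linarith, by linarith⟩).1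
  refine (sum_abs_sieveWeight_le hk hkA P hR1.le hM (by positivity)).trans ?_
  -- The density accounts for k of the k + 1 logarithms; the last one comes from the sum over
  -- divisors in `sum_abs_sieveWeight_le`.
  have hd : ∑ m ∈ Ioc 0 ⌊R⌋₊, sieveDensity k A m ≤ (|S⁻¹| + Kd) * (1 + L) ^ k := by
    have h1 := (abs_le.1 (hKd R hR1.le)).2
    have h2 : S⁻¹ * (L ^ k / (k.factorial : ℝ)) ≤ |S⁻¹| * (1 + L) ^ k := by
      refine mul_le_mul (le_abs_self _) ?_ (by positivity) (abs_nonneg _)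
      refine (div_le_self (by positivity) ?_).trans (by gcongr; linarith)
      exact_mod_cast Nat.factorial_pos k
    have h3 : Kd * (1 + L) ^ (k - 1) ≤ Kd * (1 + L) ^ k := by
      gcongr
      · linarith
      · omega
    linarith
  calc _ ≤ |S| * B * (R * (1 + L)) * ((|S⁻¹| + Kd) * (1 + L) ^ k) := by gcongr
    _ = _ := by ring

theorem primesBetween_zero_eq {L u R : ℝ} (hL : 0 < L) (h : Real.exp (u * L) = R) (A : ℕ) :
    (Icc 1 ⌊R⌋₊).filter (fun p : ℕ => p.Prime ∧ ¬ p ∣ A) =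
      (primesBetween L 0 u).filter fun p => ¬ p ∣ A := by
  ext p
  simp only [primesBetween, mem_filter, h]
  constructor
  · rintro ⟨h1, h2, h3⟩
    exact ⟨⟨h1, h2, div_pos (Real.log_pos (by exact_mod_cast h2.one_lt)) hL⟩, h3⟩
  · rintro ⟨⟨h1, h2, -⟩, h3⟩
    exact ⟨h1, h2, h3⟩

/-- The estimate for the parameters `L = log R₂` and `u = log R₁ / log R₂`. -/
theorem weightedSum_asymptotic {k A : ℕ} (hk : 1 ≤ k) (hA : A ≠ 0)
    (hkA : ∀ p : ℕ, p.Prime → ¬ p ∣ A → k < p) (P : Polynomial ℝ) {W : ℝ → ℝ} {ρ : ℝ}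
    (hρ : 1 ≤ ρ) (hW : PiecewiseSmoothOn W 0 ρ) :
    ∃ K : ℝ, 0 ≤ K ∧ ∀ (a : Fin k → ℕ) (b : Fin k → ℤ), Normalised a b → ∏ i, a i = A →
      ∀ N R₂ u : ℝ, 1 ≤ N → 0 < R₂ → 1 ≤ Real.log R₂ → 1 ≤ u → u ≤ ρ →
      |weightedSum a b P W N (Real.exp (u * Real.log R₂)) R₂ -
        singularSeries k A * N * Real.log R₂ ^ k / ((k - 1).factorial : ℝ) * J₀ k P W u| ≤
      K * (N * (Real.log R₂ ^ (k - 1) * (1 + Real.log (u * Real.log R₂))) +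
        Real.exp (u * Real.log R₂) * R₂ ^ 2 * (1 + Real.log R₂) ^ (2 * k + 2)) := by
  obtain ⟨Km, hKm0, hKm⟩ := mainTerm_asymptotic hk hA hkA P hρ hW
  obtain ⟨Ks, hKs0, hKs⟩ := exists_sum_abs_sieveWeight_le hk hA hkA P
  obtain ⟨B, hB0, hB⟩ := hW.bounded
  refine ⟨Km + B * (3 * k) * Ks ^ 2, by positivity, ?_⟩
  rintro a b hab rfl N R₂ u hN hR₂ hL hu huρ
  set A := ∏ i, a i
  set L := Real.log R₂ with hLdef
  have hL0 : 0 < L := by linarith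
  have hW' : ∀ p ∈ Icc 1 ⌊Real.exp (u * L)⌋₊, p.Prime → |W (Real.log p / L)| ≤ B := by
    intro p hp hpp
    have h1 : p ∈ primesBetween L 0 u :=
      mem_filter.2 ⟨hp, hpp, div_pos (Real.log_pos (by exact_mod_cast hpp.one_lt)) hL0⟩
    obtain ⟨-, h2, h3⟩ := (mem_primesBetween hL0).1 h1
    exact hB _ ⟨h2.le, h3.trans huρ⟩
  have h1 := abs_weightedSum_sub_le hk hab P W (R₂ := R₂) hN (Real.exp_pos (u * L)).le hB0 hW'
  rw [primesBetween_zero_eq hL0 rfl] at h1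
  have h2 := hKm R₂ u hR₂ hL hu huρ
  set X := ∑ p ∈ primesBetween L 0 u with ¬ p ∣ A, W (Real.log p / L) *
    ((k / p : ℝ) * ∑ r ∈ Ioc 0 ⌊R₂⌋₊ with ¬ p ∣ r, sieveDensity k A r *
      (y k A P R₂ r - y k A P R₂ (r * p)) ^ 2) with hX
  set E := ∑ d ∈ sieveSupport A R₂, |sieveWeight k A P R₂ d| * (k : ℝ) ^ d.primeFactors.card with hE
  have hE0 : 0 ≤ E := Finset.sum_nonneg fun d _ => by positivity
  have h3 : E ≤ Ks * R₂ * (1 + L) ^ (k + 1) := hKs R₂ hR₂ hL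
  have h4 : 0 ≤ Real.log (u * L) := Real.log_nonneg (one_le_mul_of_one_le_of_one_le hu hL)
  have h5 : |N * X - singularSeries k A * N * L ^ k / ((k - 1).factorial : ℝ) * J₀ k P W u| ≤
      N * (Km * L ^ (k - 1) * (1 + Real.log (u * L))) := by
    have e : N * X - singularSeries k A * N * L ^ k / ((k - 1).factorial : ℝ) * J₀ k P W u =
        N * (X - singularSeries k A * L ^ k / ((k - 1).factorial : ℝ) * J₀ k P W u) := by ring
    rw [e, abs_mul, abs_of_nonneg (by linarith : 0 ≤ N)]
    gcongr
  have h6 : Real.exp (u * L) * (B * (3 * k)) * E ^ 2 ≤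
      B * (3 * k) * Ks ^ 2 * (Real.exp (u * L) * R₂ ^ 2 * (1 + L) ^ (2 * k + 2)) := by
    calc _ ≤ Real.exp (u * L) * (B * (3 * k)) * (Ks * R₂ * (1 + L) ^ (k + 1)) ^ 2 := by gcongr
      _ = _ := by ring
  have h7 : 0 ≤ B * (3 * k) * Ks ^ 2 * (N * (L ^ (k - 1) * (1 + Real.log (u * L)))) := by positivity
  have h8 : 0 ≤ Km * (Real.exp (u * L) * R₂ ^ 2 * (1 + L) ^ (2 * k + 2)) := by positivity
  refine (abs_sub_le _ (N * X) _).trans ?_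
  linarith

end WeightedSieve

theorem proposition1 (k : ℕ) (hk : 1 ≤ k) :
    ∃ C : ℝ, ∀ (A : ℕ) (P : Polynomial ℝ) (η ρ : ℝ) (W₀ : ℝ → ℝ), 0 < η → 0 < ρ →
      WeightedSieve.PiecewiseSmoothOn W₀ 0 ρ → (∀ x ∈ Set.Icc 0 ρ, 0 ≤ W₀ x) →
      ∃ K N₀ : ℝ, ∀ (a : Fin k → ℕ) (b : Fin k → ℤ),
        WeightedSieve.Normalised a b → ∏ i, a i = A →
        ∀ N r₁ r₂ R₁ R₂ : ℝ, N₀ ≤ N → R₁ = N ^ r₁ → R₂ = N ^ r₂ →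
          η ≤ r₂ → r₂ ≤ r₁ → r₁ / r₂ ≤ ρ →
          R₁ * R₂ ^ 2 ≤ N * (Real.log N) ^ (-C) →
          |WeightedSieve.weightedSum a b P W₀ N R₁ R₂ -
              WeightedSieve.singularSeries k A * N * (Real.log R₂) ^ k / ((k - 1).factorial : ℝ) *
                WeightedSieve.J₀ k P W₀ (r₁ / r₂)| ≤
            K * (N * (Real.log N) ^ (k - 1) * (Real.log (Real.log N)) ^ 2) := by
  -- C = 2k + 2 is the power of the logarithm in the remainder, the square of (1 + log R₂)^(k+1).
  refine ⟨((2 * k + 2 : ℕ) : ℝ), fun A P η ρ W hη hρ0 hW _ => ?_⟩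
  -- K and N₀ must be chosen before the linear forms and exponents are known. If one of these
  -- conditions fails, no admissible data exist and the claim is vacuous.
  by_cases hyp : 1 ≤ ρ ∧ A ≠ 0 ∧ ∀ p : ℕ, p.Prime → ¬ p ∣ A → k < p
  swap
  · refine ⟨0, 0, ?_⟩
    rintro a b hab rfl N r₁ r₂ R₁ R₂ - - - h₂ h₁ hr -
    have hr₂ : 0 < r₂ := by linarith
    exact absurd ⟨((one_le_div hr₂).2 h₁).trans hr,
      Finset.prod_ne_zero_iff.2 fun i _ => (hab.pos i).ne', fun p hp h => hab.lt_of_not_dvd hp h⟩ hyp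
  obtain ⟨hρ, hA, hkA⟩ := hyp
  obtain ⟨K, hK0, hK⟩ := WeightedSieve.weightedSum_asymptotic hk hA hkA P hρ hW
  -- The two thresholds ensure log log N ≥ 1 and log R₂ = r₂ log N ≥ 1. The summands 2 and 2^(2k+2)
  -- belong to the main-term error and to the remainder.
  refine ⟨K * (2 + 2 ^ (2 * k + 2)), max (Real.exp (Real.exp 1)) (Real.exp (1 / η)), ?_⟩
  intro a b hab hprod N r₁ r₂ R₁ R₂ hN hR₁ hR₂ h₂ h₁ hr hlevel
  have hr₂ : 0 < r₂ := by linarith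
  have hN₁ : Real.exp (Real.exp 1) ≤ N := (le_max_left _ _).trans hN
  have hN₂ : Real.exp (1 / η) ≤ N := (le_max_right _ _).trans hN
  have hN0 : 0 < N := (Real.exp_pos _).trans_le hN₁
  have hl : Real.exp 1 ≤ Real.log N := (Real.le_log_iff_exp_le hN0).2 hN₁
  have hlη : 1 / η ≤ Real.log N := (Real.le_log_iff_exp_le hN0).2 hN₂
  set l := Real.log N with hldef
  have he : (1 : ℝ) ≤ Real.exp 1 := Real.one_le_exp zero_le_one
  have hl1 : 1 ≤ l := he.trans hl
  have hl0 : 0 < l := by linarith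
  have hll : 1 ≤ Real.log l := (Real.le_log_iff_exp_le hl0).2 hl
  have hN1 : 1 ≤ N := by
    by_contra! h
    have := Real.log_nonpos hN0.le h.le
    linarith
  have hR₂0 : 0 < R₂ := hR₂ ▸ Real.rpow_pos_of_pos hN0 _
  have hR₁0 : 0 < R₁ := hR₁ ▸ Real.rpow_pos_of_pos hN0 _
  have hL₂ : Real.log R₂ = r₂ * l := by rw [hR₂, Real.log_rpow hN0]
  have hL₁ : Real.log R₁ = r₁ * l := by rw [hR₁, Real.log_rpow hN0]
  have hL : 1 ≤ Real.log R₂ := by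
    rw [hL₂]
    rw [div_le_iff₀ hη] at hlη
    nlinarith
  have huL : r₁ / r₂ * Real.log R₂ = r₁ * l := by
    rw [hL₂]
    field_simp
  have hexp : Real.exp (r₁ / r₂ * Real.log R₂) = R₁ := by
    rw [huL, ← hL₁, Real.exp_log hR₁0]
  rw [Real.rpow_neg hl0.le, Real.rpow_natCast] at hlevel
  have hlevel' : R₁ * R₂ ^ 2 * l ^ (2 * k + 2) ≤ N := by
    rwa [← div_eq_mul_inv, le_div_iff₀ (by positivity)] at hlevel
  -- The level condition bounds the exponents by 1, so log R₁ and log R₂ may be replaced by log N in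
  -- the error terms.
  have hsum : r₁ + 2 * r₂ ≤ 1 := by
    have h3 : R₁ * R₂ ^ 2 ≤ N :=
      le_trans (le_mul_of_one_le_right (by positivity) (one_le_pow₀ hl1)) hlevel'
    have h4 := Real.log_le_log (by positivity) h3
    rw [Real.log_mul hR₁0.ne' (by positivity), Real.log_pow, hL₁, hL₂] at h4
    push_cast at h4
    by_contra! h5
    nlinarith
  have hLl : Real.log R₂ ≤ l := by
    rw [hL₂]
    exact mul_le_of_le_one_left hl0.le (by linarith)
  have huL0 : 0 < r₁ * l := mul_pos (by linarith) hl0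
  have huLl : Real.log (r₁ * l) ≤ Real.log l :=
    Real.log_le_log huL0 (mul_le_of_le_one_left hl0.le (by linarith))
  have key := hK a b hab hprod N R₂ (r₁ / r₂) hN1 hR₂0 hL ((one_le_div hr₂).2 h₁) hr
  rw [hexp, huL] at key
  refine key.trans ?_
  rw [mul_assoc K]
  gcongr
  have h6 : N * (Real.log R₂ ^ (k - 1) * (1 + Real.log (r₁ * l))) ≤
      2 * (N * l ^ (k - 1) * Real.log l ^ 2) := by
    -- Only the first power of log log N is needed here; log log N ≥ 1 allows it to be squared.
    have h7 : 1 + Real.log (r₁ * l) ≤ 2 * Real.log l ^ 2 := by nlinarith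
    have h8 : 0 ≤ Real.log (r₁ * l) :=
      Real.log_nonneg ((hL₂ ▸ hL).trans (mul_le_mul_of_nonneg_right h₁ hl0.le))
    calc _ ≤ N * (l ^ (k - 1) * (2 * Real.log l ^ 2)) := by gcongr
      _ = _ := by ring
  have h8 : R₁ * R₂ ^ 2 * (1 + Real.log R₂) ^ (2 * k + 2) ≤
      2 ^ (2 * k + 2) * (N * l ^ (k - 1) * Real.log l ^ 2) := by
    calc _ ≤ R₁ * R₂ ^ 2 * (2 * l) ^ (2 * k + 2) := by
          gcongr
          linarith
      _ = 2 ^ (2 * k + 2) * (R₁ * R₂ ^ 2 * l ^ (2 * k + 2)) := by rw [mul_pow]; ring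
      _ ≤ 2 ^ (2 * k + 2) * N := by gcongr
      _ ≤ _ := by
          gcongr
          rw [mul_assoc]
          exact le_mul_of_one_le_right hN0.le
            (one_le_mul_of_one_le_of_one_le (one_le_pow₀ hl1) (one_le_pow₀ hll))
  linarith
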